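/- Work in Bounded Set Theory $\mathrm{BST}$, the theory in the language $\{\in,\operatorname{st}\}$ whose axioms are those of $\mathrm{ZFC}$ (Separation and Replacement for $\in$-formulas), Boundedness, Transfer, Standardization and Bounded Idealization (equivalently, interpret everything below in an arbitrary model of $\mathrm{BST}$). For a limited real $r$ let $\operatorname{sh}(r)$ be the unique standard real infinitely close to $r$, and let $\operatorname{sh}(t)=+\infty$ if $t\in[0,+\infty]$ is unlimited or $t=+\infty$. Let $I$ be a standard set and $w\in I$. A set $x$ is $w$-standard if $x=f(w)$ for some standard function $f$ with domain $I$; assume that $w$ is good, i.e. that there is $\nu\in\mathbb N$ which is $w$-standard but not standard. Let $(\Omega,\mathcal A,\mu)$ be an (internal) finitely additive measure space: $\mathcal A$ is an algebra of subsets of $\Omega$ and $\mu:\mathcal A\to[0,+\infty]$ is finitely additive with $\mu(\emptyset)=0$. Assume that $\Omega\subseteq O$ for a standard set $O$ and that $\Omega$, $\mathcal A$, $\mu$ are $w$-standard. For standard $f\in O^I$ let $f_w$ be the standard set whose standard elements are exactly the standard $g\in O^I$ with $g(w)=f(w)$. For $w$-standard $X\in\mathcal A$ let $[X]$ be the standard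 set whose standard elements are exactly the sets $f_w$ with $f\in O^I$ standard and $f(w)\in X$. Let $\mathcal B$ be the standard set whose standard elements are exactly the sets $[X]$ with $X\in\mathcal A$ $w$-standard. Then: 1. The sets $[X]$ (for $w$-standard $X\in\mathcal A$) and $\mathcal B$ exist and are unique, and there is a unique standard function $m:\mathcal B\to[0,+\infty]$ such that $m([X])=\operatorname{sh}(\mu(X))$ for all $w$-standard $X\in\mathcal A$. 2. $\mathcal B$ is an algebra of subsets of $[\Omega]$ and $m$ is a finitely additive measure on $\mathcal B$. 3. (Carath\'eodory's condition) If $\langle A_k\mid k\in\mathbb N\rangle$ is a sequence of mutually disjoint sets in $\mathcal B$, $A\in\mathcal B$ and $A=\bigcup_{k\in\mathbb N}A_k$, then $m(A)=\sum_{k\in\mathbb N}m(A_k)$. 4. Let $\overline{\mathcal B}$ be the $\sigma$-algebra of subsets of $[\Omega]$ generated by $\mathcal B$. It is standard, and $m$ extends to a standard $\sigma$-additive measure $\overline m:\overline{\mathcal B}\to[0,+\infty]$. The completion $([\Omega],\widehat{\mathcal B},\widehat m)$ of $([\Omega],\overline{\mathcal B},\overline m)$ (the Loeb measure space) is a standard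 complete $\sigma$-additive measure space, and $\widehat m$ extends $\overline m$. -/

import Mathlib

open Set

universe u

/-! ## Bounded Set Theory: structures for the st-membership language -/

/-- A structure for the language with the binary relation symbol "membership" and the unary
predicate symbol "standard".  Its elements are the (internal) sets of the universe. -/
class StUniverse (V : Type u) where
  mem : V → V → Prop
  st : V → Prop

/-- Membership of the universe of sets (not Lean's membership). -/
infix:50 " ∈ᵥ " => StUniverse.mem

/-- The only symbol of the language of set theory: membership. -/
inductive MemRel : ℕ → Type
  | mem : MemRel 2

/-- The symbols of the language of internal set theory: membership and standardness. -/
inductive StMemRel : ℕ → Type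
  | mem : StMemRel 2
  | st : StMemRel 1

/-- The first-order language of set theory. -/
def memLanguage : FirstOrder.Language.{0, 0} := ⟨fun _ => Empty, MemRel⟩

/-- The first-order language of internal set theory. -/
def stMemLanguage : FirstOrder.Language.{0, 0} := ⟨fun _ => Empty, StMemRel⟩

instance memStructure (V : Type u) [StUniverse V] : memLanguage.Structure V where
  funMap := fun f _ => Empty.elim f
  RelMap := fun {_} r => match r with
    | MemRel.mem => fun x => x 0 ∈ᵥ x 1

instance stMemStructure (V : Type u) [StUniverse V] : stMemLanguage.Structure V where
  funMap := fun f _ => Empty.elim f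
  RelMap := fun {_} r => match r with
    | StMemRel.mem => fun x => x 0 ∈ᵥ x 1
    | StMemRel.st => fun x => StUniverse.st (x 0)

section SetTheory

variable {V : Type u} [StUniverse V]

/-- `x` is a standard set. -/
abbrev IsStd (x : V) : Prop := StUniverse.st x

/-- `a ⊆ b`. -/
def SubV (a b : V) : Prop := ∀ x, x ∈ᵥ a → x ∈ᵥ b

/-- `a = ∅`. -/
def EmptyV (a : V) : Prop := ∀ x, ¬ x ∈ᵥ a

/-- `p = {a, b}`. -/
def IsPairSet (p a b : V) : Prop := ∀ x, x ∈ᵥ p ↔ x = a ∨ x = b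

/-- `c = a ∪ {b}`. -/
def IsAdjoin (c a b : V) : Prop := ∀ x, x ∈ᵥ c ↔ x ∈ᵥ a ∨ x = b

/-- `c = a ∪ b`. -/
def IsUnionV (c a b : V) : Prop := ∀ x, x ∈ᵥ c ↔ x ∈ᵥ a ∨ x ∈ᵥ b

/-- `c = a \ b`. -/
def IsDiffV (c a b : V) : Prop := ∀ x, x ∈ᵥ c ↔ x ∈ᵥ a ∧ ¬ x ∈ᵥ b

/-- `a ∩ b = ∅`. -/
def DisjV (a b : V) : Prop := ∀ x, ¬ (x ∈ᵥ a ∧ x ∈ᵥ b)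

/-- `a` is finite in the sense of the universe: it belongs to every set that contains `∅` and is
closed under adjoining one element of `a`. -/
def FiniteV (a : V) : Prop :=
  ∀ F : V, (∀ e, EmptyV e → e ∈ᵥ F) →
    (∀ b x c, b ∈ᵥ F → x ∈ᵥ a → IsAdjoin c b x → c ∈ᵥ F) → a ∈ᵥ F

/-- `p = ⟨a, b⟩ = {{a}, {a, b}}`. -/
def IsOPair (p a b : V) : Prop :=
  ∃ s t, IsPairSet s a a ∧ IsPairSet t a b ∧ IsPairSet p s t

/-- `⟨x, y⟩ ∈ f`; when `f` is a function this says `f(x) = y`. -/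
def MapsV (f x y : V) : Prop := ∃ p, IsOPair p x y ∧ p ∈ᵥ f

/-- `f` is a function with domain `a`. -/
def IsFunOn (f a : V) : Prop :=
  (∀ p, p ∈ᵥ f → ∃ x y, x ∈ᵥ a ∧ IsOPair p x y) ∧ ∀ x, x ∈ᵥ a → ∃! y, MapsV f x y

/-- `f` is a function from `a` to `b`, that is, `f ∈ b ^ a`. -/
def IsFun (f a b : V) : Prop := IsFunOn f a ∧ ∀ x y, MapsV f x y → y ∈ᵥ b

end SetTheory

/-- The axioms of `ZFC`; the schemata are for formulas of the language of set theory, with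
arbitrary parameters. -/
structure IsZFC (V : Type u) [StUniverse V] : Prop where
  extensionality : ∀ a b : V, (∀ x, x ∈ᵥ a ↔ x ∈ᵥ b) → a = b
  foundation : ∀ a : V, (∃ x, x ∈ᵥ a) → ∃ x, x ∈ᵥ a ∧ DisjV x a
  pairing : ∀ a b : V, ∃ p, IsPairSet p a b
  union : ∀ a : V, ∃ b, ∀ x, x ∈ᵥ b ↔ ∃ y, y ∈ᵥ a ∧ x ∈ᵥ y
  powerset : ∀ a : V, ∃ b, ∀ x, x ∈ᵥ b ↔ SubV x a
  infinity : ∃ a : V, (∃ e, EmptyV e ∧ e ∈ᵥ a) ∧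
    ∀ x, x ∈ᵥ a → ∃ y, IsAdjoin y x x ∧ y ∈ᵥ a
  separation : ∀ P : Set V, (univ : Set V).Definable₁ memLanguage P →
    ∀ a : V, ∃ b, ∀ x, x ∈ᵥ b ↔ x ∈ᵥ a ∧ x ∈ P
  replacement : ∀ P : Set (V × V), (univ : Set V).Definable₂ memLanguage P →
    ∀ a : V, (∀ x, x ∈ᵥ a → ∃! y, (x, y) ∈ P) →
      ∃ b, ∀ y, y ∈ᵥ b ↔ ∃ x, x ∈ᵥ a ∧ (x, y) ∈ P
  choice : ∀ a : V, (∀ x, x ∈ᵥ a → ∃ z, z ∈ᵥ x) →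
    (∀ x y, x ∈ᵥ a → y ∈ᵥ a → x ≠ y → DisjV x y) →
      ∃ c, ∀ x, x ∈ᵥ a → ∃! z, z ∈ᵥ x ∧ z ∈ᵥ c

/-- The axioms of Bounded Set Theory `BST`. -/
structure IsBST (V : Type u) [StUniverse V] : Prop extends IsZFC V where
  boundedness : ∀ x : V, ∃ y, IsStd y ∧ x ∈ᵥ y
  /-- for formulas of the language of set theory with standard parameters -/
  transfer : ∀ P : Set V, {x : V | IsStd x}.Definable₁ memLanguage P →
    (∀ x, IsStd x → x ∈ P) → ∀ x, x ∈ P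
  /-- for formulas of the language of internal set theory with arbitrary parameters -/
  standardization : ∀ P : Set V, (univ : Set V).Definable₁ stMemLanguage P →
    ∀ a : V, ∃ s, IsStd s ∧ ∀ x, IsStd x → (x ∈ᵥ s ↔ x ∈ᵥ a ∧ x ∈ P)
  /-- for formulas of the language of set theory with arbitrary parameters -/
  idealization : ∀ P : Set (V × V), (univ : Set V).Definable₂ memLanguage P →
    ∀ A : V, IsStd A →
      ((∀ a, IsStd a → FiniteV a → SubV a A → ∃ y, ∀ x, x ∈ᵥ a → (x, y) ∈ P) ↔
        ∃ y, ∀ x, IsStd x → x ∈ᵥ A → (x, y) ∈ P)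

/-! ## The real numbers of the universe -/

/-- The elements of a set of the universe, as a type. -/
abbrev El {V : Type u} [StUniverse V] (a : V) : Type u := {x : V // x ∈ᵥ a}

/-- The real numbers, the natural numbers and the symbol `+∞` of the universe: a standard
complete ordered field `ℝ` (with standard operations and order; completeness is with respect to
the subsets of `ℝ` that are sets of the universe), its least inductive subset `ℕ`, and a standard
object `+∞` outside `ℝ`.  By `ZFC` in the universe, these exist and are unique up to a unique
isomorphism. -/
structure RealNumbers (V : Type u) [StUniverse V] where
  carrier : V
  [instField : Field (El carrier)]
  [instLinearOrder : LinearOrder (El carrier)]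
  [instIsStrictOrderedRing : IsStrictOrderedRing (El carrier)]
  /-- the graphs of the operations and of the order, as sets of the universe -/
  addGraph : V
  mulGraph : V
  leGraph : V
  mem_addGraph : ∀ a b c : El carrier,
    (∃ p, IsOPair p a.1 b.1 ∧ MapsV addGraph p c.1) ↔ a + b = c
  mem_mulGraph : ∀ a b c : El carrier,
    (∃ p, IsOPair p a.1 b.1 ∧ MapsV mulGraph p c.1) ↔ a * b = c
  mem_leGraph : ∀ a b : El carrier, MapsV leGraph a.1 b.1 ↔ a ≤ b
  complete : ∀ S : V, SubV S carrier → (∃ x, x ∈ᵥ S) →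
    BddAbove {r : El carrier | r.1 ∈ᵥ S} → ∃ b, IsLUB {r : El carrier | r.1 ∈ᵥ S} b
  nat : V
  nat_sub : SubV nat carrier
  zero_mem_nat : (0 : El carrier).1 ∈ᵥ nat
  succ_mem_nat : ∀ k : El carrier, k.1 ∈ᵥ nat → (k + 1).1 ∈ᵥ nat
  nat_least : ∀ T : V, (0 : El carrier).1 ∈ᵥ T →
    (∀ k : El carrier, k.1 ∈ᵥ T → (k + 1).1 ∈ᵥ T) → SubV nat T
  infty : V
  infty_notMem : ¬ infty ∈ᵥ carrier
  std_carrier : IsStd carrier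
  std_addGraph : IsStd addGraph
  std_mulGraph : IsStd mulGraph
  std_leGraph : IsStd leGraph
  std_nat : IsStd nat
  std_infty : IsStd infty

attribute [instance] RealNumbers.instField RealNumbers.instLinearOrder
  RealNumbers.instIsStrictOrderedRing

namespace RealNumbers

variable {V : Type u} [StUniverse V] (R : RealNumbers V)

/-- The extended reals `ℝ ∪ {+∞}`, with `r + (+∞) = +∞` and `r ≤ +∞`. -/
abbrev Ext : Type u := WithTop (El R.carrier)

/-- An extended real as a set of the universe. -/
def code : R.Ext → V
  | none => R.infty
  | some r => r.1

/-- `f(x) = t` for a function `f` of the universe and an extended real `t`. -/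
def Val (f x : V) (t : R.Ext) : Prop := MapsV f x (R.code t)

/-- `f` is a function of the universe from `a` to `[0, +∞]`. -/
def IsExtFun (f a : V) : Prop :=
  IsFunOn f a ∧ ∀ x y, MapsV f x y → ∃ t : R.Ext, 0 ≤ t ∧ y = R.code t

/-- `u = sh(t)` for `t ∈ [0, +∞]`: if `t` is a limited real, its shadow is the standard real
infinitely close to it; if `t` is unlimited or `+∞`, its shadow is `+∞`. -/
def IsShadow (t u : R.Ext) : Prop :=
  (∃ r s : El R.carrier, t = r ∧ u = s ∧ IsStd s.1 ∧
    ∀ n : El R.carrier, n.1 ∈ᵥ R.nat → IsStd n.1 → n ≠ 0 → |r - s| < 1 / n) ∨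
  (u = ⊤ ∧ ∀ n : El R.carrier, n.1 ∈ᵥ R.nat → IsStd n.1 → (n : R.Ext) ≤ t)

/-! ### Measure theory of the universe -/

/-- `A` is a sequence `⟨A_k | k ∈ ℕ⟩` (of the universe) of members of `S`. -/
def IsSeq (A S : V) : Prop := IsFun A R.nat S

/-- The members of the sequence `A` are mutually disjoint. -/
def DisjSeq (A : V) : Prop :=
  ∀ k l X Y, k ∈ᵥ R.nat → l ∈ᵥ R.nat → k ≠ l → MapsV A k X → MapsV A l Y → DisjV X Y

/-- `W` is the union of the members of the sequence `A`. -/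
def IsUnionSeq (W A : V) : Prop :=
  ∀ x, x ∈ᵥ W ↔ ∃ k X, k ∈ᵥ R.nat ∧ MapsV A k X ∧ x ∈ᵥ X

/-- `t` is the sum in `[0, +∞]` of the series with terms `m(A_k)`, `k ∈ ℕ`: the least upper bound
of the sequence `s` of its partial sums, `s(0) = 0` and `s(k + 1) = s(k) + m(A_k)`. -/
def IsSeriesSum (m A : V) (t : R.Ext) : Prop :=
  ∃ s, R.IsExtFun s R.nat ∧ R.Val s (0 : El R.carrier).1 0 ∧
    (∀ (k : El R.carrier) (X : V) (x y : R.Ext), k.1 ∈ᵥ R.nat → MapsV A k.1 X → R.Val m X x →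
      R.Val s k.1 y → R.Val s (k + 1).1 (y + x)) ∧
    IsLUB {y : R.Ext | ∃ k, k ∈ᵥ R.nat ∧ R.Val s k y} t

/-- `S` is an algebra of subsets of `Ω`. -/
structure IsAlgebraOn (Ω S : V) : Prop where
  sub : ∀ X, X ∈ᵥ S → SubV X Ω
  whole : Ω ∈ᵥ S
  compl : ∀ X Y, X ∈ᵥ S → IsDiffV Y Ω X → Y ∈ᵥ S
  union : ∀ X Y Z, X ∈ᵥ S → Y ∈ᵥ S → IsUnionV Z X Y → Z ∈ᵥ S

/-- `(Ω, S, m)` is a finitely additive measure space, with values in `[0, +∞]`. -/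
structure IsFinAddSpace (Ω S m : V) : Prop where
  alg : IsAlgebraOn Ω S
  isExtFun : R.IsExtFun m S
  empty : ∀ E, EmptyV E → R.Val m E 0
  additive : ∀ (X Y Z : V) (x y : R.Ext), X ∈ᵥ S → Y ∈ᵥ S → DisjV X Y → IsUnionV Z X Y →
    R.Val m X x → R.Val m Y y → R.Val m Z (x + y)

/-- If the union of a mutually disjoint sequence of members of `S` is a member of `S`, then its
measure is the sum of the measures. -/
def CountablyAdditive (S m : V) : Prop :=
  ∀ A W : V, R.IsSeq A S → R.DisjSeq A → W ∈ᵥ S → R.IsUnionSeq W A →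
    ∃ t, R.Val m W t ∧ R.IsSeriesSum m A t

/-- `S` is a σ-algebra of subsets of `Ω`. -/
structure IsSigmaAlgebraOn (Ω S : V) : Prop where
  alg : IsAlgebraOn Ω S
  seqUnion : ∀ A W, R.IsSeq A S → R.IsUnionSeq W A → W ∈ᵥ S

/-- `S` is the σ-algebra of subsets of `Ω` generated by `B`. -/
structure IsGeneratedBy (Ω B S : V) : Prop where
  sigma : R.IsSigmaAlgebraOn Ω S
  sub : SubV B S
  least : ∀ T, R.IsSigmaAlgebraOn Ω T → SubV B T → SubV S T

/-- `(Ω, S, m)` is a (σ-additive) measure space, with values in `[0, +∞]`. -/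
structure IsMeasureSpaceOn (Ω S m : V) : Prop where
  sigma : R.IsSigmaAlgebraOn Ω S
  isExtFun : R.IsExtFun m S
  empty : ∀ E, EmptyV E → R.Val m E 0
  sigmaAdditive : R.CountablyAdditive S m

/-- There are members `X ⊆ Y ⊆ Z` of `S` with `m(Z \ X) = 0`. -/
def Squeezed (S m X Y Z : V) : Prop :=
  X ∈ᵥ S ∧ Z ∈ᵥ S ∧ SubV X Y ∧ SubV Y Z ∧ ∃ D, IsDiffV D Z X ∧ R.Val m D 0

/-- `(Ω, S', m')` is the completion of the measure space `(Ω, S, m)`: `S'` consists of the sets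
`Y` with `X ⊆ Y ⊆ Z` for some `X, Z ∈ S` with `m(Z \ X) = 0`, and then `m'(Y) = m(X)`. -/
structure IsCompletionOf (S' m' S m : V) : Prop where
  mem_iff : ∀ Y, Y ∈ᵥ S' ↔ ∃ X Z, R.Squeezed S m X Y Z
  isExtFun : R.IsExtFun m' S'
  val : ∀ (X Y Z : V) (t : R.Ext), R.Squeezed S m X Y Z → R.Val m X t → R.Val m' Y t

/-- Every subset of a set of measure zero is measurable. -/
def IsCompleteMeasure (S m : V) : Prop :=
  ∀ X Y, X ∈ᵥ S → R.Val m X 0 → SubV Y X → Y ∈ᵥ S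

end RealNumbers

/-! ## Relative standardness and coding by standard sets -/

section Coding

variable {V : Type u} [StUniverse V]

/-- `x` is `w`-standard (`w` is an element of the standard set `I`): `x = f(w)` for some standard
function `f` with domain `I`. -/
def StdRel (I w x : V) : Prop := ∃ f, IsStd f ∧ IsFunOn f I ∧ MapsV f w x

/-- `w` is good: some natural number is `w`-standard but not standard. -/
def Good (R : RealNumbers V) (I w : V) : Prop :=
  ∃ ν, ν ∈ᵥ R.nat ∧ StdRel I w ν ∧ ¬ IsStd ν

/-- `F = f_w`, the standard set whose standard elements are the standard `g ∈ O ^ I` with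
`g(w) = f(w)`. -/
def IsGermOf (O I w f F : V) : Prop :=
  IsStd F ∧ ∀ g, IsStd g → (g ∈ᵥ F ↔ IsFun g I O ∧ ∃ y, MapsV f w y ∧ MapsV g w y)

/-- `C = [X]`, the standard set whose standard elements are the `f_w` for standard `f ∈ O ^ I`
such that `f(w)` is a (`w`-standard) element of `X`. -/
def IsCodeOf (O I w X C : V) : Prop :=
  IsStd C ∧ ∀ F, IsStd F → (F ∈ᵥ C ↔ ∃ f x, IsStd f ∧ IsFun f I O ∧ IsGermOf O I w f F ∧
    MapsV f w x ∧ x ∈ᵥ X ∧ StdRel I w x)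

/-- `B` is the standard set whose standard elements are the `[X]` for `w`-standard `X ∈ 𝒜`. -/
def IsCodedAlgebra (O I w 𝒜 B : V) : Prop :=
  IsStd B ∧ ∀ A, IsStd A → (A ∈ᵥ B ↔ ∃ X, X ∈ᵥ 𝒜 ∧ StdRel I w X ∧ IsCodeOf O I w X A)

/-- `m` is a standard function from `B` to `[0, +∞]` such that `m([X]) = sh(μ(X))` for all
`w`-standard `X ∈ 𝒜`. -/
def IsCodedMeasure (R : RealNumbers V) (O I w 𝒜 μ B m : V) : Prop :=
  IsStd m ∧ R.IsExtFun m B ∧ ∀ X A, X ∈ᵥ 𝒜 → StdRel I w X → IsCodeOf O I w X A →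
    ∃ t s : R.Ext, R.Val μ X t ∧ R.IsShadow t s ∧ R.Val m A s

end Coding

/-! The coding `X ↦ [X]` is an isomorphism of Boolean algebras from the `w`-standard members of `𝒜`
onto the standard members of `B`. A `w`-standard element of `O` is determined by the germ of the
standard functions that take it as value at `w` (`IsGermAt.inj`), and a nonempty set definable from
`w` and standard parameters has a `w`-standard element (`exists_stdRel`), so inclusion of codes
reflects inclusion of sets (`subV_of_codeV_subV`). Hence `sh(μ(X))` depends only on `[X]`, and
Standardization turns this correspondence into a standard function `m`. The algebra laws and finite
additivity hold for the standard members of `B`, because coding respects the set operations and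
shadows are additive (`IsShadow.add`). Transfer extends them to all members.

Goodness of `w` supplies the countable part (`exists_bound_of_isStd`). A standard increasing
sequence in `B` with measures at most a standard `t` can be written `A_k = [Φ_k(w)]` at standard
`k`, for one standard sequence `Φ`. For each standard `n` the sets `Φ_k(w)` with `k ≤ n` are
increasing members of `𝒜` with `μ(Φ_k(w)) ≤ t + 1/(k+1)`. This condition on `n` is internal and
definable from `w`. If `ν` is a nonstandard `w`-standard natural number, the largest such `n ≤ ν` is
definable from `w`, hence `w`-standard, and it lies above every standard natural number. Then
`[Φ_n(w)]` is a member of `B` that contains every `A_k` and has measure at most `t`. By Transfer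
this gives `IncreasingBounded` for all sequences.

What remains is measure theory inside the universe. Under `IncreasingBounded` the outer measure
built from single covers by members of `B` is continuous along increasing unions
(`outer_iUnion_le`). So the Carathéodory-measurable sets form a σ-algebra containing `B`, and the
outer measure is countably additive on its subalgebras (`countablyAdditive_of_subV_caraV`).
Restricting it to `B`, to the generated σ-algebra and to the completion gives the last two
assertions. These objects are defined explicitly from standard ones, hence are standard.

The schemata of the theory speak about definable sets, so every application needs a proof of
definability. The predicates `D` and `DF` are a compositional calculus for such proofs, which
`D.auto` carries out. -/

set_option linter.unusedSectionVars false

/-! ## A calculus of definable predicates and maps -/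

/-- A type whose elements are coded by finite tuples of elements of `V`. -/
class Coded (V : Type u) (τ : Type*) where
  ι : Type
  [fin : Finite ι]
  enc : τ → ι → V
  enc_inj : Function.Injective enc

attribute [instance] Coded.fin

section Calculus

variable {V : Type u} [StUniverse V]

instance Coded.self : Coded V V where
  ι := Unit
  enc := fun x _ => x
  enc_inj := fun _ _ h => congrFun h ()

instance Coded.el (a : V) : Coded V (El a) where
  ι := Unit
  enc := fun x _ => x.1
  enc_inj := fun _ _ h => Subtype.ext (congrFun h ())

instance Coded.prod {σ τ : Type*} [Coded V σ] [Coded V τ] : Coded V (σ × τ) where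
  ι := Coded.ι V σ ⊕ Coded.ι V τ
  enc := fun p => Sum.elim (Coded.enc p.1) (Coded.enc p.2)
  enc_inj := fun p q h => by
    have h₁ : Coded.enc (V := V) p.1 = Coded.enc q.1 := by
      funext i; exact congrFun h (Sum.inl i)
    have h₂ : Coded.enc (V := V) p.2 = Coded.enc q.2 := by
      funext i; exact congrFun h (Sum.inr i)
    exact Prod.ext (Coded.enc_inj h₁) (Coded.enc_inj h₂)

theorem RealNumbers.code_injective (R : RealNumbers V) : Function.Injective R.code := by
  intro s t h
  induction s using WithTop.recTopCoe with
  | top =>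
    induction t using WithTop.recTopCoe with
    | top => rfl
    | coe t =>
      have e : R.infty = t.1 := h
      exact absurd (e ▸ t.2) R.infty_notMem
  | coe s =>
    induction t using WithTop.recTopCoe with
    | top =>
      have e : s.1 = R.infty := h
      exact absurd (e ▸ s.2) R.infty_notMem
    | coe t => exact congrArg _ (Subtype.ext h)

instance Coded.ext (R : RealNumbers V) : Coded V (WithTop (El R.carrier)) where
  ι := Unit
  enc := fun x _ => R.code x
  enc_inj := fun _ _ h => R.code_injective (congrFun h ())

/-- A language in which the membership relation of `V` is definable. -/
class MemLang (L : FirstOrder.Language.{0, 0}) (V : Type u) [StUniverse V] [L.Structure V] :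
    Prop where
  definable_mem : ∀ A : Set V, A.Definable L {v : Fin 2 → V | v 0 ∈ᵥ v 1}

theorem definable_rel {L : FirstOrder.Language.{0, 0}} [L.Structure V] {k : ℕ}
    (r : L.Relations k) (A : Set V) :
    A.Definable L {v : Fin k → V | FirstOrder.Language.Structure.RelMap r v} := by
  refine Set.definable_iff_exists_formula_sum.2
    ⟨r.formula fun i => FirstOrder.Language.Term.var (Sum.inr i), ?_⟩
  ext v
  simp [FirstOrder.Language.Formula.realize_rel]

instance : MemLang memLanguage V where
  definable_mem := fun A => definable_rel (L := memLanguage) (k := 2) MemRel.mem A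

instance : MemLang stMemLanguage V where
  definable_mem := fun A => definable_rel (L := stMemLanguage) (k := 2) StMemRel.mem A

variable (V) in
/-- The set of standard elements. -/
abbrev StdSet : Set V := {x | IsStd x}

/-- A parameter set containing all standard elements. -/
class StdSub (A : Set V) : Prop where
  sub : ∀ x, IsStd x → x ∈ A

instance : StdSub (univ : Set V) := ⟨fun _ _ => trivial⟩
instance : StdSub (StdSet V) := ⟨fun _ h => h⟩
instance (w : V) : StdSub (insert w (StdSet V)) := ⟨fun _ h => Or.inr h⟩

variable (L : FirstOrder.Language.{0, 0}) [L.Structure V] (A : Set V)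

/-- `P` is definable in the language `L` with parameters from `A`. -/
def D {σ : Type*} [Coded V σ] (P : σ → Prop) : Prop :=
  ∃ Q : Set (Coded.ι V σ → V), A.Definable L Q ∧ ∀ x, P x ↔ Coded.enc x ∈ Q

/-- The graph of `f` is definable in the language `L` with parameters from `A`. -/
def DF {σ τ : Type*} [Coded V σ] [Coded V τ] (f : σ → τ) : Prop :=
  ∃ Q : Set (Coded.ι V σ ⊕ Coded.ι V τ → V), A.Definable L Q ∧
    ∀ x u, Sum.elim (Coded.enc x) u ∈ Q ↔ u = Coded.enc (f x)

/-- The set of codes of elements of `τ` is definable. -/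
class DRange (τ : Type*) [Coded V τ] : Prop where
  range : A.Definable L {u | ∃ x : τ, u = Coded.enc x}

variable {L A} {ρ σ τ : Type*} [Coded V ρ] [Coded V σ] [Coded V τ]

theorem D.congr {P Q : σ → Prop} (hP : D L A P) (h : ∀ x, Q x ↔ P x) : D L A Q :=
  (funext fun x => propext (h x) : Q = P) ▸ hP

theorem DF.congr {f g : σ → τ} (hf : DF L A f) (h : ∀ x, g x = f x) : DF L A g :=
  (funext h : g = f) ▸ hf

theorem D.mono {B : Set V} {P : σ → Prop} (hP : D L A P) (h : A ⊆ B) : D L B P :=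
  let ⟨Q, hQ, h'⟩ := hP
  ⟨Q, hQ.mono h, h'⟩

theorem D.and {P Q : σ → Prop} (hP : D L A P) (hQ : D L A Q) : D L A fun x => P x ∧ Q x := by
  obtain ⟨P', hP', h₁⟩ := hP
  obtain ⟨Q', hQ', h₂⟩ := hQ
  exact ⟨P' ∩ Q', hP'.inter hQ', fun x => and_congr (h₁ x) (h₂ x)⟩

theorem D.not {P : σ → Prop} (hP : D L A P) : D L A fun x => ¬ P x := by
  obtain ⟨P', hP', h₁⟩ := hP
  exact ⟨P'ᶜ, hP'.compl, fun x => not_congr (h₁ x)⟩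

theorem D.or {P Q : σ → Prop} (hP : D L A P) (hQ : D L A Q) : D L A fun x => P x ∨ Q x :=
  (hP.not.and hQ.not).not.congr fun x => by tauto

theorem D.imp {P Q : σ → Prop} (hP : D L A P) (hQ : D L A Q) : D L A fun x => P x → Q x :=
  (hP.and hQ.not).not.congr fun x => by tauto

theorem D.iff {P Q : σ → Prop} (hP : D L A P) (hQ : D L A Q) : D L A fun x => P x ↔ Q x :=
  ((hP.imp hQ).and (hQ.imp hP)).congr fun x => by tauto

/-- The defining set is everything or nothing, so a side condition that does not depend on the
variables, even an external one, needs no parameters. -/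
theorem D.const (p : Prop) : D L A fun _ : σ => p := by
  by_cases hp : p
  · exact ⟨univ, definable_univ, by simp [hp]⟩
  · exact ⟨∅, definable_empty, by simp [hp]⟩

/-- Substitution is an existential quantifier over the value: the graph of `f` is intersected with
the set defining `P`, and the value coordinates are projected away. Codes are finite tuples, so this
projection is first-order. -/
theorem D.comp {P : τ → Prop} {f : σ → τ} (hP : D L A P) (hf : DF L A f) :
    D L A fun x => P (f x) := by
  obtain ⟨P', hP', h₁⟩ := hP
  obtain ⟨Q, hQ, h₂⟩ := hf
  refine ⟨_, (hQ.inter (hP'.preimage_comp Sum.inr)).image_comp Sum.inl, fun x => ?_⟩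
  constructor
  · intro hx
    exact ⟨Sum.elim (Coded.enc x) (Coded.enc (f x)), ⟨(h₂ _ _).2 rfl, (h₁ _).1 hx⟩, rfl⟩
  · rintro ⟨u, ⟨hu, hu'⟩, hux⟩
    have e : u = Sum.elim (Coded.enc x) (u ∘ Sum.inr) := by
      rw [← hux]; exact (Sum.elim_comp_inl_inr u).symm
    rw [e] at hu
    have := (h₂ _ _).1 hu
    rw [h₁, ← this]
    exact hu'

theorem definable_eq_coord {α : Type*} (i j : α) : A.Definable L {v : α → V | v i = v j} := by
  refine Set.definable_iff_exists_formula_sum.2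
    ⟨(FirstOrder.Language.Term.var (Sum.inr i)).equal (FirstOrder.Language.Term.var (Sum.inr j)),
      ?_⟩
  ext v
  simp [FirstOrder.Language.Formula.realize_equal]

theorem definable_eq_coords {α β : Type*} [Finite β] (i j : β → α) :
    A.Definable L {v : α → V | v ∘ i = v ∘ j} := by
  have := definable_iInter_of_finite (A := A) (L := L) (M := V)
    (f := fun b : β => {v : α → V | v (i b) = v (j b)}) fun b => definable_eq_coord _ _
  convert this using 1
  ext v
  simp [funext_iff]

theorem DF.id : DF L A fun x : σ => x :=
  ⟨{v | v ∘ Sum.inr = v ∘ Sum.inl}, definable_eq_coords _ _, fun _ _ => Iff.rfl⟩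

theorem DF.comp {g : σ → τ} {f : ρ → σ} (hg : DF L A g) (hf : DF L A f) :
    DF L A fun x => g (f x) := by
  obtain ⟨G, hG, h₁⟩ := hg
  obtain ⟨F, hF, h₂⟩ := hf
  refine ⟨_, ((hF.preimage_comp (β := (Coded.ι V ρ ⊕ Coded.ι V τ) ⊕ Coded.ι V σ)
    (Sum.elim (Sum.inl ∘ Sum.inl) Sum.inr)).inter
    (hG.preimage_comp (Sum.elim Sum.inr (Sum.inl ∘ Sum.inr)))).image_comp Sum.inl,
    fun x u => ?_⟩
  constructor
  · rintro ⟨v, ⟨hv, hv'⟩, hvx⟩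
    have e₁ : v ∘ Sum.elim (Sum.inl ∘ Sum.inl) Sum.inr =
        Sum.elim (Coded.enc x) (v ∘ Sum.inr) := by
      funext i
      cases i with
      | inl i => exact congrFun hvx (Sum.inl i)
      | inr i => rfl
    have e₂ : v ∘ Sum.elim Sum.inr (Sum.inl ∘ Sum.inr) = Sum.elim (v ∘ Sum.inr) u := by
      funext i
      cases i with
      | inl i => rfl
      | inr i => exact congrFun hvx (Sum.inr i)
    rw [mem_preimage, e₁, h₂] at hv
    rw [mem_preimage, e₂, hv, h₁] at hv'
    exact hv'
  · rintro rfl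
    refine ⟨Sum.elim (Sum.elim (Coded.enc x) (Coded.enc (g (f x)))) (Coded.enc (f x)), ⟨?_, ?_⟩,
      rfl⟩
    · rw [mem_preimage, Sum.comp_elim]
      exact (h₂ x _).2 rfl
    · rw [mem_preimage, Sum.comp_elim]
      exact (h₁ _ _).2 rfl

theorem DF.fst {f : ρ → σ × τ} (hf : DF L A f) : DF L A fun x => (f x).1 := by
  refine DF.comp (g := Prod.fst) ?_ hf
  exact ⟨{v | v ∘ Sum.inr = v ∘ (Sum.inl ∘ Sum.inl)}, definable_eq_coords _ _,
    fun _ _ => Iff.rfl⟩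

theorem DF.snd {f : ρ → σ × τ} (hf : DF L A f) : DF L A fun x => (f x).2 := by
  refine DF.comp (g := Prod.snd) ?_ hf
  exact ⟨{v | v ∘ Sum.inr = v ∘ (Sum.inl ∘ Sum.inr)}, definable_eq_coords _ _,
    fun _ _ => Iff.rfl⟩

theorem DF.pair {f : ρ → σ} {g : ρ → τ} (hf : DF L A f) (hg : DF L A g) :
    DF L A fun x => (f x, g x) := by
  obtain ⟨F, hF, h₁⟩ := hf
  obtain ⟨G, hG, h₂⟩ := hg
  refine ⟨_, (hF.preimage_comp (Sum.map _root_.id Sum.inl)).inter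
    (hG.preimage_comp (Sum.map _root_.id Sum.inr)), fun x u => ?_⟩
  rw [mem_inter_iff, mem_preimage, mem_preimage, Sum.elim_comp_map, Sum.elim_comp_map,
    Function.comp_id, h₁, h₂]
  constructor
  · rintro ⟨e₁, e₂⟩
    funext i
    cases i with
    | inl i => exact congrFun e₁ i
    | inr i => exact congrFun e₂ i
  · rintro rfl
    exact ⟨rfl, rfl⟩

theorem D.eq {f g : σ → τ} (hf : DF L A f) (hg : DF L A g) : D L A fun x => f x = g x := by
  refine D.comp (P := fun p : τ × τ => p.1 = p.2) ?_ (hf.pair hg)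
  refine ⟨{v | v ∘ Sum.inl = v ∘ Sum.inr}, definable_eq_coords _ _, fun p => ?_⟩
  exact ⟨fun h => congrArg Coded.enc h, fun h => Coded.enc_inj h⟩

theorem D.mem [MemLang L V] {f g : σ → V} (hf : DF L A f) (hg : DF L A g) :
    D L A fun x => f x ∈ᵥ g x := by
  refine D.comp (P := fun p : V × V => p.1 ∈ᵥ p.2) ?_ (hf.pair hg)
  exact ⟨_, (MemLang.definable_mem (L := L) A).preimage_comp ![Sum.inl (), Sum.inr ()],
    fun p => Iff.rfl⟩

theorem D.st {f : σ → V} (hf : DF stMemLanguage A f) :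
    D stMemLanguage A fun x => StUniverse.st (f x) := by
  refine D.comp (P := fun x : V => StUniverse.st x) ?_ hf
  exact ⟨_, (definable_rel (L := stMemLanguage) (k := 1) StMemRel.st A).preimage_comp
    (fun _ => ()), fun p => Iff.rfl⟩

/-- Not every tuple need be a code, so the quantified tuple is confined to the definable range of
codes before it is projected away. -/
theorem D.ex [DRange L A τ] {P : σ → τ → Prop} (hP : D L A fun p : σ × τ => P p.1 p.2) :
    D L A fun x => ∃ y, P x y := by
  obtain ⟨Q, hQ, h⟩ := hP
  refine ⟨_, (hQ.inter ((DRange.range (L := L) (A := A) (τ := τ)).preimage_comp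
    Sum.inr)).image_comp Sum.inl, fun x => ?_⟩
  constructor
  · rintro ⟨y, hy⟩
    exact ⟨_, ⟨(h (x, y)).1 hy, y, rfl⟩, rfl⟩
  · rintro ⟨u, ⟨hu, y, hy⟩, hux⟩
    refine ⟨y, (h (x, y)).2 ?_⟩
    have : u = Coded.enc (x, y) := by
      rw [← Sum.elim_comp_inl_inr u]
      exact congrArg₂ Sum.elim hux hy
    exact this ▸ hu

theorem D.all [DRange L A τ] {P : σ → τ → Prop} (hP : D L A fun p : σ × τ => P p.1 p.2) :
    D L A fun x => ∀ y, P x y :=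
  (D.ex (P := fun x y => ¬ P x y) hP.not).not.congr fun x => by simp

theorem D.exUnique [DRange L A τ] {P : σ → τ → Prop} (hP : D L A fun p : σ × τ => P p.1 p.2) :
    D L A fun x => ∃! y, P x y := by
  have h₁ : D L A fun p : (σ × τ) × τ => P p.1.1 p.2 :=
    hP.comp (f := fun p : (σ × τ) × τ => (p.1.1, p.2)) (DF.id.fst.fst.pair DF.id.snd)
  exact D.ex (P := fun x y => P x y ∧ ∀ z, P x z → z = y) (hP.and
    (D.all (P := fun (p : σ × τ) z => P p.1 z → z = p.2) (h₁.imp (D.eq DF.id.snd DF.id.fst.snd))))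

/-- A set defining a predicate is constrained only at codes, whereas `DF` controls all tuples;
intersecting with the range of codes removes the spurious ones. -/
theorem DF.of_graph [DRange L A τ] {f : σ → τ} (h : D L A fun p : σ × τ => p.2 = f p.1) :
    DF L A f := by
  obtain ⟨Q, hQ, h⟩ := h
  refine ⟨_, hQ.inter ((DRange.range (L := L) (A := A) (τ := τ)).preimage_comp Sum.inr),
    fun x u => ?_⟩
  constructor
  · rintro ⟨h₁, y, hy⟩
    have hy : u = Coded.enc y := hy
    rw [hy] at h₁ ⊢
    rw [← (h (x, y)).2 h₁]
  · rintro rfl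
    exact ⟨(h (x, f x)).1 rfl, f x, rfl⟩

instance : DRange L A V where
  range := by
    convert definable_univ using 1
    exact eq_univ_of_forall fun u => ⟨u (), rfl⟩

theorem DF.constV_mem {c : V} (hc : c ∈ A) : DF L A fun _ : σ => c := by
  refine ⟨{v | v (Sum.inr ()) = c}, ?_, fun x u => ?_⟩
  · have := (Set.Definable.singleton_of_mem L hc).preimage_comp
      (β := Coded.ι V σ ⊕ Unit) (fun _ => Sum.inr ())
    exact this
  · constructor
    · intro h
      exact funext fun _ => h
    · intro h
      exact congrFun h ()

/-- An element of `El a` is coded by its underlying set, so both graphs are the same by definition.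
The three statements that follow rest on the same remark. -/
theorem DF.val {a : V} {f : σ → El a} (hf : DF L A f) : DF L A fun x => (f x).1 := hf

theorem DF.of_val {a : V} {f : σ → El a} (hf : DF L A fun x => (f x).1) : DF L A f := hf

theorem DF.code {R : RealNumbers V} {f : σ → R.Ext} (hf : DF L A f) :
    DF L A fun x => R.code (f x) := hf

theorem DF.of_code {R : RealNumbers V} {f : σ → R.Ext} (hf : DF L A fun x => R.code (f x)) :
    DF L A f := hf

theorem D.definable₁ {P : V → Prop} (h : D L A P) : A.Definable₁ L {x | P x} := by
  obtain ⟨Q, hQ, h⟩ := h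
  have := hQ.preimage_comp (β := Fin 1) (fun _ => 0)
  unfold Set.Definable₁
  convert this using 1
  ext v
  exact h (v 0)

theorem D.definable₂ {P : V × V → Prop} (h : D L A P) : A.Definable₂ L {x | P x} := by
  obtain ⟨Q, hQ, h⟩ := h
  have := hQ.preimage_comp (β := Fin 2) (Sum.elim (fun _ => 0) (fun _ => 1))
  unfold Set.Definable₂
  convert this using 1
  ext v
  refine (h (v 0, v 1)).trans ?_
  rw [mem_preimage, Sum.comp_elim]
  rfl

theorem DF.constV [StdSub A] {c : V} (hc : IsStd c) : DF L A fun _ : σ => c :=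
  DF.constV_mem (StdSub.sub c hc)

theorem DF.const_univ (c : τ) : DF L (univ : Set V) fun _ : σ => c := by
  refine ⟨⋂ i, {v | v (Sum.inr i) = Coded.enc c i}, ?_, fun x u => ?_⟩
  · refine definable_iInter_of_finite fun i => ?_
    have := (Set.Definable.singleton_of_mem L (mem_univ (Coded.enc (V := V) c i))).preimage_comp
      (β := Coded.ι V σ ⊕ Coded.ι V τ) (fun _ => Sum.inr i)
    exact this
  · simp [funext_iff]

instance [MemLang L V] [StdSub A] (R : RealNumbers V) : DRange L A (El R.carrier) where
  range := by
    obtain ⟨Q, hQ, h⟩ := D.mem (L := L) (A := A) DF.id (DF.constV R.std_carrier)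
    have e : {u | ∃ x : El R.carrier, u = Coded.enc (V := V) x} = Q := ?_
    · exact e ▸ hQ
    refine Set.ext fun u => ⟨?_, fun hu => ?_⟩
    · rintro ⟨x, rfl⟩
      exact (h x.1).1 x.2
    · exact ⟨⟨u (), (h (u ())).2 hu⟩, rfl⟩

theorem RealNumbers.exists_code (R : RealNumbers V) {x : V} :
    (∃ t, x = R.code t) ↔ x ∈ᵥ R.carrier ∨ x = R.infty := by
  constructor
  · rintro ⟨t, rfl⟩
    induction t using WithTop.recTopCoe with
    | top => exact Or.inr rfl
    | coe t => exact Or.inl t.2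
  · rintro (h | rfl)
    · exact ⟨((⟨x, h⟩ : El R.carrier) : R.Ext), rfl⟩
    · exact ⟨⊤, rfl⟩

instance [MemLang L V] [StdSub A] (R : RealNumbers V) : DRange L A (WithTop (El R.carrier)) where
  range := by
    obtain ⟨Q, hQ, h⟩ := D.or (D.mem (L := L) (A := A) DF.id (DF.constV R.std_carrier))
      (D.eq DF.id (DF.constV R.std_infty))
    have e : {u | ∃ x : R.Ext, u = Coded.enc (V := V) x} = Q := ?_
    · exact e ▸ hQ
    refine Set.ext fun u => ?_
    refine Iff.trans ?_ (h (u ()))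
    refine Iff.trans ?_ R.exists_code
    refine exists_congr fun t => ⟨fun h => congrFun h (), fun h => funext fun _ => h⟩

end Calculus

/-! ### Definability of the basic set-theoretic notions -/

section SetOps

variable {V : Type u} [StUniverse V]
variable {L : FirstOrder.Language.{0, 0}} [L.Structure V] [MemLang L V] {A : Set V}
variable {σ : Type*} [Coded V σ]

/-- The automatic argument is a proof search on the syntax of `P`. Reducible transparency keeps
defined notions closed, so each goal is matched by its outermost symbol; the later variants enlarge
the vocabulary. -/
theorem D.auto_logic {P : σ → Prop} (h : D L A P := by
    repeat' first
      | exact D.const _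
      | with_reducible apply D.and
      | with_reducible apply D.or
      | with_reducible apply D.not
      | with_reducible apply D.iff
      | with_reducible apply D.imp
      | with_reducible apply D.exUnique
      | with_reducible apply D.ex
      | with_reducible apply D.all
      | with_reducible apply D.mem
      | with_reducible apply D.eq
      | with_reducible apply DF.id
      | with_reducible apply DF.fst
      | with_reducible apply DF.snd
      | assumption) : D L A P := h

theorem D.comp₂ {τ τ' : Type*} [Coded V τ] [Coded V τ'] {P : τ → τ' → Prop}
    (hP : D L A fun p : τ × τ' => P p.1 p.2) {f : σ → τ} {g : σ → τ'} (hf : DF L A f)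
    (hg : DF L A g) : D L A fun x => P (f x) (g x) := hP.comp (hf.pair hg)

theorem D.comp₃ {τ τ' τ'' : Type*} [Coded V τ] [Coded V τ'] [Coded V τ'']
    {P : τ → τ' → τ'' → Prop}
    (hP : D L A fun p : τ × τ' × τ'' => P p.1 p.2.1 p.2.2) {f : σ → τ} {g : σ → τ'}
    {h : σ → τ''} (hf : DF L A f) (hg : DF L A g) (hh : DF L A h) :
    D L A fun x => P (f x) (g x) (h x) := hP.comp (hf.pair (hg.pair hh))

theorem DF.comp₂ {τ τ' ρ : Type*} [Coded V τ] [Coded V τ'] [Coded V ρ] {F : τ → τ' → ρ}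
    (hF : DF L A fun p : τ × τ' => F p.1 p.2) {f : σ → τ} {g : σ → τ'} (hf : DF L A f)
    (hg : DF L A g) : DF L A fun x => F (f x) (g x) := hF.comp (hf.pair hg)

/-- The frozen coordinate becomes a parameter, which is why the conclusion allows all parameters. -/
theorem D.section₂ {τ τ' : Type*} [Coded V τ] [Coded V τ'] {P : τ → τ' → Prop}
    (hP : D L A fun p : τ × τ' => P p.1 p.2) (x : τ) : D L (univ : Set V) fun y => P x y :=
  D.comp₂ (P := P) (f := fun _ => x) (hP.mono (subset_univ _)) (DF.const_univ x) DF.id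

variable {a b c : σ → V}

theorem D.subV (ha : DF L A a) (hb : DF L A b) : D L A fun x => SubV (a x) (b x) :=
  D.comp₂ (P := SubV) (by unfold SubV; exact D.auto_logic) ha hb

theorem D.emptyV (ha : DF L A a) : D L A fun x => EmptyV (a x) :=
  D.comp (P := EmptyV) (by unfold EmptyV; exact D.auto_logic) ha

theorem D.isPairSet (ha : DF L A a) (hb : DF L A b) (hc : DF L A c) :
    D L A fun x => IsPairSet (a x) (b x) (c x) :=
  D.comp₃ (P := IsPairSet) (by unfold IsPairSet; exact D.auto_logic) ha hb hc

theorem D.isUnionV (ha : DF L A a) (hb : DF L A b) (hc : DF L A c) :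
    D L A fun x => IsUnionV (a x) (b x) (c x) :=
  D.comp₃ (P := IsUnionV) (by unfold IsUnionV; exact D.auto_logic) ha hb hc

theorem D.isDiffV (ha : DF L A a) (hb : DF L A b) (hc : DF L A c) :
    D L A fun x => IsDiffV (a x) (b x) (c x) :=
  D.comp₃ (P := IsDiffV) (by unfold IsDiffV; exact D.auto_logic) ha hb hc

theorem D.disjV (ha : DF L A a) (hb : DF L A b) : D L A fun x => DisjV (a x) (b x) :=
  D.comp₂ (P := DisjV) (by unfold DisjV; exact D.auto_logic) ha hb

theorem D.auto_sets {P : σ → Prop} (h : D L A P := by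
    repeat' first
      | exact D.const _
      | with_reducible apply D.and
      | with_reducible apply D.or
      | with_reducible apply D.not
      | with_reducible apply D.iff
      | with_reducible apply D.imp
      | with_reducible apply D.exUnique
      | with_reducible apply D.ex
      | with_reducible apply D.all
      | with_reducible apply D.mem
      | with_reducible apply D.eq
      | with_reducible apply D.subV
      | with_reducible apply D.emptyV
      | with_reducible apply D.isPairSet
      | with_reducible apply D.isUnionV
      | with_reducible apply D.isDiffV
      | with_reducible apply D.disjV
      | with_reducible apply DF.id
      | with_reducible apply DF.fst
      | with_reducible apply DF.snd
      | with_reducible exact DF.const_univ _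
      | assumption) : D L A P := h

theorem D.isOPair (ha : DF L A a) (hb : DF L A b) (hc : DF L A c) :
    D L A fun x => IsOPair (a x) (b x) (c x) :=
  D.comp₃ (P := IsOPair) (by unfold IsOPair; exact D.auto_sets) ha hb hc

theorem D.mapsV (ha : DF L A a) (hb : DF L A b) (hc : DF L A c) :
    D L A fun x => MapsV (a x) (b x) (c x) := by
  refine D.comp₃ (P := MapsV) ?_ ha hb hc
  unfold MapsV
  exact D.ex (P := fun (q : V × V × V) p => IsOPair p q.2.1 q.2.2 ∧ p ∈ᵥ q.1)
    ((D.isOPair DF.id.snd DF.id.fst.snd.fst DF.id.fst.snd.snd).and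
      (D.mem DF.id.snd DF.id.fst.fst))

/-! ### Set operations of a model of `ZFC` -/

variable [hZ : Fact (IsZFC V)]

theorem set_ext {a b : V} (h : ∀ x, x ∈ᵥ a ↔ x ∈ᵥ b) : a = b := hZ.out.extensionality a b h

theorem exists_emptyV : ∃ e : V, EmptyV e :=
  let ⟨_, ⟨e, he, _⟩, _⟩ := hZ.out.infinity
  ⟨e, he⟩

variable (V) in
/-- The empty set. -/
noncomputable def emp : V := exists_emptyV.choose

theorem notMem_emp (x : V) : ¬ x ∈ᵥ emp V := (exists_emptyV (V := V)).choose_spec x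

theorem emptyV_iff {x : V} : EmptyV x ↔ x = emp V :=
  ⟨fun h => set_ext fun y => iff_of_false (h y) (notMem_emp y), fun h => h ▸ notMem_emp⟩

theorem DF.emp : DF L A fun _ : σ => emp V := by
  refine DF.of_graph (D.congr (P := fun p : σ × V => EmptyV p.2) D.auto_sets fun p => ?_)
  exact emptyV_iff.symm

open Classical in
/-- The unique element satisfying `P`, and the empty set if there is none. -/
noncomputable def the (P : V → Prop) : V := if h : ∃! x, P x then h.choose else emp V

theorem the_spec {P : V → Prop} (h : ∃! x, P x) : P (the P) := by
  rw [the, dif_pos h]; exact h.choose_spec.1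

theorem the_eq {P : V → Prop} {x : V} (h : P x) (hu : ∀ y, P y → y = x) : the P = x :=
  hu _ (the_spec ⟨x, h, hu⟩)

/-- Unique existence is itself a definable condition, so the graph is a union of two definable
cases, the second one carrying the default value. -/
theorem DF.the {P : σ → V → Prop} (hP : D L A fun p : σ × V => P p.1 p.2) :
    DF L A fun x => the (P x) := by
  have h₁ : D L A fun p : σ × V => ∃! y, P p.1 y :=
    (D.exUnique hP).comp DF.id.fst
  refine DF.of_graph (D.congr
    (P := fun p : σ × V => (P p.1 p.2 ∧ ∃! y, P p.1 y) ∨ (¬ ∃! y, P p.1 y) ∧ EmptyV p.2)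
    ((hP.and h₁).or (h₁.not.and (D.emptyV DF.id.snd))) fun p => ?_)
  rw [emptyV_iff]
  by_cases h : ∃! y, P p.1 y
  · simp only [h, and_true, not_true, false_and, or_false]
    exact ⟨fun e => e ▸ the_spec h, fun e => h.unique e (the_spec h)⟩
  · rw [_root_.the, dif_neg h]
    simp only [h, and_false, not_false_iff, true_and, false_or]

/-- `{x ∈ a | P x}`. -/
noncomputable def sepV (a : V) (P : V → Prop) : V := the fun b => ∀ x, x ∈ᵥ b ↔ x ∈ᵥ a ∧ P x

/-- `sepV` accepts arbitrary predicates, external ones included, but Separation gives it the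
intended elements only when the predicate is definable by membership. -/
theorem mem_sepV {a : V} {P : V → Prop} (hP : D memLanguage (univ : Set V) P) {x : V} :
    x ∈ᵥ sepV a P ↔ x ∈ᵥ a ∧ P x := by
  obtain ⟨b, hb⟩ := hZ.out.separation _ hP.definable₁ a
  have := the_spec (P := fun b => ∀ x, x ∈ᵥ b ↔ x ∈ᵥ a ∧ P x)
    ⟨b, hb, fun c hc => set_ext fun x => (hc x).trans (hb x).symm⟩
  exact this x

/-- The unordered pair. -/
noncomputable def upair (a b : V) : V := the fun p => IsPairSet p a b

theorem isPairSet_iff {p a b : V} : IsPairSet p a b ↔ p = upair a b := by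
  obtain ⟨q, hq⟩ := hZ.out.pairing a b
  have h : ∀ p, IsPairSet p a b → p = q := fun p hp =>
    set_ext fun x => (hp x).trans (hq x).symm
  have : upair a b = q := the_eq hq h
  exact ⟨fun hp => this ▸ h p hp, fun e => by rw [e, this]; exact hq⟩

theorem mem_upair {x a b : V} : x ∈ᵥ upair a b ↔ x = a ∨ x = b := isPairSet_iff.2 rfl x

/-- The ordered pair. -/
noncomputable def opair (a b : V) : V := upair (upair a a) (upair a b)

theorem isOPair_iff {p a b : V} : IsOPair p a b ↔ p = opair a b := by
  constructor
  · rintro ⟨s, t, hs, ht, hp⟩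
    rw [isPairSet_iff] at hs ht hp
    rw [hp, hs, ht, opair]
  · rintro rfl
    exact ⟨_, _, isPairSet_iff.2 rfl, isPairSet_iff.2 rfl, isPairSet_iff.2 rfl⟩

theorem upair_left_inj {a b c : V} (h : upair a b = upair a c) : b = c := by
  have h₁ : b ∈ᵥ upair a c := h ▸ mem_upair.2 (Or.inr rfl)
  have h₂ : c ∈ᵥ upair a b := h.symm ▸ mem_upair.2 (Or.inr rfl)
  rw [mem_upair] at h₁ h₂
  rcases h₁ with h₁ | h₁
  · rcases h₂ with h₂ | h₂
    · rw [h₁, h₂]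
    · exact h₂.symm
  · exact h₁

theorem opair_inj {a b c d : V} : opair a b = opair c d ↔ a = c ∧ b = d := by
  refine ⟨fun h => ?_, fun h => by rw [h.1, h.2]⟩
  have hac : a = c := by
    have h₁ : upair a a ∈ᵥ opair c d := h ▸ mem_upair.2 (Or.inl rfl)
    have h₂ : c ∈ᵥ upair a a := by
      rcases mem_upair.1 h₁ with e | e <;> rw [e] <;> exact mem_upair.2 (Or.inl rfl)
    rcases mem_upair.1 h₂ with e | e <;> exact e.symm
  subst hac
  exact ⟨rfl, upair_left_inj (upair_left_inj h)⟩

/-- The union of a set. -/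
noncomputable def sUn (a : V) : V := the fun b => ∀ x, x ∈ᵥ b ↔ ∃ y, y ∈ᵥ a ∧ x ∈ᵥ y

theorem mem_sUn {a x : V} : x ∈ᵥ sUn a ↔ ∃ y, y ∈ᵥ a ∧ x ∈ᵥ y := by
  obtain ⟨b, hb⟩ := hZ.out.union a
  exact the_spec (P := fun b => ∀ x, x ∈ᵥ b ↔ ∃ y, y ∈ᵥ a ∧ x ∈ᵥ y)
    ⟨b, hb, fun c hc => set_ext fun x => (hc x).trans (hb x).symm⟩ x

/-- The power set. -/
noncomputable def powV (a : V) : V := the fun b => ∀ x, x ∈ᵥ b ↔ SubV x a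

theorem mem_powV {a x : V} : x ∈ᵥ powV a ↔ SubV x a := by
  obtain ⟨b, hb⟩ := hZ.out.powerset a
  exact the_spec (P := fun b => ∀ x, x ∈ᵥ b ↔ SubV x a)
    ⟨b, hb, fun c hc => set_ext fun x => (hc x).trans (hb x).symm⟩ x

/-- `a ∪ b`. -/
noncomputable def cup (a b : V) : V := sUn (upair a b)

theorem mem_cup {a b x : V} : x ∈ᵥ cup a b ↔ x ∈ᵥ a ∨ x ∈ᵥ b := by
  rw [cup, mem_sUn]
  constructor
  · rintro ⟨y, hy, hx⟩
    rcases mem_upair.1 hy with rfl | rfl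
    exacts [Or.inl hx, Or.inr hx]
  · rintro (h | h)
    exacts [⟨a, mem_upair.2 (Or.inl rfl), h⟩, ⟨b, mem_upair.2 (Or.inr rfl), h⟩]

/-- `a \ b`. -/
noncomputable def sdiffV (a b : V) : V := sepV a fun x => ¬ x ∈ᵥ b

theorem mem_sdiffV {a b x : V} : x ∈ᵥ sdiffV a b ↔ x ∈ᵥ a ∧ ¬ x ∈ᵥ b := mem_sepV D.auto_sets

/-- `a ∩ b`. -/
noncomputable def cap (a b : V) : V := sepV a fun x => x ∈ᵥ b

theorem mem_cap {a b x : V} : x ∈ᵥ cap a b ↔ x ∈ᵥ a ∧ x ∈ᵥ b := mem_sepV D.auto_sets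

theorem isUnionV_iff {c a b : V} : IsUnionV c a b ↔ c = cup a b :=
  ⟨fun h => set_ext fun x => (h x).trans mem_cup.symm, fun h _ => h ▸ mem_cup⟩

theorem isDiffV_iff {c a b : V} : IsDiffV c a b ↔ c = sdiffV a b :=
  ⟨fun h => set_ext fun x => (h x).trans mem_sdiffV.symm, fun h _ => h ▸ mem_sdiffV⟩

/-- The value of the function `f` at `x`. -/
noncomputable def app (f x : V) : V := the fun y => MapsV f x y

theorem mapsV_iff {f x y : V} : MapsV f x y ↔ opair x y ∈ᵥ f := by
  constructor
  · rintro ⟨p, hp, h⟩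
    exact isOPair_iff.1 hp ▸ h
  · exact fun h => ⟨_, isOPair_iff.2 rfl, h⟩

theorem DF.sepV {a : σ → V} {P : σ → V → Prop} (ha : DF L A a)
    (hP : D L A fun p : σ × V => P p.1 p.2) : DF L A fun x => sepV (a x) (P x) := by
  refine DF.the (D.all (D.iff (D.mem DF.id.snd DF.id.fst.snd) (D.and
    (D.mem DF.id.snd (ha.comp DF.id.fst.fst)) ?_)))
  exact D.comp₂ (P := P) hP DF.id.fst.fst DF.id.snd

theorem DF.upair (ha : DF L A a) (hb : DF L A b) : DF L A fun x => upair (a x) (b x) :=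
  DF.comp₂ (F := _root_.upair) (DF.the D.auto_sets) ha hb

theorem DF.opair (ha : DF L A a) (hb : DF L A b) : DF L A fun x => opair (a x) (b x) :=
  DF.upair (DF.upair ha ha) (DF.upair ha hb)

theorem DF.sUn (ha : DF L A a) : DF L A fun x => sUn (a x) :=
  DF.comp (g := _root_.sUn) (DF.the D.auto_sets) ha

theorem DF.powV (ha : DF L A a) : DF L A fun x => powV (a x) :=
  DF.comp (g := _root_.powV) (DF.the D.auto_sets) ha

theorem DF.cup (ha : DF L A a) (hb : DF L A b) : DF L A fun x => cup (a x) (b x) :=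
  (ha.upair hb).sUn

theorem DF.sdiffV (ha : DF L A a) (hb : DF L A b) : DF L A fun x => sdiffV (a x) (b x) :=
  DF.comp₂ (F := _root_.sdiffV) (DF.sepV DF.id.fst D.auto_sets) ha hb

theorem DF.cap (ha : DF L A a) (hb : DF L A b) : DF L A fun x => cap (a x) (b x) :=
  DF.comp₂ (F := _root_.cap) (DF.sepV DF.id.fst D.auto_sets) ha hb

theorem DF.app (ha : DF L A a) (hb : DF L A b) : DF L A fun x => app (a x) (b x) :=
  DF.comp₂ (F := _root_.app) (DF.the (D.mapsV DF.id.fst.fst DF.id.fst.snd DF.id.snd)) ha hb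

theorem D.auto_ops {P : σ → Prop} (h : D L A P := by
    repeat' first
      | exact D.const _
      | with_reducible apply D.and
      | with_reducible apply D.or
      | with_reducible apply D.not
      | with_reducible apply D.iff
      | with_reducible apply D.imp
      | with_reducible apply D.exUnique
      | with_reducible apply D.ex
      | with_reducible apply D.all
      | with_reducible apply D.mem
      | with_reducible apply D.eq
      | with_reducible apply D.subV
      | with_reducible apply D.emptyV
      | with_reducible apply D.isUnionV
      | with_reducible apply D.isDiffV
      | with_reducible apply D.disjV
      | with_reducible apply D.isOPair
      | with_reducible apply D.mapsV
      | with_reducible apply DF.id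
      | with_reducible apply DF.fst
      | with_reducible apply DF.snd
      | with_reducible exact DF.const_univ _
      | with_reducible apply DF.sepV
      | with_reducible apply DF.opair
      | with_reducible apply DF.sUn
      | with_reducible apply DF.powV
      | with_reducible apply DF.cup
      | with_reducible apply DF.cap
      | with_reducible apply DF.sdiffV
      | with_reducible apply DF.app
      | with_reducible apply DF.emp
      | assumption) : D L A P := h

theorem D.isFunOn (ha : DF L A a) (hb : DF L A b) : D L A fun x => IsFunOn (a x) (b x) :=
  D.comp₂ (P := IsFunOn) (by unfold IsFunOn; exact D.auto_ops) ha hb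

theorem D.isFun (ha : DF L A a) (hb : DF L A b) (hc : DF L A c) :
    D L A fun x => IsFun (a x) (b x) (c x) :=
  D.comp₃ (P := IsFun) (D.and (D.isFunOn DF.id.fst DF.id.snd.fst) D.auto_ops) ha hb hc

/-- `a × b`. -/
noncomputable def prodV (a b : V) : V :=
  sepV (powV (powV (cup a b))) fun p => ∃ x y, x ∈ᵥ a ∧ y ∈ᵥ b ∧ p = opair x y

theorem DF.prodV (ha : DF L A a) (hb : DF L A b) : DF L A fun x => prodV (a x) (b x) :=
  DF.comp₂ (F := _root_.prodV) (DF.sepV (DF.id.fst.cup DF.id.snd).powV.powV D.auto_ops) ha hb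

theorem mem_prodV {a b p : V} : p ∈ᵥ prodV a b ↔ ∃ x y, x ∈ᵥ a ∧ y ∈ᵥ b ∧ p = opair x y := by
  rw [prodV, mem_sepV D.auto_ops]
  refine ⟨fun h => h.2, fun h => ⟨?_, h⟩⟩
  obtain ⟨x, y, hx, hy, rfl⟩ := h
  rw [mem_powV]
  intro z hz
  rw [mem_powV]
  intro t ht
  rw [mem_cup]
  rcases mem_upair.1 hz with rfl | rfl
  · rcases mem_upair.1 ht with rfl | rfl <;> exact Or.inl hx
  · rcases mem_upair.1 ht with rfl | rfl
    exacts [Or.inl hx, Or.inr hy]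

theorem opair_mem_prodV {a b x y : V} : opair x y ∈ᵥ prodV a b ↔ x ∈ᵥ a ∧ y ∈ᵥ b := by
  rw [mem_prodV]
  constructor
  · rintro ⟨x', y', hx, hy, e⟩
    rw [opair_inj] at e
    rw [e.1, e.2]
    exact ⟨hx, hy⟩
  · exact fun h => ⟨x, y, h.1, h.2, rfl⟩

/-- `b ^ a`. -/
noncomputable def funs (a b : V) : V := sepV (powV (prodV a b)) fun f => IsFun f a b

theorem DF.funs (ha : DF L A a) (hb : DF L A b) : DF L A fun x => funs (a x) (b x) :=
  DF.comp₂ (F := _root_.funs) (DF.sepV (DF.id.fst.prodV DF.id.snd).powV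
    (D.isFun DF.id.snd DF.id.fst.fst DF.id.fst.snd)) ha hb

theorem mem_funs {a b f : V} : f ∈ᵥ funs a b ↔ IsFun f a b := by
  rw [funs, mem_sepV (D.isFun DF.id (DF.const_univ _) (DF.const_univ _))]
  refine ⟨fun h => h.2, fun h => ⟨mem_powV.2 fun p hp => ?_, h⟩⟩
  obtain ⟨x, y, hx, hxy⟩ := h.1.1 p hp
  rw [isOPair_iff] at hxy
  subst hxy
  exact opair_mem_prodV.2 ⟨hx, h.2 x y (mapsV_iff.2 hp)⟩

theorem IsFunOn.mapsV {f a x y : V} (h : IsFunOn f a) (hx : x ∈ᵥ a) :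
    MapsV f x y ↔ y = app f x := by
  have := the_spec (h.2 x hx)
  exact ⟨fun hy => (h.2 x hx).unique hy this, fun e => e ▸ this⟩

theorem IsFunOn.mem_dom {f a x y : V} (h : IsFunOn f a) (hx : MapsV f x y) : x ∈ᵥ a := by
  obtain ⟨x', y', hx', e⟩ := h.1 _ (mapsV_iff.1 hx)
  rw [isOPair_iff, opair_inj] at e
  exact e.1 ▸ hx'

theorem IsFunOn.maps_app {f a x : V} (h : IsFunOn f a) (hx : x ∈ᵥ a) : MapsV f x (app f x) :=
  (h.mapsV hx).2 rfl

theorem MapsV.app_eq {f a x y : V} (h : MapsV f x y) (hf : IsFunOn f a) : app f x = y :=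
  ((hf.mapsV (hf.mem_dom h)).1 h).symm

theorem IsFunOn.ext {f g a : V} (hf : IsFunOn f a) (hg : IsFunOn g a)
    (h : ∀ x, x ∈ᵥ a → app f x = app g x) : f = g := by
  have key : ∀ f g : V, IsFunOn f a → IsFunOn g a → (∀ x, x ∈ᵥ a → app f x = app g x) →
      ∀ p, p ∈ᵥ f → p ∈ᵥ g := by
    intro f g hf hg h p hp
    obtain ⟨x, y, hx, e⟩ := hf.1 p hp
    rw [isOPair_iff] at e
    subst e
    rw [← mapsV_iff, hf.mapsV hx, h x hx] at hp
    exact mapsV_iff.1 ((hg.mapsV hx).2 hp)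
  exact set_ext fun p => ⟨key f g hf hg h p, key g f hg hf (fun x hx => (h x hx).symm) p⟩

theorem isFun_iff {f a b : V} : IsFun f a b ↔ IsFunOn f a ∧ ∀ x, x ∈ᵥ a → app f x ∈ᵥ b := by
  refine and_congr_right fun h => ⟨fun h' x hx => h' x _ (h.maps_app hx), fun h' x y hxy => ?_⟩
  rw [← hxy.app_eq h]
  exact h' x (h.mem_dom hxy)

theorem IsFun.app_mem {f a b x : V} (h : IsFun f a b) (hx : x ∈ᵥ a) : app f x ∈ᵥ b :=
  (isFun_iff.1 h).2 x hx

/-- The function with domain `a` and values `F x`. -/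
noncomputable def lam (a : V) (F : V → V) : V :=
  the fun f => ∀ p, p ∈ᵥ f ↔ ∃ x, x ∈ᵥ a ∧ p = opair x (F x)

theorem DF.lam {a : σ → V} {F : σ → V → V} (ha : DF L A a)
    (hF : DF L A fun p : σ × V => F p.1 p.2) : DF L A fun x => lam (a x) (F x) := by
  refine DF.the (D.all (D.iff (D.mem DF.id.snd DF.id.fst.snd) (D.ex (D.and
    (D.mem DF.id.snd (ha.comp DF.id.fst.fst.fst)) (D.eq DF.id.fst.snd (DF.opair DF.id.snd ?_))))))
  exact DF.comp₂ (F := F) hF DF.id.fst.fst.fst DF.id.snd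

/-- Replacement is applied to `x ↦ ⟨x, F x⟩`, which yields the graph directly without a codomain for
`F`. -/
theorem mem_lam {a : V} {F : V → V} (hF : DF memLanguage (univ : Set V) F) {p : V} :
    p ∈ᵥ lam a F ↔ ∃ x, x ∈ᵥ a ∧ p = opair x (F x) := by
  obtain ⟨b, hb⟩ := hZ.out.replacement {q : V × V | q.2 = opair q.1 (F q.1)}
    (D.definable₂ (P := fun q : V × V => q.2 = opair q.1 (F q.1))
      (D.eq DF.id.snd (DF.opair DF.id.fst (hF.comp DF.id.fst)))) a
    (fun x _ => ⟨opair x (F x), rfl, fun _ h => h⟩)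
  exact the_spec (P := fun f => ∀ p, p ∈ᵥ f ↔ ∃ x, x ∈ᵥ a ∧ p = opair x (F x))
    ⟨b, hb, fun c hc => set_ext fun x => (hc x).trans (hb x).symm⟩ p

theorem mapsV_lam {a : V} {F : V → V} (hF : DF memLanguage (univ : Set V) F) {x y : V} :
    MapsV (lam a F) x y ↔ x ∈ᵥ a ∧ y = F x := by
  rw [mapsV_iff, mem_lam hF]
  constructor
  · rintro ⟨z, hz, e⟩
    rw [opair_inj] at e
    rw [e.1]
    exact ⟨hz, e.2⟩
  · rintro ⟨hx, rfl⟩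
    exact ⟨x, hx, rfl⟩

theorem isFunOn_lam {a : V} {F : V → V} (hF : DF memLanguage (univ : Set V) F) : IsFunOn (lam a F) a := by
  constructor
  · intro p hp
    obtain ⟨x, hx, e⟩ := (mem_lam hF).1 hp
    exact ⟨x, F x, hx, isOPair_iff.2 e⟩
  · intro x hx
    exact ⟨F x, (mapsV_lam hF).2 ⟨hx, rfl⟩, fun y hy => ((mapsV_lam hF).1 hy).2⟩

theorem app_lam {a : V} {F : V → V} (hF : DF memLanguage (univ : Set V) F) {x : V} (hx : x ∈ᵥ a) :
    app (lam a F) x = F x :=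
  (((isFunOn_lam hF).mapsV hx).1 ((mapsV_lam hF).2 ⟨hx, rfl⟩)).symm

/-- The axiom of choice for definable relations between elements of two sets. -/
theorem exists_choice_fun {a b : V} {P : V → V → Prop}
    (hP : D memLanguage (univ : Set V) fun p : V × V => P p.1 p.2)
    (h : ∀ x, x ∈ᵥ a → ∃ y, y ∈ᵥ b ∧ P x y) :
    ∃ f, IsFun f a b ∧ ∀ x, x ∈ᵥ a → P x (app f x) := by
  have hQ : D memLanguage (univ : Set V)
      fun q : V × V => ∃ y, y ∈ᵥ b ∧ q.2 = opair q.1 y ∧ P q.1 y :=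
    D.ex (D.and (D.mem DF.id.snd (DF.const_univ _)) (D.and
      (D.eq DF.id.fst.snd (DF.opair DF.id.fst.fst DF.id.snd))
      (D.comp₂ (P := P) hP DF.id.fst.fst DF.id.snd)))
  -- The axiom of choice is stated for families of disjoint sets, so each candidate `y` is tagged
  -- with its argument `x`.
  let fib : V → V := fun x => sepV (prodV a b) fun p => ∃ y, y ∈ᵥ b ∧ p = opair x y ∧ P x y
  have hfib : DF memLanguage (univ : Set V) fib := DF.sepV (DF.const_univ _) hQ
  have mem_fib : ∀ x p, p ∈ᵥ fib x ↔ x ∈ᵥ a ∧ ∃ y, y ∈ᵥ b ∧ p = opair x y ∧ P x y := by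
    intro x p
    refine (mem_sepV (D.section₂ (P := fun x p => ∃ y, y ∈ᵥ b ∧ p = opair x y ∧ P x y)
      hQ x)).trans ?_
    constructor
    · rintro ⟨h₁, y, hy, rfl, hxy⟩
      exact ⟨(opair_mem_prodV.1 h₁).1, y, hy, rfl, hxy⟩
    · rintro ⟨hx, y, hy, rfl, hxy⟩
      exact ⟨opair_mem_prodV.2 ⟨hx, hy⟩, y, hy, rfl, hxy⟩
  have hT : D memLanguage (univ : Set V) fun t => ∃ x, x ∈ᵥ a ∧ t = fib x :=
    D.ex (D.and (D.mem DF.id.snd (DF.const_univ _)) (D.eq DF.id.fst (hfib.comp DF.id.snd)))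
  obtain ⟨c, hc⟩ := hZ.out.choice (sepV (powV (prodV a b)) fun t => ∃ x, x ∈ᵥ a ∧ t = fib x) (by
      intro t ht
      rw [mem_sepV hT] at ht
      obtain ⟨_, x, hx, rfl⟩ := ht
      obtain ⟨y, hy, hxy⟩ := h x hx
      exact ⟨opair x y, (mem_fib _ _).2 ⟨hx, y, hy, rfl, hxy⟩⟩) (by
      intro t t' ht ht' hne p hp
      rw [mem_sepV hT] at ht ht'
      obtain ⟨_, x, hx, rfl⟩ := ht
      obtain ⟨_, x', hx', rfl⟩ := ht'
      obtain ⟨_, y, _, e, _⟩ := (mem_fib _ _).1 hp.1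
      obtain ⟨_, y', _, e', _⟩ := (mem_fib _ _).1 hp.2
      rw [e, opair_inj] at e'
      exact hne (by rw [e'.1]))
  have key : ∀ x, x ∈ᵥ a → ∃! z, z ∈ᵥ fib x ∧ z ∈ᵥ c := by
    intro x hx
    refine hc _ ((mem_sepV hT).2 ⟨mem_powV.2 fun p hp => ?_, x, hx, rfl⟩)
    obtain ⟨_, y, hy, rfl, _⟩ := (mem_fib _ _).1 hp
    exact opair_mem_prodV.2 ⟨hx, hy⟩
  -- The choice set may have elements that lie in no fibre; discarding them leaves the graph of a
  -- function.
  have hf : D memLanguage (univ : Set V) fun p => p ∈ᵥ c ∧ ∃ x, x ∈ᵥ a ∧ p ∈ᵥ fib x :=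
    D.and (D.mem DF.id (DF.const_univ _)) (D.ex (D.and (D.mem DF.id.snd (DF.const_univ _))
      (D.mem DF.id.fst (hfib.comp DF.id.snd))))
  set f := sepV (prodV a b) fun p => p ∈ᵥ c ∧ ∃ x, x ∈ᵥ a ∧ p ∈ᵥ fib x with hfdef
  have hmap : ∀ x y, MapsV f x y ↔ opair x y ∈ᵥ c ∧ x ∈ᵥ a ∧ y ∈ᵥ b ∧ P x y := by
    intro x y
    rw [mapsV_iff, hfdef, mem_sepV hf, opair_mem_prodV]
    constructor
    · rintro ⟨⟨hx, hy⟩, hc, x', hx', h'⟩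
      obtain ⟨_, y', hy', e, hxy⟩ := (mem_fib _ _).1 h'
      rw [opair_inj] at e
      rw [← e.1, ← e.2] at hxy
      exact ⟨hc, hx, hy, hxy⟩
    · rintro ⟨hc, hx, hy, hxy⟩
      exact ⟨⟨hx, hy⟩, hc, x, hx, (mem_fib _ _).2 ⟨hx, y, hy, rfl, hxy⟩⟩
  have hfun : IsFunOn f a := by
    constructor
    · intro p hp
      rw [hfdef, mem_sepV hf, mem_prodV] at hp
      obtain ⟨⟨x, y, hx, hy, e⟩, _⟩ := hp
      exact ⟨x, y, hx, isOPair_iff.2 e⟩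
    · intro x hx
      obtain ⟨z, ⟨hz, hzc⟩, hu⟩ := key x hx
      obtain ⟨_, y, hy, rfl, hxy⟩ := (mem_fib _ _).1 hz
      refine ⟨y, (hmap x y).2 ⟨hzc, hx, hy, hxy⟩, fun y' hy' => ?_⟩
      obtain ⟨h₁, _, h₂, h₃⟩ := (hmap x y').1 hy'
      exact (opair_inj.1 (hu _ ⟨(mem_fib _ _).2 ⟨hx, y', h₂, rfl, h₃⟩, h₁⟩)).2
  refine ⟨f, ⟨hfun, fun x y hxy => ((hmap x y).1 hxy).2.2.1⟩, fun x hx => ?_⟩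
  exact ((hmap x _).1 (hfun.maps_app hx)).2.2.2

end SetOps

/-! ## Definability of the real numbers of the universe -/

section Reals

variable {V : Type u} [StUniverse V] {R : RealNumbers V}
variable {L : FirstOrder.Language.{0, 0}} [L.Structure V] [MemLang L V] {A : Set V} [StdSub A]
variable {σ : Type*} [Coded V σ]

theorem DF.constE {a : V} {c : El a} (hc : IsStd c.1) : DF L A fun _ : σ => c :=
  DF.of_val (DF.constV hc)

theorem D.leR {a b : σ → El R.carrier} (ha : DF L A a) (hb : DF L A b) :
    D L A fun x => a x ≤ b x :=
  (D.mapsV (DF.constV R.std_leGraph) ha.val hb.val).congr fun _ => (R.mem_leGraph _ _).symm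

theorem D.ltR {a b : σ → El R.carrier} (ha : DF L A a) (hb : DF L A b) :
    D L A fun x => a x < b x :=
  (D.leR hb ha).not.congr fun _ => not_le.symm

theorem D.graph₂ {g : V} (hg : IsStd g) {a b c : σ → V} (ha : DF L A a) (hb : DF L A b)
    (hc : DF L A c) : D L A fun x => ∃ p, IsOPair p (a x) (b x) ∧ MapsV g p (c x) := by
  refine D.comp₃ (P := fun a b c => ∃ p, IsOPair p a b ∧ MapsV g p c) ?_ ha hb hc
  exact D.ex (D.and (D.isOPair DF.id.snd DF.id.fst.fst DF.id.fst.snd.fst)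
    (D.mapsV (DF.constV hg) DF.id.snd DF.id.fst.snd.snd))

theorem DF.addR {a b : σ → El R.carrier} (ha : DF L A a) (hb : DF L A b) :
    DF L A fun x => a x + b x := by
  refine DF.comp₂ (F := fun s t : El R.carrier => s + t) (DF.of_graph ?_) ha hb
  refine (D.graph₂ R.std_addGraph (DF.id.fst.fst.val) (DF.id.fst.snd.val)
    (DF.id.snd.val)).congr (Q := fun p : (El R.carrier × El R.carrier) × El R.carrier =>
      p.2 = p.1.1 + p.1.2) fun p => ?_
  rw [R.mem_addGraph, eq_comm]

theorem DF.mulR {a b : σ → El R.carrier} (ha : DF L A a) (hb : DF L A b) :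
    DF L A fun x => a x * b x := by
  refine DF.comp₂ (F := fun s t : El R.carrier => s * t) (DF.of_graph ?_) ha hb
  refine (D.graph₂ R.std_mulGraph (DF.id.fst.fst.val) (DF.id.fst.snd.val)
    (DF.id.snd.val)).congr (Q := fun p : (El R.carrier × El R.carrier) × El R.carrier =>
      p.2 = p.1.1 * p.1.2) fun p => ?_
  rw [R.mem_mulGraph, eq_comm]

/-- Zero is the only solution of `x + x = x`, and below one is the only nonzero solution of `x * x =
x`. Both are thus definable from the standard operation graphs, before they are known to be standard
themselves. -/
theorem DF.zeroR : DF L A fun _ : σ => (0 : El R.carrier) := by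
  refine DF.of_graph ((D.eq (DF.addR DF.id.snd DF.id.snd) DF.id.snd).congr
    (Q := fun p : σ × El R.carrier => p.2 = 0) fun p => ?_)
  simp

theorem DF.oneR : DF L A fun _ : σ => (1 : El R.carrier) := by
  refine DF.of_graph (((D.eq (DF.mulR DF.id.snd DF.id.snd) DF.id.snd).and
    (D.eq DF.id.snd DF.zeroR).not).congr
    (Q := fun p : σ × El R.carrier => p.2 = 1) fun p => ?_)
  constructor
  · intro h
    simp [h]
  · rintro ⟨h₁, h₂⟩
    exact (mul_eq_left₀ h₂).1 h₁

theorem DF.subR {a b : σ → El R.carrier} (ha : DF L A a) (hb : DF L A b) :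
    DF L A fun x => a x - b x := by
  refine DF.comp₂ (F := fun s t : El R.carrier => s - t) (DF.of_graph ?_) ha hb
  exact (D.eq (DF.addR DF.id.snd DF.id.fst.snd) DF.id.fst.fst).congr
    (Q := fun p : (El R.carrier × El R.carrier) × El R.carrier =>
      p.2 = p.1.1 - p.1.2) fun p => eq_sub_iff_add_eq

/-- The first disjunct of the graph encodes the convention `a / 0 = 0`. -/
theorem DF.divR {a b : σ → El R.carrier} (ha : DF L A a) (hb : DF L A b) :
    DF L A fun x => a x / b x := by
  refine DF.comp₂ (F := fun s t : El R.carrier => s / t) (DF.of_graph ?_) ha hb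
  refine ((D.and (D.eq DF.id.fst.snd DF.zeroR) (D.eq DF.id.snd DF.zeroR)).or
    (D.and (D.eq DF.id.fst.snd DF.zeroR).not
      (D.eq (DF.mulR DF.id.snd DF.id.fst.snd) DF.id.fst.fst))).congr
    (Q := fun p : (El R.carrier × El R.carrier) × El R.carrier =>
      p.2 = p.1.1 / p.1.2) fun p => ?_
  by_cases h : p.1.2 = 0
  · simp [h]
  · simp [h, eq_div_iff]

theorem DF.absR {a : σ → El R.carrier} (ha : DF L A a) : DF L A fun x => |a x| := by
  refine DF.comp (g := fun s : El R.carrier => |s|) (DF.of_graph ?_) ha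
  refine ((D.and (D.leR DF.zeroR DF.id.fst) (D.eq DF.id.snd DF.id.fst)).or
    (D.and (D.leR DF.zeroR DF.id.fst).not
      (D.eq (DF.addR DF.id.snd DF.id.fst) DF.zeroR))).congr
    (Q := fun p : El R.carrier × El R.carrier => p.2 = |p.1|) fun p => ?_
  by_cases h : 0 ≤ p.1
  · simp [h, abs_of_nonneg]
  · rw [abs_of_neg (not_le.1 h)]
    simp [h, eq_neg_iff_add_eq_zero]

theorem DF.coeX {a : σ → El R.carrier} (ha : DF L A a) :
    DF L A fun x => ((a x : El R.carrier) : R.Ext) := ha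

theorem DF.topX : DF L A fun _ : σ => (⊤ : R.Ext) := DF.of_code (DF.constV R.std_infty)

theorem DF.zeroX : DF L A fun _ : σ => (0 : R.Ext) := DF.coeX DF.zeroR

theorem D.leX {a b : σ → R.Ext} (ha : DF L A a) (hb : DF L A b) :
    D L A fun x => a x ≤ b x := by
  refine D.comp₂ (P := fun s t : R.Ext => s ≤ t) ?_ ha hb
  refine ((D.eq DF.id.snd DF.topX).or (D.ex (P := fun (p : R.Ext × R.Ext) (r : El R.carrier) =>
    ∃ s : El R.carrier, p.1 = r ∧ p.2 = s ∧ r ≤ s) (D.ex (D.and (D.eq DF.id.fst.fst.fst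
    DF.id.fst.snd.coeX) (D.and (D.eq DF.id.fst.fst.snd DF.id.snd.coeX)
    (D.leR DF.id.fst.snd DF.id.snd)))))).congr fun p => ?_
  obtain ⟨s, t⟩ := p
  induction t using WithTop.recTopCoe with
  | top => simp
  | coe t =>
    induction s using WithTop.recTopCoe with
    | top => simp
    | coe s => simp

theorem DF.addX {a b : σ → R.Ext} (ha : DF L A a) (hb : DF L A b) :
    DF L A fun x => a x + b x := by
  refine DF.comp₂ (F := fun s t : R.Ext => s + t) (DF.of_graph ?_) ha hb
  refine ((D.and (D.eq DF.id.fst.fst DF.topX) (D.eq DF.id.snd DF.topX)).or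
    ((D.and (D.eq DF.id.fst.snd DF.topX) (D.eq DF.id.snd DF.topX)).or
    (D.ex (P := fun (p : (R.Ext × R.Ext) × R.Ext) (r : El R.carrier) =>
    ∃ s : El R.carrier, p.1.1 = r ∧ p.1.2 = s ∧ p.2 = ((r + s : El R.carrier) : R.Ext))
    (D.ex (D.and (D.eq DF.id.fst.fst.fst.fst
    DF.id.fst.snd.coeX) (D.and (D.eq DF.id.fst.fst.fst.snd DF.id.snd.coeX)
    (D.eq DF.id.fst.fst.snd (DF.addR DF.id.fst.snd DF.id.snd).coeX))))))).congr
    (Q := fun p : (R.Ext × R.Ext) × R.Ext => p.2 = p.1.1 + p.1.2) fun p => ?_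
  obtain ⟨⟨s, t⟩, w⟩ := p
  induction t using WithTop.recTopCoe with
  | top => simp
  | coe t =>
    induction s using WithTop.recTopCoe with
    | top => simp
    | coe s => simp [← WithTop.coe_add]

namespace RealNumbers

variable (R)

open Classical in
/-- The real number with code `x`. -/
noncomputable def decR (x : V) : El R.carrier := if h : x ∈ᵥ R.carrier then ⟨x, h⟩ else 0

open Classical in
/-- The extended real number with code `x`. -/
noncomputable def decX (x : V) : R.Ext := if h : x ∈ᵥ R.carrier then ((⟨x, h⟩ : El R.carrier) :) else ⊤

theorem decR_val (x : El R.carrier) : R.decR x.1 = x := dif_pos x.2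

/-- The default value of `decX` outside `ℝ` is `⊤`, which makes it correct at the code of `+∞` as
well. -/
theorem decX_code (t : R.Ext) : R.decX (R.code t) = t := by
  induction t using WithTop.recTopCoe with
  | top => exact dif_neg R.infty_notMem
  | coe t => exact dif_pos t.2

/-- The value of `f` at `x`, as an extended real. -/
noncomputable def ev [Fact (IsZFC V)] (f x : V) : R.Ext := R.decX (app f x)

end RealNumbers

theorem DF.decR {a : σ → V} (ha : DF L A a) : DF L A fun x => R.decR (a x) := by
  refine DF.comp (g := R.decR) (DF.of_graph ?_) ha
  refine ((D.eq DF.id.fst DF.id.snd.val).or ((D.mem DF.id.fst (DF.constV R.std_carrier)).not.and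
    (D.eq DF.id.snd DF.zeroR))).congr
    (Q := fun p : V × El R.carrier => p.2 = R.decR p.1) fun p => ?_
  obtain ⟨x, r⟩ := p
  by_cases h : x ∈ᵥ R.carrier
  · simp only [RealNumbers.decR, h, dif_pos, not_true, false_and, or_false]
    exact ⟨fun e => congrArg Subtype.val e.symm, fun e => Subtype.ext e.symm⟩
  · simp only [RealNumbers.decR, h, dif_neg, not_false_iff, true_and]
    exact ⟨fun e => Or.inr e, fun e => e.resolve_left fun e => h (e ▸ r.2)⟩

theorem DF.decX {a : σ → V} (ha : DF L A a) : DF L A fun x => R.decX (a x) := by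
  refine DF.comp (g := R.decX) (DF.of_graph ?_) ha
  refine ((D.eq DF.id.fst DF.id.snd.code).or ((D.mem DF.id.fst (DF.constV R.std_carrier)).not.and
    (D.eq DF.id.snd DF.topX))).congr
    (Q := fun p : V × R.Ext => p.2 = R.decX p.1) fun p => ?_
  obtain ⟨x, t⟩ := p
  constructor
  · intro (e : t = R.decX x)
    subst e
    by_cases h : x ∈ᵥ R.carrier
    · refine Or.inl ?_
      simp only [RealNumbers.decX, h, dif_pos]
      rfl
    · exact Or.inr ⟨h, dif_neg h⟩
  · rintro (h | ⟨h, h'⟩)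
    · have h : x = R.code t := h
      exact h ▸ (R.decX_code t).symm
    · have h' : t = ⊤ := h'
      rw [h']
      exact (show R.decX x = ⊤ from dif_neg h).symm

variable [hZ : Fact (IsZFC V)]

theorem DF.ev {a b : σ → V} (ha : DF L A a) (hb : DF L A b) : DF L A fun x => R.ev (a x) (b x) :=
  (ha.app hb).decX

theorem D.val {a b : σ → V} {t : σ → R.Ext} (ha : DF L A a) (hb : DF L A b) (ht : DF L A t) :
    D L A fun x => R.Val (a x) (b x) (t x) := D.mapsV ha hb ht

/-- A `w`-standard constant is `f(w)` for a standard `f`, so over standard parameters together with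
`w` it is definable. Parameters from `insert w (StdSet V)` therefore cover all `w`-standard objects.
-/
theorem DF.constW {I w c : V} (h : StdRel I w c) :
    DF L (insert w (StdSet V)) fun _ : σ => c := by
  obtain ⟨f, hf, hfI, hfc⟩ := h
  exact (DF.app (DF.constV hf) (DF.constV_mem (mem_insert w _))).congr fun _ =>
    (hfc.app_eq hfI).symm

theorem DF.constWE {I w a : V} {c : El a} (h : StdRel I w c.1) :
    DF L (insert w (StdSet V)) fun _ : σ => c := DF.of_val (DF.constW h)

/-- Besides the syntax-directed rules, constants are discharged by finding among the hypotheses that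
they are standard or `w`-standard. Several local facts in later proofs serve this search. -/
theorem D.auto {P : σ → Prop} (h : D L A P := by
    repeat' first
      | exact D.const _
      | with_reducible apply D.and
      | with_reducible apply D.or
      | with_reducible apply D.not
      | with_reducible apply D.iff
      | with_reducible apply D.imp
      | with_reducible apply D.exUnique
      | with_reducible apply D.ex
      | with_reducible apply D.all
      | with_reducible apply D.mem
      | with_reducible apply D.eq
      | with_reducible apply D.subV
      | with_reducible apply D.emptyV
      | with_reducible apply D.isUnionV
      | with_reducible apply D.isDiffV
      | with_reducible apply D.disjV
      | with_reducible apply D.isOPair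
      | with_reducible apply D.mapsV
      | with_reducible apply D.isFunOn
      | with_reducible apply D.isFun
      | with_reducible apply D.leR
      | with_reducible apply D.ltR
      | with_reducible apply D.leX
      | with_reducible apply D.val
      | with_reducible apply D.st
      | with_reducible apply DF.id
      | with_reducible apply DF.fst
      | with_reducible apply DF.snd
      | with_reducible exact DF.const_univ _
      | (with_reducible refine DF.constV ?_; with_reducible assumption)
      | (with_reducible refine DF.constE ?_; with_reducible assumption)
      | with_reducible exact DF.constW (by with_reducible assumption)
      | with_reducible exact DF.constWE (by with_reducible assumption)
      | with_reducible exact DF.constV (RealNumbers.std_carrier _)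
      | with_reducible exact DF.constV (RealNumbers.std_nat _)
      | with_reducible apply DF.val
      | with_reducible apply DF.sepV
      | with_reducible apply DF.opair
      | with_reducible apply DF.sUn
      | with_reducible apply DF.powV
      | with_reducible apply DF.cup
      | with_reducible apply DF.cap
      | with_reducible apply DF.sdiffV
      | with_reducible apply DF.app
      | with_reducible apply DF.emp
      | with_reducible apply DF.prodV
      | with_reducible apply DF.funs
      | with_reducible apply DF.lam
      | with_reducible apply DF.zeroR
      | with_reducible apply DF.oneR
      | with_reducible apply DF.addR
      | with_reducible apply DF.mulR
      | with_reducible apply DF.subR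
      | with_reducible apply DF.divR
      | with_reducible apply DF.absR
      | with_reducible apply DF.zeroX
      | with_reducible apply DF.topX
      | with_reducible apply DF.addX
      | with_reducible apply DF.coeX
      | with_reducible apply DF.decR
      | with_reducible apply DF.decX
      | with_reducible apply DF.ev
      | with_reducible apply DF.code
      | with_reducible assumption) : D L A P := h

end Reals

/-! ## Real and natural numbers of a model of `ZFC` -/

section Numbers

variable {V : Type u} [StUniverse V] [hZ : Fact (IsZFC V)]

namespace RealNumbers

variable {R : RealNumbers V}

local notation "𝔻" => D memLanguage (univ : Set V)

/-- `ℕ` is least only among the inductive sets of the universe, so the predicate must cut out such a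
set; this is why it has to be definable in the language of membership. -/
theorem nat_induction {P : El R.carrier → Prop} (hP : 𝔻 P) (h0 : P 0)
    (hs : ∀ k : El R.carrier, k.1 ∈ᵥ R.nat → P k → P (k + 1)) :
    ∀ k : El R.carrier, k.1 ∈ᵥ R.nat → P k := by
  have hQ : 𝔻 fun x => P (R.decR x) := hP.comp (DF.decR DF.id)
  have := R.nat_least (sepV R.nat fun x => P (R.decR x)) ?_ ?_
  · intro k hk
    have := ((mem_sepV hQ).1 (this k.1 hk)).2
    rwa [R.decR_val] at this
  · rw [mem_sepV hQ, R.decR_val]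
    exact ⟨R.zero_mem_nat, h0⟩
  · intro k hk
    rw [mem_sepV hQ, R.decR_val] at hk ⊢
    exact ⟨R.succ_mem_nat k hk.1, hs k hk.1 hk.2⟩

theorem nat_nonneg {k : El R.carrier} (hk : k.1 ∈ᵥ R.nat) : 0 ≤ k :=
  nat_induction (P := fun k => 0 ≤ k) D.auto le_rfl (fun _ _ h => h.trans (by simp)) k hk

theorem nat_eq_zero_or {k : El R.carrier} (hk : k.1 ∈ᵥ R.nat) :
    k = 0 ∨ ∃ j : El R.carrier, j.1 ∈ᵥ R.nat ∧ k = j + 1 :=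
  nat_induction (P := fun k : El R.carrier => k = 0 ∨ ∃ j : El R.carrier, j.1 ∈ᵥ R.nat ∧ k = j + 1)
    D.auto (Or.inl rfl) (fun k hk _ => Or.inr ⟨k, hk, rfl⟩) k hk

theorem nat_succ_le {j k : El R.carrier} (hj : j.1 ∈ᵥ R.nat) (hk : k.1 ∈ᵥ R.nat) (h : j < k) :
    j + 1 ≤ k := by
  refine nat_induction (P := fun k : El R.carrier =>
    ∀ j : El R.carrier, j.1 ∈ᵥ R.nat → j < k → j + 1 ≤ k) D.auto
    (fun j hj h => absurd h (not_lt.2 (nat_nonneg hj))) (fun k hk ih j hj h => ?_) k hk j hj h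
  rcases nat_eq_zero_or hj with rfl | ⟨i, hi, rfl⟩
  · simpa using nat_nonneg hk
  · have := ih i hi (by linarith)
    linarith

theorem nat_lt_succ {j k : El R.carrier} (hj : j.1 ∈ᵥ R.nat) (hk : k.1 ∈ᵥ R.nat) :
    j < k + 1 ↔ j ≤ k := by
  refine ⟨fun h => ?_, fun h => by linarith⟩
  have := nat_succ_le hj (R.succ_mem_nat k hk) h
  linarith

theorem nat_le_succ {j k : El R.carrier} (hj : j.1 ∈ᵥ R.nat) (hk : k.1 ∈ᵥ R.nat) :
    j ≤ k + 1 ↔ j ≤ k ∨ j = k + 1 := by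
  rw [le_iff_lt_or_eq, nat_lt_succ hj hk]

/-- Completeness concerns only subsets of `ℝ` that are sets of the universe, and definability
provides such a set. -/
theorem exists_isLUB {P : El R.carrier → Prop} (hP : 𝔻 P) (hne : ∃ r, P r)
    (hb : ∃ b, ∀ r, P r → r ≤ b) : ∃ b, IsLUB {r | P r} b := by
  have hQ : 𝔻 fun x => P (R.decR x) := hP.comp (DF.decR DF.id)
  have key : {r : El R.carrier | r.1 ∈ᵥ sepV R.carrier fun x => P (R.decR x)} = {r | P r} := by
    ext r
    rw [mem_ofPred_eq, mem_sepV hQ, R.decR_val]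
    exact and_iff_right r.2
  rw [← key]
  refine R.complete _ (fun x hx => ((mem_sepV hQ).1 hx).1) ?_ ?_
  · obtain ⟨r, hr⟩ := hne
    exact ⟨r.1, (mem_sepV hQ).2 ⟨r.2, (R.decR_val r).symm ▸ hr⟩⟩
  · obtain ⟨b, hb⟩ := hb
    rw [key]
    exact ⟨b, fun r hr => hb r hr⟩

theorem exists_nat_gt (r : El R.carrier) : ∃ n : El R.carrier, n.1 ∈ᵥ R.nat ∧ r < n := by
  by_contra! h
  obtain ⟨b, hb⟩ := exists_isLUB (R := R) (P := fun n => n.1 ∈ᵥ R.nat) D.auto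
    ⟨0, R.zero_mem_nat⟩ ⟨r, h⟩
  have : b ≤ b - 1 := hb.2 fun n hn => by
    have := hb.1 (R.succ_mem_nat n hn)
    linarith
  linarith

/-- If some finite value satisfies `P`, the infimum is the supremum of the real lower bounds;
otherwise it is `⊤`. -/
theorem exists_isGLB {P : R.Ext → Prop} (hP : 𝔻 P) (hnn : ∀ t, P t → 0 ≤ t) :
    ∃ t, IsGLB {t | P t} t := by
  by_cases h : ∃ r : El R.carrier, P r
  · obtain ⟨r, hr⟩ := h
    have hQ : 𝔻 fun s : El R.carrier => ∀ r : El R.carrier, P r → s ≤ r :=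
      D.all (D.imp (hP.comp DF.id.snd.coeX) (D.leR DF.id.fst DF.id.snd))
    obtain ⟨b, hb⟩ := exists_isLUB hQ ⟨0, fun r hr => WithTop.coe_le_coe.1 (hnn _ hr)⟩
      ⟨r, fun s hs => hs r hr⟩
    refine ⟨b, fun t ht => ?_, fun t ht => ?_⟩
    · induction t using WithTop.recTopCoe with
      | top => exact le_top
      | coe t => exact WithTop.coe_le_coe.2 (hb.2 fun s hs => hs t ht)
    · induction t using WithTop.recTopCoe with
      | top => exact absurd (ht hr) (not_le.2 (WithTop.coe_lt_top r))
      | coe t => exact WithTop.coe_le_coe.2 (hb.1 fun s hs => WithTop.coe_le_coe.1 (ht hs))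
  · refine ⟨⊤, fun t ht => ?_, fun t _ => le_top⟩
    induction t using WithTop.recTopCoe with
    | top => exact le_rfl
    | coe t => exact absurd ⟨t, ht⟩ h

/-- A definable predicate that holds at `0` has a largest instance below `ν`. -/
theorem exists_max_nat {P : El R.carrier → Prop} (hP : 𝔻 P) (h0 : P 0) {ν : El R.carrier}
    (hν : ν.1 ∈ᵥ R.nat) : ∃ n : El R.carrier, n.1 ∈ᵥ R.nat ∧ n ≤ ν ∧ P n ∧
      ∀ k : El R.carrier, k.1 ∈ᵥ R.nat → k ≤ ν → P k → k ≤ n := by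
  refine nat_induction (P := fun ν => ∃ n : El R.carrier, n.1 ∈ᵥ R.nat ∧ n ≤ ν ∧ P n ∧
      ∀ k : El R.carrier, k.1 ∈ᵥ R.nat → k ≤ ν → P k → k ≤ n) ?_
      ⟨0, R.zero_mem_nat, le_rfl, h0, fun _ _ h _ => h⟩ (fun ν hν ih => ?_) ν hν
  · have hP' : ∀ {σ : Type u} [Coded V σ] {f : σ → El R.carrier},
        DF memLanguage univ f → 𝔻 fun x => P (f x) := fun hf => hP.comp hf
    exact D.ex (D.and D.auto (D.and D.auto (D.and (hP' DF.id.snd)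
      (D.all (D.imp D.auto (D.imp D.auto (D.imp (hP' DF.id.snd) D.auto)))))))
  · by_cases h : P (ν + 1)
    · exact ⟨ν + 1, R.succ_mem_nat _ hν, le_rfl, h, fun _ _ h _ => h⟩
    · obtain ⟨n, hn, hnν, hPn, hmax⟩ := ih
      refine ⟨n, hn, hnν.trans (by simp), hPn, fun k hk hkν hPk => hmax k hk ?_ hPk⟩
      rcases (nat_le_succ hk hν).1 hkν with h' | rfl
      exacts [h', absurd hPk h]

theorem le_of_forall_pos_le_addX {a b : R.Ext}
    (h : ∀ ε : El R.carrier, 0 < ε → a ≤ b + ε) : a ≤ b := by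
  induction b using WithTop.recTopCoe with
  | top => exact le_top
  | coe b =>
    induction a using WithTop.recTopCoe with
    | top => exact absurd (h 1 one_pos) (by rw [← WithTop.coe_add]; simp)
    | coe a =>
      rw [WithTop.coe_le_coe]
      refine le_of_forall_pos_le_add fun ε hε => ?_
      have := h ε hε
      rwa [← WithTop.coe_add, WithTop.coe_le_coe] at this

theorem val_iff_ev {f a x : V} {t : R.Ext} (hf : R.IsExtFun f a) (hx : x ∈ᵥ a) :
    R.Val f x t ↔ t = R.ev f x := by
  unfold Val
  rw [hf.1.mapsV hx]
  obtain ⟨s, -, hs⟩ := hf.2 x _ (hf.1.maps_app hx)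
  rw [ev, hs, R.decX_code, R.code_injective.eq_iff]

theorem val_ev {f a x : V} (hf : R.IsExtFun f a) (hx : x ∈ᵥ a) : R.Val f x (R.ev f x) :=
  (val_iff_ev hf hx).2 rfl

theorem Val.ev_eq {f a x : V} {t : R.Ext} (hf : R.IsExtFun f a) (h : R.Val f x t) :
    R.ev f x = t := ((val_iff_ev hf (hf.1.mem_dom h)).1 h).symm

theorem ev_nonneg {f a x : V} (hf : R.IsExtFun f a) (hx : x ∈ᵥ a) : 0 ≤ R.ev f x := by
  obtain ⟨s, hs, e⟩ := hf.2 x _ (hf.1.maps_app hx)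
  rwa [ev, e, R.decX_code]

theorem isExtFun_lam {a : V} {F : V → R.Ext} (hF : DF memLanguage (univ : Set V) F)
    (h0 : ∀ x, x ∈ᵥ a → 0 ≤ F x) : R.IsExtFun (lam a fun x => R.code (F x)) a := by
  refine ⟨isFunOn_lam hF.code, fun x y hxy => ?_⟩
  rw [mapsV_lam hF.code] at hxy
  exact ⟨F x, h0 x hxy.1, hxy.2⟩

theorem ev_lam {a : V} {F : V → R.Ext} (hF : DF memLanguage (univ : Set V) F) {x : V}
    (hx : x ∈ᵥ a) : R.ev (lam a fun x => R.code (F x)) x = F x := by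
  rw [ev, app_lam hF.code hx, R.decX_code]

end RealNumbers

/-! ### Definability of the notions of measure theory -/

variable {R : RealNumbers V}
variable {L : FirstOrder.Language.{0, 0}} [L.Structure V] [MemLang L V] {A : Set V} [StdSub A]
variable {σ : Type*} [Coded V σ] {a b c d e : σ → V}

theorem D.isSeq (ha : DF L A a) (hb : DF L A b) : D L A fun x => R.IsSeq (a x) (b x) :=
  D.comp₂ (P := R.IsSeq) (by unfold RealNumbers.IsSeq; exact D.auto) ha hb

theorem D.isUnionSeq (ha : DF L A a) (hb : DF L A b) : D L A fun x => R.IsUnionSeq (a x) (b x) :=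
  D.comp₂ (P := R.IsUnionSeq) (by unfold RealNumbers.IsUnionSeq; exact D.auto) ha hb

theorem D.isAlgebraOn (ha : DF L A a) (hb : DF L A b) :
    D L A fun x => RealNumbers.IsAlgebraOn (a x) (b x) := by
  refine D.comp₂ (P := RealNumbers.IsAlgebraOn) ?_ ha hb
  refine D.congr (P := fun p : V × V => (∀ X, X ∈ᵥ p.2 → SubV X p.1) ∧ p.1 ∈ᵥ p.2 ∧
    (∀ X Y, X ∈ᵥ p.2 → IsDiffV Y p.1 X → Y ∈ᵥ p.2) ∧
    ∀ X Y Z, X ∈ᵥ p.2 → Y ∈ᵥ p.2 → IsUnionV Z X Y → Z ∈ᵥ p.2) D.auto fun p => ?_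
  exact ⟨fun h => ⟨h.1, h.2, h.3, h.4⟩, fun h => ⟨h.1, h.2.1, h.2.2.1, h.2.2.2⟩⟩

theorem D.isSigmaAlgebraOn (ha : DF L A a) (hb : DF L A b) :
    D L A fun x => R.IsSigmaAlgebraOn (a x) (b x) := by
  refine D.comp₂ (P := R.IsSigmaAlgebraOn) ?_ ha hb
  refine D.congr (P := fun p : V × V => RealNumbers.IsAlgebraOn p.1 p.2 ∧
    ∀ A W, R.IsSeq A p.2 → R.IsUnionSeq W A → W ∈ᵥ p.2)
    (D.and (D.isAlgebraOn DF.id.fst DF.id.snd) (D.all (D.all (D.imp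
      (D.isSeq DF.id.fst.snd DF.id.fst.fst.snd) (D.imp (D.isUnionSeq DF.id.snd DF.id.fst.snd)
      D.auto))))) fun p => ?_
  exact ⟨fun h => ⟨h.1, h.2⟩, fun h => ⟨h.1, h.2⟩⟩

theorem D.squeezed (ha : DF L A a) (hb : DF L A b) (hc : DF L A c) (hd : DF L A d)
    (he : DF L A e) : D L A fun x => R.Squeezed (a x) (b x) (c x) (d x) (e x) := by
  refine D.comp (P := fun p : V × V × V × V × V => R.Squeezed p.1 p.2.1 p.2.2.1 p.2.2.2.1
    p.2.2.2.2) ?_ (ha.pair (hb.pair (hc.pair (hd.pair he))))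
  unfold RealNumbers.Squeezed
  exact D.auto

end Numbers

/-! ## Carathéodory extension in a model of `ZFC` -/

section Caratheodory

variable {V : Type u} [StUniverse V] [hZ : Fact (IsZFC V)]

namespace RealNumbers

variable {R : RealNumbers V}

local notation "𝔻" => D memLanguage (univ : Set V)

theorem IsAlgebraOn.diff_mem {C B X : V} (h : IsAlgebraOn C B) (hX : X ∈ᵥ B) : sdiffV C X ∈ᵥ B :=
  h.compl X _ hX (isDiffV_iff.2 rfl)

theorem IsAlgebraOn.cup_mem {C B X Y : V} (h : IsAlgebraOn C B) (hX : X ∈ᵥ B) (hY : Y ∈ᵥ B) :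
    cup X Y ∈ᵥ B := h.union X Y _ hX hY (isUnionV_iff.2 rfl)

theorem IsAlgebraOn.emp_mem {C B : V} (h : IsAlgebraOn C B) : emp V ∈ᵥ B := by
  have e : emp V = sdiffV C C := set_ext fun x => by
    rw [mem_sdiffV]
    exact iff_of_false (notMem_emp x) fun h => h.2 h.1
  exact e ▸ h.diff_mem h.whole

theorem IsAlgebraOn.cap_mem {C B X Y : V} (h : IsAlgebraOn C B) (hX : X ∈ᵥ B) (hY : Y ∈ᵥ B) :
    cap X Y ∈ᵥ B := by
  have e : cap X Y = sdiffV C (cup (sdiffV C X) (sdiffV C Y)) := set_ext fun x => by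
    have := h.sub X hX x
    simp only [mem_sdiffV, mem_cap, mem_cup]
    tauto
  exact e ▸ h.diff_mem (h.cup_mem (h.diff_mem hX) (h.diff_mem hY))

theorem IsAlgebraOn.sdiff_mem {C B X Y : V} (h : IsAlgebraOn C B) (hX : X ∈ᵥ B) (hY : Y ∈ᵥ B) :
    sdiffV X Y ∈ᵥ B := by
  have e : sdiffV X Y = cap X (sdiffV C Y) := set_ext fun x => by
    have := h.sub X hX x
    simp only [mem_sdiffV, mem_cap]
    tauto
  exact e ▸ h.cap_mem hX (h.diff_mem hY)

/-! ### Finitely additive measures -/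

section FinAdd

variable {C B m : V} (hm : R.IsFinAddSpace C B m)

include hm

theorem IsFinAddSpace.ev_emp : R.ev m (emp V) = 0 :=
  (hm.empty _ (emptyV_iff.2 rfl)).ev_eq hm.isExtFun

theorem IsFinAddSpace.ev_cup {X Y : V} (hX : X ∈ᵥ B) (hY : Y ∈ᵥ B) (h : DisjV X Y) :
    R.ev m (cup X Y) = R.ev m X + R.ev m Y :=
  (hm.additive X Y _ _ _ hX hY h (isUnionV_iff.2 rfl) (val_ev hm.isExtFun hX)
    (val_ev hm.isExtFun hY)).ev_eq hm.isExtFun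

theorem IsFinAddSpace.ev_cap_add_diff {X Y : V} (hX : X ∈ᵥ B) (hY : Y ∈ᵥ B) :
    R.ev m (cap X Y) + R.ev m (sdiffV X Y) = R.ev m X := by
  rw [← hm.ev_cup (hm.alg.cap_mem hX hY) (hm.alg.sdiff_mem hX hY)]
  · congr 1
    refine set_ext fun x => ?_
    simp only [mem_cup, mem_cap, mem_sdiffV]
    tauto
  · intro x
    simp only [mem_cap, mem_sdiffV]
    tauto

theorem IsFinAddSpace.ev_mono {X Y : V} (hX : X ∈ᵥ B) (hY : Y ∈ᵥ B) (h : SubV X Y) :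
    R.ev m X ≤ R.ev m Y := by
  rw [← hm.ev_cap_add_diff hY hX]
  have e : cap Y X = X := set_ext fun x => by
    have := h x
    rw [mem_cap]
    tauto
  rw [e]
  exact le_add_of_nonneg_right (ev_nonneg hm.isExtFun (hm.alg.sdiff_mem hY hX))

/-- The modular law is kept as a sum on both sides, since subtraction is unavailable when a value is
infinite. -/
theorem IsFinAddSpace.ev_cup_add_cap {X Y : V} (hX : X ∈ᵥ B) (hY : Y ∈ᵥ B) :
    R.ev m (cup X Y) + R.ev m (cap X Y) = R.ev m X + R.ev m Y := by
  have e : cup X Y = cup X (sdiffV Y X) := set_ext fun x => by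
    simp only [mem_cup, mem_sdiffV]
    tauto
  have e' : cap X Y = cap Y X := set_ext fun x => by
    simp only [mem_cap]
    tauto
  rw [e, hm.ev_cup hX (hm.alg.sdiff_mem hY hX), e', add_assoc, add_comm (R.ev m (sdiffV Y X)),
    hm.ev_cap_add_diff hY hX]
  intro x
  rw [mem_sdiffV]
  tauto

end FinAdd

/-! ### Partial unions -/

variable (R) in
/-- The union of the sets `A_j ⊆ C` with `j < k`. -/
noncomputable def pUn (C A : V) (k : El R.carrier) : V :=
  sepV C fun x => ∃ j : El R.carrier, j.1 ∈ᵥ R.nat ∧ j < k ∧ x ∈ᵥ app A j.1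

theorem mem_pUn {C A : V} {k : El R.carrier} {x : V} : x ∈ᵥ R.pUn C A k ↔
    x ∈ᵥ C ∧ ∃ j : El R.carrier, j.1 ∈ᵥ R.nat ∧ j < k ∧ x ∈ᵥ app A j.1 := mem_sepV D.auto

theorem pUn_zero {C A : V} : R.pUn C A 0 = emp V :=
  emptyV_iff.1 fun x hx => by
    obtain ⟨_, j, hj, hj', _⟩ := mem_pUn.1 hx
    exact absurd hj' (not_lt.2 (nat_nonneg hj))

theorem pUn_succ {C A : V} {k : El R.carrier} (hk : k.1 ∈ᵥ R.nat) (h : SubV (app A k.1) C) :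
    R.pUn C A (k + 1) = cup (R.pUn C A k) (app A k.1) := by
  refine set_ext fun x => ?_
  rw [mem_cup, mem_pUn, mem_pUn]
  constructor
  · rintro ⟨hx, j, hj, hjk, hxj⟩
    rcases ((nat_lt_succ hj hk).1 hjk).lt_or_eq with h' | rfl
    exacts [Or.inl ⟨hx, j, hj, h', hxj⟩, Or.inr hxj]
  · rintro (⟨hx, j, hj, hjk, hxj⟩ | hx)
    · exact ⟨hx, j, hj, hjk.trans (lt_add_one k), hxj⟩
    · exact ⟨h x hx, k, hk, lt_add_one k, hx⟩

theorem _root_.DF.pUn {L : FirstOrder.Language.{0, 0}} [L.Structure V] [MemLang L V] {A : Set V}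
    [StdSub A] {σ : Type*} [Coded V σ] {a b : σ → V} {k : σ → El R.carrier} (ha : DF L A a)
    (hb : DF L A b) (hk : DF L A k) : DF L A fun x => R.pUn (a x) (b x) (k x) := by
  refine DF.comp (g := fun p : V × V × El R.carrier => R.pUn p.1 p.2.1 p.2.2) ?_
    (ha.pair (hb.pair hk))
  exact DF.sepV DF.id.fst D.auto

theorem pUn_mem {C S A : V} (hS : IsAlgebraOn C S) (hA : R.IsSeq A S) (k : El R.carrier)
    (hk : k.1 ∈ᵥ R.nat) : R.pUn C A k ∈ᵥ S := by
  refine nat_induction (P := fun k => R.pUn C A k ∈ᵥ S)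
    (D.mem (DF.pUn (DF.const_univ _) (DF.const_univ _) DF.id) (DF.const_univ _)) ?_ ?_ k hk
  · rw [pUn_zero]
    exact hS.emp_mem
  · intro k hk ih
    have := hA.app_mem hk
    rw [pUn_succ hk (hS.sub _ this)]
    exact hS.cup_mem ih this

/-! ### The outer measure -/

variable (R) in
/-- The infimum of `m(A)` over the members `A ⊇ E` of `B`. -/
noncomputable def outer (B m E : V) : R.Ext :=
  R.decX (the fun y => ∃ t : R.Ext, y = R.code t ∧ (∀ A, A ∈ᵥ B → SubV E A → t ≤ R.ev m A) ∧
    ∀ s : R.Ext, (∀ A, A ∈ᵥ B → SubV E A → s ≤ R.ev m A) → s ≤ t)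

theorem _root_.DF.outer {L : FirstOrder.Language.{0, 0}} [L.Structure V] [MemLang L V] {A : Set V}
    [StdSub A] {σ : Type*} [Coded V σ] {a b c : σ → V} (ha : DF L A a)
    (hb : DF L A b) (hc : DF L A c) : DF L A fun x => R.outer (a x) (b x) (c x) := by
  refine DF.comp (g := fun p : V × V × V => R.outer p.1 p.2.1 p.2.2) ?_ (ha.pair (hb.pair hc))
  exact DF.decX (DF.the D.auto)

section Outer

variable {C B m : V}

/-- The infimum runs over single members of `B` rather than countable covers. It exists because the
values are nonnegative and definable, and it is `⊤` when there is no cover. -/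
theorem outer_spec (hm : R.IsExtFun m B) (E : V) :
    (∀ A, A ∈ᵥ B → SubV E A → R.outer B m E ≤ R.ev m A) ∧
    ∀ s : R.Ext, (∀ A, A ∈ᵥ B → SubV E A → s ≤ R.ev m A) → s ≤ R.outer B m E := by
  obtain ⟨t, ht⟩ := exists_isGLB (R := R) (P := fun t => ∃ A, A ∈ᵥ B ∧ SubV E A ∧ t = R.ev m A)
    D.auto (by rintro _ ⟨A, hA, -, rfl⟩; exact ev_nonneg hm hA)
  have h₁ : ∀ A, A ∈ᵥ B → SubV E A → t ≤ R.ev m A := fun A hA hE => ht.1 ⟨A, hA, hE, rfl⟩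
  have h₂ : ∀ s : R.Ext, (∀ A, A ∈ᵥ B → SubV E A → s ≤ R.ev m A) → s ≤ t :=
    fun s hs => ht.2 (by rintro _ ⟨A, hA, hE, rfl⟩; exact hs A hA hE)
  have : R.outer B m E = t := by
    rw [outer, the_eq (x := R.code t) ⟨t, rfl, h₁, h₂⟩, R.decX_code]
    rintro _ ⟨s, rfl, h₁', h₂'⟩
    rw [le_antisymm (h₂ s h₁') (h₂' t h₁)]
  rw [this]
  exact ⟨h₁, h₂⟩

theorem outer_le (hm : R.IsExtFun m B) {E A : V} (hA : A ∈ᵥ B) (h : SubV E A) :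
    R.outer B m E ≤ R.ev m A := (outer_spec hm E).1 A hA h

theorem le_outer (hm : R.IsExtFun m B) {E : V} {s : R.Ext}
    (h : ∀ A, A ∈ᵥ B → SubV E A → s ≤ R.ev m A) : s ≤ R.outer B m E := (outer_spec hm E).2 s h

theorem outer_nonneg (hm : R.IsExtFun m B) (E : V) : 0 ≤ R.outer B m E :=
  le_outer hm fun _ hA _ => ev_nonneg hm hA

theorem outer_mono (hm : R.IsExtFun m B) {E F : V} (h : SubV E F) :
    R.outer B m E ≤ R.outer B m F :=
  le_outer hm fun _ hA hF => outer_le hm hA fun x hx => hF x (h x hx)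

theorem exists_cover (hm : R.IsExtFun m B) {E : V} {ε : El R.carrier} (hε : 0 < ε)
    (h : R.outer B m E ≠ ⊤) : ∃ A, A ∈ᵥ B ∧ SubV E A ∧ R.ev m A ≤ R.outer B m E + ε := by
  by_contra! h'
  have h₁ := le_outer hm fun A hA hE => (h' A hA hE).le
  lift R.outer B m E to El R.carrier using h with t
  rw [← WithTop.coe_add, WithTop.coe_le_coe] at h₁
  linarith

variable (hm : R.IsFinAddSpace C B m)

include hm

theorem outer_eq {E : V} (hE : E ∈ᵥ B) : R.outer B m E = R.ev m E :=
  le_antisymm (outer_le hm.isExtFun hE fun _ h => h)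
    (le_outer hm.isExtFun fun _ hA h => hm.ev_mono hE hA h)

theorem outer_emp : R.outer B m (emp V) = 0 := by
  rw [outer_eq hm hm.alg.emp_mem, hm.ev_emp]

/-- The union of a cover of each set within `ε / 2` covers the union, and finite additivity bounds
its measure. -/
theorem outer_cup_le (E F : V) :
    R.outer B m (cup E F) ≤ R.outer B m E + R.outer B m F := by
  by_cases hE : R.outer B m E = ⊤
  · simp [hE]
  by_cases hF : R.outer B m F = ⊤
  · simp [hF]
  refine le_of_forall_pos_le_addX fun ε hε => ?_
  obtain ⟨A, hA, hEA, h₁⟩ := exists_cover hm.isExtFun (half_pos hε) hE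
  obtain ⟨A', hA', hFA, h₂⟩ := exists_cover hm.isExtFun (half_pos hε) hF
  have h₃ : R.outer B m (cup E F) ≤ R.ev m (cup A A') := by
    refine outer_le hm.isExtFun (hm.alg.cup_mem hA hA') fun x hx => ?_
    rw [mem_cup] at hx ⊢
    exact hx.imp (hEA x) (hFA x)
  have h₄ : R.ev m (cup A A') ≤ R.ev m A + R.ev m A' := by
    rw [← hm.ev_cup_add_cap hA hA']
    exact le_add_of_nonneg_right (ev_nonneg hm.isExtFun (hm.alg.cap_mem hA hA'))
  refine h₃.trans (h₄.trans ((add_le_add h₁ h₂).trans (le_of_eq ?_)))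
  rw [add_add_add_comm, ← WithTop.coe_add, add_halves]

end Outer

/-! ### Continuity from below -/

variable (R) in
/-- An increasing sequence of members of `B` whose measures are bounded by `t` has an upper bound
in `B` of measure at most `t`. -/
def IncreasingBounded (B m : V) : Prop :=
  ∀ (A : V) (t : El R.carrier), R.IsSeq A B →
    (∀ k : El R.carrier, k.1 ∈ᵥ R.nat → SubV (app A k.1) (app A (k + 1).1)) →
    (∀ k : El R.carrier, k.1 ∈ᵥ R.nat → R.ev m (app A k.1) ≤ t) →
    ∃ U, U ∈ᵥ B ∧ (∀ k : El R.carrier, k.1 ∈ᵥ R.nat → SubV (app A k.1) U) ∧ R.ev m U ≤ t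

section Cont

variable {C B m : V} (hm : R.IsFinAddSpace C B m) (hb : R.IncreasingBounded B m)

include hm hb

/-- Cover each `E_k` by some `A_k` in `B` with a small error. The unions `A_0 ∪ … ∪ A_k` have
measure at most that of `E_k` plus a total error below `ε`, because the overlap of this union with
`A_{k+1}` still contains `E_k`. `IncreasingBounded` then encloses all of them in one member of `B`,
which covers `W`. -/
theorem outer_iUnion_le {E W : V} {t : R.Ext}
    (hE : ∀ k : El R.carrier, k.1 ∈ᵥ R.nat → SubV (app E k.1) (app E (k + 1).1))
    (ht : ∀ k : El R.carrier, k.1 ∈ᵥ R.nat → R.outer B m (app E k.1) ≤ t)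
    (hW : ∀ x, x ∈ᵥ W → ∃ k : El R.carrier, k.1 ∈ᵥ R.nat ∧ x ∈ᵥ app E k.1) :
    R.outer B m W ≤ t := by
  induction t using WithTop.recTopCoe with
  | top => exact le_top
  | coe t =>
  refine le_of_forall_pos_le_addX fun ε hε => ?_
  -- The errors `ε / ((k + 1)(k + 2))` telescope to `ε (1 - 1 / (k + 2))`, so the total error has a
  -- closed form and stays below `ε`.
  have hD : D memLanguage (univ : Set V) fun p : V × V => SubV (app E p.1) p.2 ∧
      R.ev m p.2 ≤ R.outer B m (app E p.1) +
        ((ε / ((R.decR p.1 + 1) * (R.decR p.1 + 2)) : El R.carrier) : R.Ext) :=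
    D.and D.auto (D.leX (DF.ev (DF.const_univ _) DF.id.snd)
      (DF.addX (DF.outer (DF.const_univ _) (DF.const_univ _) (DF.app (DF.const_univ _) DF.id.fst))
      (DF.coeX (DF.divR (DF.const_univ _) (DF.mulR (DF.addR (DF.decR DF.id.fst) (DF.const_univ _))
        (DF.addR (DF.decR DF.id.fst) (DF.const_univ _)))))))
  have hfin : ∀ k : El R.carrier, k.1 ∈ᵥ R.nat → R.outer B m (app E k.1) ≠ ⊤ := fun k hk h => by
    have := ht k hk
    rw [h, top_le_iff] at this
    exact WithTop.coe_ne_top this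
  obtain ⟨A, hA, hEA⟩ := exists_choice_fun (a := R.nat) (b := B) (P := fun x y =>
      SubV (app E x) y ∧ R.ev m y ≤ R.outer B m (app E x) +
        ((ε / ((R.decR x + 1) * (R.decR x + 2)) : El R.carrier) : R.Ext)) hD (by
    intro x hx
    have hxR := R.nat_sub x hx
    obtain ⟨k, rfl⟩ : ∃ k : El R.carrier, k.1 = x := ⟨⟨x, hxR⟩, rfl⟩
    have h0 := nat_nonneg hx
    rw [R.decR_val]
    exact exists_cover hm.isExtFun (div_pos hε (by positivity)) (hfin k hx))
  have hAB : ∀ k : El R.carrier, k.1 ∈ᵥ R.nat → app A k.1 ∈ᵥ B := fun k hk => hA.app_mem hk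
  have hAC : ∀ k : El R.carrier, k.1 ∈ᵥ R.nat → SubV (app A k.1) C :=
    fun k hk => hm.alg.sub _ (hAB k hk)
  have hU : ∀ k : El R.carrier, k.1 ∈ᵥ R.nat → R.pUn C A k ∈ᵥ B := pUn_mem hm.alg hA
  have hbound : ∀ k : El R.carrier, k.1 ∈ᵥ R.nat → R.ev m (R.pUn C A (k + 1)) ≤
      R.outer B m (app E k.1) + ((ε * (1 - 1 / (k + 2)) : El R.carrier) : R.Ext) := by
    refine nat_induction ?_ ?_ ?_
    · exact D.leX (DF.ev (DF.const_univ _) (DF.pUn (DF.const_univ _) (DF.const_univ _)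
        (DF.addR DF.id (DF.const_univ _)))) (DF.addX (DF.outer (DF.const_univ _) (DF.const_univ _)
        (DF.app (DF.const_univ _) DF.id)) (DF.coeX (DF.mulR (DF.const_univ _)
        (DF.subR (DF.const_univ _) (DF.divR (DF.const_univ _) (DF.addR DF.id
        (DF.const_univ _)))))))
    · have := (hEA _ R.zero_mem_nat).2
      rw [R.decR_val] at this
      rw [pUn_succ R.zero_mem_nat (hAC 0 R.zero_mem_nat), pUn_zero]
      have e : cup (emp V) (app A (0 : El R.carrier).1) = app A (0 : El R.carrier).1 :=
        set_ext fun x => by simp [mem_cup, notMem_emp]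
      rw [e]
      convert this using 4
      norm_num
      ring
    · intro k hk ih
      have hk1 := R.succ_mem_nat k hk
      have h0 := nat_nonneg hk
      rw [pUn_succ hk1 (hAC _ hk1)]
      have h₁ := hm.ev_cup_add_cap (hU _ hk1) (hAB _ hk1)
      -- `E_k` lies in `A_k`, and also in `A_{k+1}` because it lies in `E_{k+1}`. In the modular law
      -- this cancels the term for `E_k` in the induction hypothesis, which is finite by `hfin`.
      have h₂ : R.outer B m (app E k.1) ≤ R.ev m (cap (R.pUn C A (k + 1)) (app A (k + 1).1)) := by
        refine outer_le hm.isExtFun (hm.alg.cap_mem (hU _ hk1) (hAB _ hk1)) fun x hx => ?_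
        rw [mem_cap, pUn_succ hk (hAC k hk), mem_cup]
        exact ⟨Or.inr ((hEA _ hk).1 x hx), (hEA _ hk1).1 x (hE k hk x hx)⟩
      have h₃ := (hEA _ hk1).2
      rw [R.decR_val] at h₃
      have hf := hfin k hk
      have hf' := hfin _ hk1
      generalize R.outer B m (app E k.1) = a at *
      generalize R.outer B m (app E (k + 1).1) = b at *
      lift a to El R.carrier using hf
      lift b to El R.carrier using hf'
      have h₄ := (add_le_add_right h₂ _).trans (h₁.le.trans (add_le_add ih h₃))
      simp only [← WithTop.coe_add] at h₄ ⊢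
      obtain ⟨c, hc⟩ : ∃ c : El R.carrier,
          R.ev m (cup (R.pUn C A (k + 1)) (app A (k + 1).1)) = c := by
        refine WithTop.ne_top_iff_exists.1 (fun h => ?_) |>.imp fun _ h => h.symm
        rw [h, top_add, top_le_iff] at h₄
        exact WithTop.coe_ne_top h₄
      rw [hc] at h₄ ⊢
      rw [← WithTop.coe_add, WithTop.coe_le_coe] at h₄
      rw [WithTop.coe_le_coe]
      have e : ε * (1 - 1 / (k + 2)) + ε / ((k + 1 + 1) * (k + 1 + 2)) =
          ε * (1 - 1 / (k + 1 + 2)) := by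
        have h₅ : k + 2 ≠ 0 := by positivity
        have h₆ : k + 1 + 2 ≠ 0 := by positivity
        have h₇ : k + 1 + 1 = k + 2 := by ring
        rw [h₇]
        field_simp
        ring
      rw [← e]
      linarith
  -- The shift by one makes the `k`-th term the union of `A_0, …, A_k`, so that it contains `E_k`.
  have hseq : DF memLanguage (univ : Set V) fun x => R.pUn C A (R.decR x + 1) :=
    DF.pUn (DF.const_univ _) (DF.const_univ _) (DF.addR (DF.decR DF.id) (DF.const_univ _))
  have happ : ∀ k : El R.carrier, k.1 ∈ᵥ R.nat →
      app (lam R.nat fun x => R.pUn C A (R.decR x + 1)) k.1 = R.pUn C A (k + 1) := fun k hk => by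
    rw [app_lam hseq hk, R.decR_val]
  obtain ⟨U, hUB, hAU, hUt⟩ := hb (lam R.nat fun x => R.pUn C A (R.decR x + 1)) (t + ε)
    (isFun_iff.2 ⟨isFunOn_lam hseq, fun x hx => by
      have hxR := R.nat_sub x hx
      obtain ⟨k, rfl⟩ : ∃ k : El R.carrier, k.1 = x := ⟨⟨x, hxR⟩, rfl⟩
      rw [happ k hx]
      exact hU _ (R.succ_mem_nat k hx)⟩)
    (fun k hk x hx => by
      have hk1 := R.succ_mem_nat k hk
      rw [happ k hk] at hx
      rw [happ _ hk1, pUn_succ hk1 (hAC _ hk1), mem_cup]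
      exact Or.inl hx)
    (fun k hk => by
      rw [happ k hk, WithTop.coe_add]
      refine (hbound k hk).trans (add_le_add (ht k hk) (WithTop.coe_le_coe.2 ?_))
      have h0 := nat_nonneg hk
      have : 0 ≤ 1 / (k + 2) := by positivity
      nlinarith)
  refine (outer_le hm.isExtFun hUB fun x hx => ?_).trans hUt
  obtain ⟨k, hk, hxk⟩ := hW x hx
  refine hAU k hk x ?_
  rw [happ k hk, pUn_succ hk (hAC k hk), mem_cup]
  exact Or.inr ((hEA _ hk).1 x hxk)

end Cont

end RealNumbers

end Caratheodory

/-! ### Measurable sets, the generated σ-algebra and the completion -/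

section Extension

variable {V : Type u} [StUniverse V] [hZ : Fact (IsZFC V)]

namespace RealNumbers

variable {R : RealNumbers V} {C B m : V}

theorem mem_pUn_iff_of_union {S A W : V} (hS : IsAlgebraOn C S) (hA : R.IsSeq A S)
    (hW : R.IsUnionSeq W A) (x : V) :
    x ∈ᵥ W ↔ ∃ k : El R.carrier, k.1 ∈ᵥ R.nat ∧ x ∈ᵥ R.pUn C A k := by
  rw [hW x]
  constructor
  · rintro ⟨k, X, hk, hX, hx⟩
    obtain ⟨k, rfl⟩ : ∃ l : El R.carrier, l.1 = k := ⟨⟨k, R.nat_sub k hk⟩, rfl⟩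
    rw [hA.1.mapsV hk] at hX
    subst hX
    exact ⟨k + 1, R.succ_mem_nat k hk, mem_pUn.2 ⟨hS.sub _ (hA.app_mem hk) x hx, k, hk,
      lt_add_one k, hx⟩⟩
  · rintro ⟨k, hk, hx⟩
    obtain ⟨_, j, hj, _, hxj⟩ := mem_pUn.1 hx
    exact ⟨j.1, _, hj, hA.1.maps_app hj, hxj⟩

theorem pUn_subV_succ {A : V} {k : El R.carrier} :
    SubV (R.pUn C A k) (R.pUn C A (k + 1)) := fun x hx => by
  rw [mem_pUn] at hx ⊢
  obtain ⟨hx, j, hj, hjk, h⟩ := hx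
  exact ⟨hx, j, hj, hjk.trans (lt_add_one k), h⟩

variable (R) in
/-- The Carathéodory-measurable subsets of `C`. -/
noncomputable def caraV (C B m : V) : V :=
  sepV (powV C) fun E => ∀ T, SubV T C →
    R.outer B m (cap T E) + R.outer B m (sdiffV T E) ≤ R.outer B m T

theorem mem_caraV {E : V} : E ∈ᵥ R.caraV C B m ↔ SubV E C ∧ ∀ T, SubV T C →
    R.outer B m (cap T E) + R.outer B m (sdiffV T E) ≤ R.outer B m T := by
  rw [caraV, mem_sepV, mem_powV]
  exact D.all (D.imp D.auto (D.leX (DF.addX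
    (DF.outer (DF.const_univ _) (DF.const_univ _) (DF.cap DF.id.snd DF.id.fst))
    (DF.outer (DF.const_univ _) (DF.const_univ _) (DF.sdiffV DF.id.snd DF.id.fst)))
    (DF.outer (DF.const_univ _) (DF.const_univ _) DF.id.snd)))

variable (R) in
/-- The σ-algebra of subsets of `C` generated by `B`. -/
noncomputable def genSigma (C B : V) : V :=
  sepV (powV C) fun E => ∀ T, R.IsSigmaAlgebraOn C T → SubV B T → E ∈ᵥ T

theorem mem_genSigma {E : V} : E ∈ᵥ R.genSigma C B ↔
    SubV E C ∧ ∀ T, R.IsSigmaAlgebraOn C T → SubV B T → E ∈ᵥ T := by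
  rw [genSigma, mem_sepV, mem_powV]
  exact D.all (D.imp (D.isSigmaAlgebraOn (DF.const_univ _) DF.id.snd) D.auto)

variable (R) in
/-- The outer measure, as a function on `S`. -/
noncomputable def outerFun (S B m : V) : V := lam S fun E => R.code (R.outer B m E)

variable (R) in
/-- The subsets `Y` of `C` with `X ⊆ Y ⊆ Z` for some `X, Z ∈ S` with `m(Z \ X) = 0`. -/
noncomputable def completionV (C S m : V) : V :=
  sepV (powV C) fun Y => ∃ X Z, R.Squeezed S m X Y Z

theorem mem_completionV {S Y : V} : Y ∈ᵥ R.completionV C S m ↔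
    SubV Y C ∧ ∃ X Z, R.Squeezed S m X Y Z := by
  rw [completionV, mem_sepV, mem_powV]
  exact D.ex (D.ex (D.squeezed (DF.const_univ _) (DF.const_univ _) DF.id.fst.snd DF.id.fst.fst
    DF.id.snd))

theorem isSigmaAlgebraOn_genSigma (hB : ∀ X, X ∈ᵥ B → SubV X C) :
    R.IsGeneratedBy C B (R.genSigma C B) where
  sigma :=
    { alg :=
        { sub := fun X hX => (mem_genSigma.1 hX).1
          whole := mem_genSigma.2 ⟨fun _ h => h, fun T hT _ => hT.alg.whole⟩
          compl := fun X Y hX hY => mem_genSigma.2 ⟨fun x hx => ((hY x).1 hx).1, fun T hT hBT =>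
            hT.alg.compl X Y ((mem_genSigma.1 hX).2 T hT hBT) hY⟩
          union := fun X Y Z hX hY hZ => mem_genSigma.2
            ⟨fun x hx => ((hZ x).1 hx).elim ((mem_genSigma.1 hX).1 x) ((mem_genSigma.1 hY).1 x),
            fun T hT hBT => hT.alg.union X Y Z ((mem_genSigma.1 hX).2 T hT hBT)
              ((mem_genSigma.1 hY).2 T hT hBT) hZ⟩ }
      seqUnion := fun A W hA hW => mem_genSigma.2 ⟨fun x hx => by
          obtain ⟨k, X, _, hX, hxX⟩ := (hW x).1 hx
          exact (mem_genSigma.1 (hA.2 k X hX)).1 x hxX,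
        fun T hT hBT => hT.seqUnion A W
          ⟨hA.1, fun x y hxy => (mem_genSigma.1 (hA.2 x y hxy)).2 T hT hBT⟩ hW⟩ }
  sub := fun X hX => mem_genSigma.2 ⟨hB X hX, fun _ _ hBT => hBT X hX⟩
  least := fun T hT hBT X hX => (mem_genSigma.1 hX).2 T hT hBT

variable (hm : R.IsFinAddSpace C B m)

include hm

/-- Membership in `caraV` demands only one inequality; subadditivity gives the other. -/
theorem outer_eq_cap_add_sdiffV {E T : V} (hE : E ∈ᵥ R.caraV C B m) (hT : SubV T C) :
    R.outer B m T = R.outer B m (cap T E) + R.outer B m (sdiffV T E) := by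
  refine le_antisymm ?_ ((mem_caraV.1 hE).2 T hT)
  refine le_trans (outer_mono hm.isExtFun fun x hx => ?_) (outer_cup_le hm _ _)
  simp only [mem_cup, mem_cap, mem_sdiffV]
  tauto

theorem outer_cup {E F : V} (hE : E ∈ᵥ R.caraV C B m) (hF : SubV F C) (h : DisjV E F) :
    R.outer B m (cup E F) = R.outer B m E + R.outer B m F := by
  rw [outer_eq_cap_add_sdiffV hm hE (T := cup E F)]
  · congr 2
    · refine set_ext fun x => ?_
      rw [mem_cap, mem_cup]
      tauto
    · refine set_ext fun x => ?_
      have := h x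
      rw [mem_sdiffV, mem_cup]
      tauto
  · intro x hx
    exact (mem_cup.1 hx).elim ((mem_caraV.1 hE).1 x) (hF x)

theorem mem_caraV_of_null {E : V} (hE : SubV E C) (h : R.outer B m E = 0) :
    E ∈ᵥ R.caraV C B m := by
  refine mem_caraV.2 ⟨hE, fun T _ => ?_⟩
  have h₁ : R.outer B m (cap T E) ≤ 0 := h ▸ outer_mono hm.isExtFun fun x hx => (mem_cap.1 hx).2
  have h₂ : R.outer B m (sdiffV T E) ≤ R.outer B m T :=
    outer_mono hm.isExtFun fun x hx => (mem_sdiffV.1 hx).1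
  simpa using add_le_add h₁ h₂

theorem isAlgebraOn_caraV : IsAlgebraOn C (R.caraV C B m) where
  sub := fun X hX => (mem_caraV.1 hX).1
  whole := by
    refine mem_caraV.2 ⟨fun _ h => h, fun T hT => ?_⟩
    have e₁ : cap T C = T := set_ext fun x => by
      have := hT x
      rw [mem_cap]
      tauto
    have e₂ : sdiffV T C = emp V := emptyV_iff.1 fun x hx => by
      have := hT x
      rw [mem_sdiffV] at hx
      tauto
    rw [e₁, e₂, outer_emp hm, add_zero]
  compl := by
    intro X Y hX hY
    rw [isDiffV_iff] at hY
    subst hY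
    refine mem_caraV.2 ⟨fun x hx => (mem_sdiffV.1 hx).1, fun T hT => ?_⟩
    have e₁ : cap T (sdiffV C X) = sdiffV T X := set_ext fun x => by
      have := hT x
      rw [mem_cap, mem_sdiffV, mem_sdiffV]
      tauto
    have e₂ : sdiffV T (sdiffV C X) = cap T X := set_ext fun x => by
      have := hT x
      rw [mem_cap, mem_sdiffV, mem_sdiffV]
      tauto
    rw [e₁, e₂, add_comm]
    exact (mem_caraV.1 hX).2 T hT
  union := by
    intro X Y Z hX hY hZ
    rw [isUnionV_iff] at hZ
    subst hZ
    refine mem_caraV.2 ⟨fun x hx => (mem_cup.1 hx).elim ((mem_caraV.1 hX).1 x)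
      ((mem_caraV.1 hY).1 x), fun T hT => ?_⟩
    have e₁ : cap T (cup X Y) = cup (cap T X) (cap (sdiffV T X) Y) := set_ext fun x => by
      simp only [mem_cap, mem_cup, mem_sdiffV]
      tauto
    have e₂ : sdiffV T (cup X Y) = sdiffV (sdiffV T X) Y := set_ext fun x => by
      simp only [mem_cup, mem_sdiffV]
      tauto
    rw [outer_eq_cap_add_sdiffV hm hX hT, outer_eq_cap_add_sdiffV hm hY (T := sdiffV T X)
      fun x hx => hT x (mem_sdiffV.1 hx).1, e₁, e₂, ← add_assoc]
    exact add_le_add_left (outer_cup_le hm _ _) _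

/-- A member of `B` splits every cover of `T` into covers of the two pieces of `T`, and the measure
is additive on this splitting. -/
theorem subV_caraV : SubV B (R.caraV C B m) := by
  intro F hF
  refine mem_caraV.2 ⟨hm.alg.sub F hF, fun T _ => le_outer hm.isExtFun fun A hA hTA => ?_⟩
  rw [← hm.ev_cap_add_diff hA hF]
  refine add_le_add (outer_le hm.isExtFun (hm.alg.cap_mem hA hF) fun x hx => ?_)
    (outer_le hm.isExtFun (hm.alg.sdiff_mem hA hF) fun x hx => ?_)
  · rw [mem_cap] at hx ⊢
    exact ⟨hTA x hx.1, hx.2⟩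
  · rw [mem_sdiffV] at hx ⊢
    exact ⟨hTA x hx.1, hx.2⟩

variable (hb : R.IncreasingBounded B m)

include hb

/-- Continuity from below for a definable family, which Replacement first collects into a sequence
of the universe. -/
theorem outer_le_of_increasing {F : El R.carrier → V} (hF : DF memLanguage (univ : Set V) F)
    {W : V} {t : R.Ext} (hmono : ∀ k : El R.carrier, k.1 ∈ᵥ R.nat → SubV (F k) (F (k + 1)))
    (ht : ∀ k : El R.carrier, k.1 ∈ᵥ R.nat → R.outer B m (F k) ≤ t)
    (hW : ∀ x, x ∈ᵥ W → ∃ k : El R.carrier, k.1 ∈ᵥ R.nat ∧ x ∈ᵥ F k) :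
    R.outer B m W ≤ t := by
  have happ : ∀ k : El R.carrier, k.1 ∈ᵥ R.nat →
      app (lam R.nat fun x => F (R.decR x)) k.1 = F k := fun k hk => by
    rw [app_lam (F := fun x => F (R.decR x)) (hF.comp (DF.decR DF.id)) hk, R.decR_val]
  refine outer_iUnion_le hm hb (E := lam R.nat fun x => F (R.decR x)) (fun k hk => ?_)
    (fun k hk => ?_) fun x hx => ?_
  · rw [happ k hk, happ _ (R.succ_mem_nat k hk)]
    exact hmono k hk
  · rw [happ k hk]
    exact ht k hk
  · obtain ⟨k, hk, h⟩ := hW x hx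
    exact ⟨k, hk, (happ k hk).symm ▸ h⟩

/-- The Carathéodory inequality holds for the finite partial unions. Since `T \ W` is contained in
the complement in `T` of each of them, it remains to pass to the limit in the other term, which is
continuity from below. No disjointification is needed. -/
theorem isSigmaAlgebraOn_caraV : R.IsSigmaAlgebraOn C (R.caraV C B m) where
  alg := isAlgebraOn_caraV hm
  seqUnion := by
    intro A W hA hW
    have hS := isAlgebraOn_caraV hm
    have hmem := mem_pUn_iff_of_union hS hA hW
    refine mem_caraV.2 ⟨fun x hx => ?_, fun T hT => ?_⟩
    · obtain ⟨k, _, hk⟩ := (hmem x).1 hx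
      exact (mem_pUn.1 hk).1
    by_cases htop : R.outer B m T = ⊤
    · rw [htop]
      exact le_top
    have hle : R.outer B m (sdiffV T W) ≤ R.outer B m T :=
      outer_mono hm.isExtFun fun x hx => (mem_sdiffV.1 hx).1
    have hbd : ∀ k : El R.carrier, k.1 ∈ᵥ R.nat →
        R.outer B m (cap T (R.pUn C A k)) + R.outer B m (sdiffV T W) ≤ R.outer B m T := by
      intro k hk
      refine le_trans (add_le_add_right (outer_mono hm.isExtFun fun x hx => ?_) _)
        ((mem_caraV.1 (pUn_mem hS hA k hk)).2 T hT)
      rw [mem_sdiffV] at hx ⊢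
      exact ⟨hx.1, fun h => hx.2 ((hmem x).2 ⟨k, hk, h⟩)⟩
    have hfin : R.outer B m (sdiffV T W) ≠ ⊤ := fun h => htop (top_le_iff.1 (h ▸ hle))
    generalize R.outer B m (sdiffV T W) = b at *
    generalize R.outer B m T = a at *
    lift a to El R.carrier using htop
    lift b to El R.carrier using hfin
    -- Both values are finite here, so the uniform bound on the partial unions can be written as the
    -- real number `a - b`.
    have key : R.outer B m (cap T W) ≤ ((a - b : El R.carrier) : R.Ext) := by
      refine outer_le_of_increasing hm hb (F := fun k => cap T (R.pUn C A k))
        (DF.cap (DF.const_univ _) (DF.pUn (DF.const_univ _) (DF.const_univ _) DF.id))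
        (fun k _ x hx => ?_) (fun k hk => ?_) fun x hx => ?_
      · rw [mem_cap] at hx ⊢
        exact ⟨hx.1, pUn_subV_succ x hx.2⟩
      · have := hbd k hk
        generalize R.outer B m (cap T (R.pUn C A k)) = c at *
        induction c using WithTop.recTopCoe with
        | top => simp at this
        | coe c =>
          rw [← WithTop.coe_add, WithTop.coe_le_coe] at this
          rw [WithTop.coe_le_coe]
          linarith
      · rw [mem_cap] at hx
        obtain ⟨k, hk, h⟩ := (hmem x).1 hx.2
        exact ⟨k, hk, mem_cap.2 ⟨hx.1, h⟩⟩
    refine (add_le_add_left key _).trans (le_of_eq ?_)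
    rw [← WithTop.coe_add, sub_add_cancel]

/-- By finite additivity on measurable sets, the partial sums of the series are the outer measures
of the partial unions. Continuity from below identifies their supremum. The same argument serves
`B`, the generated σ-algebra and the completion. -/
theorem countablyAdditive_of_subV_caraV {S f : V} (hS : IsAlgebraOn C S)
    (hSc : SubV S (R.caraV C B m)) (hf : R.IsExtFun f S)
    (hfo : ∀ E, E ∈ᵥ S → R.ev f E = R.outer B m E) : R.CountablyAdditive S f := by
  intro A W hA hd hWS hW
  refine ⟨R.outer B m W, (val_iff_ev hf hWS).2 (hfo W hWS).symm, ?_⟩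
  have hmem := mem_pUn_iff_of_union hS hA hW
  have hD : DF memLanguage (univ : Set V) fun x => R.outer B m (R.pUn C A (R.decR x)) :=
    DF.outer (DF.const_univ _) (DF.const_univ _) (DF.pUn (DF.const_univ _) (DF.const_univ _)
      (DF.decR DF.id))
  set s := lam R.nat fun x => R.code (R.outer B m (R.pUn C A (R.decR x))) with hs
  have hsE : R.IsExtFun s R.nat := isExtFun_lam hD fun _ _ => outer_nonneg hm.isExtFun _
  have hval : ∀ (k : El R.carrier) (t : R.Ext), k.1 ∈ᵥ R.nat →
      (R.Val s k.1 t ↔ t = R.outer B m (R.pUn C A k)) := by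
    intro k t hk
    rw [val_iff_ev hsE hk, hs, ev_lam hD hk, R.decR_val]
  refine ⟨s, hsE, ?_, ?_, ?_, ?_⟩
  · rw [hval 0 0 R.zero_mem_nat, pUn_zero, outer_emp hm]
  · intro k X x y hk hX hx hy
    rw [hA.1.mapsV hk] at hX
    subst hX
    have hXS := hA.app_mem hk
    rw [hval k y hk] at hy
    rw [val_iff_ev hf hXS, hfo _ hXS] at hx
    rw [hval _ _ (R.succ_mem_nat k hk), pUn_succ hk (hS.sub _ hXS),
      outer_cup hm (hSc _ (pUn_mem hS hA k hk)) (hS.sub _ hXS), hx, hy]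
    rintro z ⟨hz, hz'⟩
    obtain ⟨_, j, hj, hjk, hzj⟩ := mem_pUn.1 hz
    exact hd j.1 k.1 _ _ hj hk (fun h => hjk.ne (Subtype.ext h)) (hA.1.maps_app hj)
      (hA.1.maps_app hk) z ⟨hzj, hz'⟩
  · rintro y ⟨k, hk, hy⟩
    obtain ⟨k, rfl⟩ : ∃ l : El R.carrier, l.1 = k := ⟨⟨k, R.nat_sub k hk⟩, rfl⟩
    rw [hval k y hk] at hy
    rw [hy]
    exact outer_mono hm.isExtFun fun x hx => (hmem x).2 ⟨k, hk, hx⟩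
  · intro b hbd
    exact outer_le_of_increasing hm hb
      (DF.pUn (DF.const_univ _) (DF.const_univ _) DF.id) (fun _ _ => pUn_subV_succ)
      (fun k hk => hbd ⟨k.1, hk, (hval k _ hk).2 rfl⟩) fun x hx => (hmem x).1 hx

theorem IsFinAddSpace.countablyAdditive : R.CountablyAdditive B m :=
  countablyAdditive_of_subV_caraV hm hb hm.alg (subV_caraV hm) hm.isExtFun
    fun _ hE => (outer_eq hm hE).symm

omit hm hb in
theorem ev_outerFun {S E : V} (hE : E ∈ᵥ S) : R.ev (R.outerFun S B m) E = R.outer B m E :=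
  ev_lam (DF.outer (DF.const_univ _) (DF.const_univ _) DF.id) hE

omit hb in
theorem isExtFun_outerFun {S : V} : R.IsExtFun (R.outerFun S B m) S :=
  isExtFun_lam (DF.outer (DF.const_univ _) (DF.const_univ _) DF.id)
    fun _ _ => outer_nonneg hm.isExtFun _

omit hb in
theorem val_outerFun {S E : V} {t : R.Ext} :
    R.Val (R.outerFun S B m) E t ↔ E ∈ᵥ S ∧ t = R.outer B m E := by
  refine ⟨fun h => ?_, fun h => ?_⟩
  · have hE := (isExtFun_outerFun hm).1.mem_dom h
    exact ⟨hE, by rwa [val_iff_ev (isExtFun_outerFun hm) hE, ev_outerFun hE] at h⟩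
  · rw [val_iff_ev (isExtFun_outerFun hm) h.1, ev_outerFun h.1]
    exact h.2

theorem isMeasureSpaceOn_outerFun {S : V} (hS : R.IsSigmaAlgebraOn C S)
    (hSc : SubV S (R.caraV C B m)) : R.IsMeasureSpaceOn C S (R.outerFun S B m) where
  sigma := hS
  isExtFun := isExtFun_outerFun hm
  empty := by
    intro E hE
    rw [emptyV_iff] at hE
    subst hE
    exact (val_outerFun hm).2 ⟨hS.alg.emp_mem, (outer_emp hm).symm⟩
  sigmaAdditive := countablyAdditive_of_subV_caraV hm hb hS.alg hSc (isExtFun_outerFun hm)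
    fun _ hE => ev_outerFun hE

omit hb in
theorem squeezed_iff {S X Y Z : V} (hS : IsAlgebraOn C S) :
    R.Squeezed S (R.outerFun S B m) X Y Z ↔
      X ∈ᵥ S ∧ Z ∈ᵥ S ∧ SubV X Y ∧ SubV Y Z ∧ R.outer B m (sdiffV Z X) = 0 := by
  unfold Squeezed
  refine and_congr_right fun hX => and_congr_right fun hZ => and_congr_right fun _ =>
    and_congr_right fun _ => ⟨?_, fun h => ⟨_, isDiffV_iff.2 rfl, ?_⟩⟩
  · rintro ⟨D, hD, hD0⟩
    rw [isDiffV_iff] at hD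
    subst hD
    exact ((val_outerFun hm).1 hD0).2.symm
  · exact (val_outerFun hm).2 ⟨hS.sdiff_mem hZ hX, h.symm⟩

omit hb in
theorem outer_eq_zero_of_subV {E F : V} (h : SubV E F) (hF : R.outer B m F = 0) :
    R.outer B m E = 0 :=
  le_antisymm (hF ▸ outer_mono hm.isExtFun h) (outer_nonneg hm.isExtFun E)

omit hb in
theorem outer_cup_eq_zero {E F : V} (hE : R.outer B m E = 0) (hF : R.outer B m F = 0) :
    R.outer B m (cup E F) = 0 := by
  refine le_antisymm ((outer_cup_le hm E F).trans ?_) (outer_nonneg hm.isExtFun _)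
  rw [hE, hF, add_zero]

omit hb in
theorem outer_eq_of_squeezed {X Y Z : V} (hXY : SubV X Y) (hYZ : SubV Y Z)
    (h : R.outer B m (sdiffV Z X) = 0) : R.outer B m Y = R.outer B m X := by
  refine le_antisymm ?_ (outer_mono hm.isExtFun hXY)
  have h₁ : R.outer B m Y ≤ R.outer B m (cup X (sdiffV Z X)) :=
    outer_mono hm.isExtFun fun x hx => by
      have := hYZ x hx
      rw [mem_cup, mem_sdiffV]
      tauto
  refine h₁.trans ((outer_cup_le hm _ _).trans ?_)
  rw [h, add_zero]

-- A squeezed set `Y` is the union of the measurable set `X` and of `Y \ X`, which is null because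
-- it lies in `Z \ X`.
omit hb in
theorem completionV_subV_caraV {S : V} (hS : IsAlgebraOn C S) (hSc : SubV S (R.caraV C B m)) :
    SubV (R.completionV C S (R.outerFun S B m)) (R.caraV C B m) := by
  intro Y hY
  obtain ⟨hYC, X, Z, h⟩ := mem_completionV.1 hY
  obtain ⟨hX, hZ, hXY, hYZ, h0⟩ := (squeezed_iff hm hS).1 h
  have e : Y = cup X (sdiffV Y X) := set_ext fun x => by
    have := hXY x
    rw [mem_cup, mem_sdiffV]
    tauto
  rw [e]
  refine (isAlgebraOn_caraV hm).cup_mem (hSc X hX) (mem_caraV_of_null hm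
    (fun x hx => hYC x (mem_sdiffV.1 hx).1) (outer_eq_zero_of_subV hm (fun x hx => ?_) h0))
  rw [mem_sdiffV] at hx ⊢
  exact ⟨hYZ x hx.1, hx.2⟩

/-- Inner and outer approximations can be combined operation by operation. The new gap lies in the
union of the old gaps, which is null by subadditivity and, for sequences, by continuity from below.
-/
theorem isSigmaAlgebraOn_completionV {S : V} (hS : R.IsSigmaAlgebraOn C S) :
    R.IsSigmaAlgebraOn C (R.completionV C S (R.outerFun S B m)) where
  alg :=
    { sub := fun X hX => (mem_completionV.1 hX).1
      whole := by
        refine mem_completionV.2 ⟨fun _ h => h, C, C, (squeezed_iff hm hS.alg).2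
          ⟨hS.alg.whole, hS.alg.whole, fun _ h => h, fun _ h => h, ?_⟩⟩
        rw [emptyV_iff.1 (fun x hx => (mem_sdiffV.1 hx).2 (mem_sdiffV.1 hx).1), outer_emp hm]
      compl := by
        intro Y Y' hY hY'
        rw [isDiffV_iff] at hY'
        subst hY'
        obtain ⟨hYC, X, Z, h⟩ := mem_completionV.1 hY
        obtain ⟨hX, hZ, hXY, hYZ, h0⟩ := (squeezed_iff hm hS.alg).1 h
        refine mem_completionV.2 ⟨fun x hx => (mem_sdiffV.1 hx).1, sdiffV C Z, sdiffV C X,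
          (squeezed_iff hm hS.alg).2 ⟨hS.alg.diff_mem hZ, hS.alg.diff_mem hX,
          fun x hx => ?_, fun x hx => ?_, outer_eq_zero_of_subV hm (fun x hx => ?_) h0⟩⟩
        · have := hYZ x
          rw [mem_sdiffV] at hx ⊢
          tauto
        · have := hXY x
          rw [mem_sdiffV] at hx ⊢
          tauto
        · simp only [mem_sdiffV] at hx ⊢
          tauto
      union := by
        intro Y Y' W hY hY' hW
        rw [isUnionV_iff] at hW
        subst hW
        obtain ⟨hYC, X, Z, h⟩ := mem_completionV.1 hY
        obtain ⟨hX, hZ, hXY, hYZ, h0⟩ := (squeezed_iff hm hS.alg).1 h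
        obtain ⟨hYC', X', Z', h'⟩ := mem_completionV.1 hY'
        obtain ⟨hX', hZ', hXY', hYZ', h0'⟩ := (squeezed_iff hm hS.alg).1 h'
        refine mem_completionV.2 ⟨fun x hx => (mem_cup.1 hx).elim (hYC x) (hYC' x), cup X X',
          cup Z Z', (squeezed_iff hm hS.alg).2 ⟨hS.alg.cup_mem hX hX', hS.alg.cup_mem hZ hZ',
          fun x hx => ?_, fun x hx => ?_,
          outer_eq_zero_of_subV hm (fun x hx => ?_) (outer_cup_eq_zero hm h0 h0')⟩⟩
        · rw [mem_cup] at hx ⊢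
          exact hx.imp (hXY x) (hXY' x)
        · rw [mem_cup] at hx ⊢
          exact hx.imp (hYZ x) (hYZ' x)
        · simp only [mem_sdiffV, mem_cup] at hx ⊢
          tauto }
  seqUnion := by
    intro A W hA hW
    have hsq : ∀ k, k ∈ᵥ R.nat → ∃ X Z, R.Squeezed S (R.outerFun S B m) X (app A k) Z :=
      fun k hk => (mem_completionV.1 (hA.app_mem hk)).2
    have hAC : ∀ k, k ∈ᵥ R.nat → SubV (app A k) C :=
      fun k hk => (mem_completionV.1 (hA.app_mem hk)).1
    have hDapp : DF memLanguage (univ : Set V) fun p : (V × V) × V => app A p.1.1 :=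
      DF.app (DF.const_univ _) DF.id.fst.fst
    obtain ⟨F, hF, hF'⟩ := exists_choice_fun (a := R.nat) (b := S)
      (P := fun k X => ∃ Z, R.Squeezed S (R.outerFun S B m) X (app A k) Z)
      (D.ex (D.squeezed (DF.const_univ _) (DF.const_univ _) DF.id.fst.snd hDapp DF.id.snd))
      fun k hk => by
        obtain ⟨X, Z, h⟩ := hsq k hk
        exact ⟨X, h.1, Z, h⟩
    -- The outer sets are chosen after the inner ones, so that the two sequences squeeze `A_k`
    -- jointly.
    obtain ⟨G, hG, hG'⟩ := exists_choice_fun (a := R.nat) (b := S)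
      (P := fun k Z => R.Squeezed S (R.outerFun S B m) (app F k) (app A k) Z)
      (D.squeezed (DF.const_univ _) (DF.const_univ _) (DF.app (DF.const_univ _) DF.id.fst)
        (DF.app (DF.const_univ _) DF.id.fst) DF.id.snd)
      fun k hk => by
        obtain ⟨Z, h⟩ := hF' k hk
        exact ⟨Z, h.2.1, h⟩
    have hsq' : ∀ k, k ∈ᵥ R.nat → _ := fun k hk => (squeezed_iff hm hS.alg).1 (hG' k hk)
    have hun : ∀ A : V, D memLanguage (univ : Set V)
        fun x => ∃ k, k ∈ᵥ R.nat ∧ x ∈ᵥ app A k := fun A => D.auto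
    have hunion : ∀ F : V, R.IsSeq F S →
        R.IsUnionSeq (sepV C fun x => ∃ k, k ∈ᵥ R.nat ∧ x ∈ᵥ app F k) F := by
      intro F hF x
      rw [mem_sepV (hun F)]
      constructor
      · rintro ⟨_, k, hk, hx⟩
        exact ⟨k, _, hk, hF.1.maps_app hk, hx⟩
      · rintro ⟨k, X, hk, hX, hx⟩
        rw [hF.1.mapsV hk] at hX
        subst hX
        exact ⟨hS.alg.sub _ (hF.app_mem hk) x hx, k, hk, hx⟩
    refine mem_completionV.2 ⟨fun x hx => ?_, _, _, (squeezed_iff hm hS.alg).2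
      ⟨hS.seqUnion F _ hF (hunion F hF), hS.seqUnion G _ hG (hunion G hG),
      fun x hx => ?_, fun x hx => ?_, ?_⟩⟩
    · obtain ⟨k, X, hk, hX, hx⟩ := (hW x).1 hx
      rw [hA.1.mapsV hk] at hX
      subst hX
      exact hAC k hk x hx
    · obtain ⟨_, k, hk, hx⟩ := (mem_sepV (hun F)).1 hx
      exact (hW x).2 ⟨k, _, hk, hA.1.maps_app hk, (hsq' k hk).2.2.1 x hx⟩
    · obtain ⟨k, X, hk, hX, hx⟩ := (hW x).1 hx
      rw [hA.1.mapsV hk] at hX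
      subst hX
      exact (mem_sepV (hun G)).2 ⟨hAC k hk x hx, k, hk, (hsq' k hk).2.2.2.1 x hx⟩
    -- The gap between the unions lies in the union of the gaps `G_k \ F_k`, whose finite partial
    -- unions are null by induction.
    · have hN : DF memLanguage (univ : Set V) fun x => sdiffV (app G x) (app F x) :=
        DF.sdiffV (DF.app (DF.const_univ _) DF.id) (DF.app (DF.const_univ _) DF.id)
      set N := lam R.nat fun x => sdiffV (app G x) (app F x) with hNdef
      have happ : ∀ k, k ∈ᵥ R.nat → app N k = sdiffV (app G k) (app F k) :=
        fun k hk => app_lam hN hk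
      have hGC : ∀ k, k ∈ᵥ R.nat → SubV (app G k) C := fun k hk => hS.alg.sub _ (hG.app_mem hk)
      have hNC : ∀ k, k ∈ᵥ R.nat → SubV (app N k) C := fun k hk x hx => by
        rw [happ k hk, mem_sdiffV] at hx
        exact hGC k hk x hx.1
      have hnull : ∀ k : El R.carrier, k.1 ∈ᵥ R.nat → R.outer B m (R.pUn C N k) = 0 := by
        refine nat_induction ?_ ?_ ?_
        · exact D.eq (DF.outer (DF.const_univ _) (DF.const_univ _)
            (DF.pUn (DF.const_univ _) (DF.const_univ _) DF.id)) (DF.const_univ _)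
        · rw [pUn_zero, outer_emp hm]
        · intro k hk ih
          rw [pUn_succ hk (hNC _ hk), happ _ hk]
          exact outer_cup_eq_zero hm ih (hsq' _ hk).2.2.2.2
      refine le_antisymm ?_ (outer_nonneg hm.isExtFun _)
      refine outer_le_of_increasing hm hb (F := fun k => R.pUn C N k)
        (DF.pUn (DF.const_univ _) (DF.const_univ _) DF.id) (fun _ _ => pUn_subV_succ)
        (fun k hk => (hnull k hk).le) fun x hx => ?_
      rw [mem_sdiffV, mem_sepV (hun G), mem_sepV (hun F)] at hx
      obtain ⟨⟨hxC, k, hk, hxk⟩, hxF⟩ := hx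
      obtain ⟨k, rfl⟩ : ∃ l : El R.carrier, l.1 = k := ⟨⟨k, R.nat_sub k hk⟩, rfl⟩
      refine ⟨k + 1, R.succ_mem_nat k hk, mem_pUn.2 ⟨hxC, k, hk, lt_add_one k, ?_⟩⟩
      rw [happ _ hk, mem_sdiffV]
      exact ⟨hxk, fun h => hxF ⟨hxC, k.1, hk, h⟩⟩

-- The completed measure is again the outer measure, now on more sets; it cannot distinguish `Y`
-- from `X` when `Z \ X` is null.
omit hb in
theorem isCompletionOf_completionV {S : V} (hS : IsAlgebraOn C S) :
    R.IsCompletionOf (R.completionV C S (R.outerFun S B m))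
      (R.outerFun (R.completionV C S (R.outerFun S B m)) B m) S (R.outerFun S B m) where
  mem_iff := by
    intro Y
    rw [mem_completionV]
    refine ⟨fun h => h.2, fun h => ⟨?_, h⟩⟩
    obtain ⟨X, Z, h⟩ := h
    exact fun x hx => hS.sub Z h.2.1 x (h.2.2.2.1 x hx)
  isExtFun := isExtFun_outerFun hm
  val := by
    intro X Y Z t h ht
    have h' := (squeezed_iff hm hS).1 h
    refine (val_outerFun hm).2 ⟨mem_completionV.2 ⟨fun x hx => hS.sub Z h.2.1 x
      (h.2.2.2.1 x hx), X, Z, h⟩, ?_⟩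
    rw [((val_outerFun hm).1 ht).2, outer_eq_of_squeezed hm h'.2.2.1 h'.2.2.2.1 h'.2.2.2.2]

-- If `Y` is null and squeezed between `X` and `Z`, then `Z` is covered by the null sets `X` and `Z
-- \ X`. Every subset of `Y` is thus squeezed between the empty set and `Z`.
omit hb in
theorem isCompleteMeasure_completionV {S : V} (hS : IsAlgebraOn C S) :
    R.IsCompleteMeasure (R.completionV C S (R.outerFun S B m))
      (R.outerFun (R.completionV C S (R.outerFun S B m)) B m) := by
  intro Y Y' hY hY0 hsub
  obtain ⟨hYC, X, Z, h⟩ := mem_completionV.1 hY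
  have h' := (squeezed_iff hm hS).1 h
  have h0 := ((val_outerFun hm).1 hY0).2.symm
  have hX0 := outer_eq_zero_of_subV hm h'.2.2.1 h0
  refine mem_completionV.2 ⟨fun x hx => hYC x (hsub x hx), emp V, Z, (squeezed_iff hm hS).2
    ⟨hS.emp_mem, h.2.1, fun x hx => absurd hx (notMem_emp x),
    fun x hx => h'.2.2.2.1 x (hsub x hx), ?_⟩⟩
  refine outer_eq_zero_of_subV hm (fun x hx => ?_) (outer_cup_eq_zero hm hX0 h'.2.2.2.2)
  rw [mem_sdiffV] at hx
  rw [mem_cup, mem_sdiffV]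
  tauto

end RealNumbers

/-! ### Definability of the extension -/

variable {R : RealNumbers V}
variable {L : FirstOrder.Language.{0, 0}} [L.Structure V] [MemLang L V] {A : Set V} [StdSub A]
variable {σ : Type*} [Coded V σ] {a b c : σ → V}

/-- Together with the two statements that follow, this makes the constructed σ-algebras and measures
standard: they are definable from standard parameters. -/
theorem DF.genSigma (ha : DF L A a) (hb : DF L A b) :
    DF L A fun x => R.genSigma (a x) (b x) := by
  refine DF.comp₂ (F := R.genSigma) (DF.sepV DF.id.fst.powV (D.all (D.imp
    (D.isSigmaAlgebraOn DF.id.fst.fst.fst DF.id.snd) D.auto))) ha hb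

theorem DF.outerFun (ha : DF L A a) (hb : DF L A b) (hc : DF L A c) :
    DF L A fun x => R.outerFun (a x) (b x) (c x) := by
  refine DF.comp (g := fun p : V × V × V => R.outerFun p.1 p.2.1 p.2.2) ?_ (ha.pair (hb.pair hc))
  exact DF.lam DF.id.fst (DF.outer DF.id.fst.snd.fst DF.id.fst.snd.snd DF.id.snd).code

theorem DF.completionV (ha : DF L A a) (hb : DF L A b) (hc : DF L A c) :
    DF L A fun x => R.completionV (a x) (b x) (c x) := by
  refine DF.comp (g := fun p : V × V × V => R.completionV p.1 p.2.1 p.2.2) ?_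
    (ha.pair (hb.pair hc))
  exact DF.sepV DF.id.fst.powV (D.ex (D.ex (D.squeezed DF.id.fst.fst.fst.snd.fst
    DF.id.fst.fst.fst.snd.snd DF.id.fst.snd DF.id.fst.fst.snd DF.id.snd)))

end Extension

/-! ## Transfer, standardization and shadows -/

section Nonstandard

variable {V : Type u} [StUniverse V] [hZ : Fact (IsZFC V)] (hV : IsBST V)
variable {σ : Type*} [Coded V σ]

/-- In the defining formula the parameter `w` is relabelled as a fresh variable, while parameters in
`A` are kept as they are. This allows quantification over the index that `w` instantiates. -/
theorem D.exists_param {L : FirstOrder.Language.{0, 0}} [L.Structure V] {A : Set V} {w : V}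
    {P : σ → Prop} (hP : D L (insert w A) P) :
    ∃ Q : V × σ → Prop, D L A Q ∧ ∀ x, P x ↔ Q (w, x) := by
  classical
  obtain ⟨S, hS, h⟩ := hP
  obtain ⟨φ, rfl⟩ := Set.definable_iff_exists_formula_sum.1 hS
  let r : (insert w A : Set V) ⊕ Coded.ι V σ → A ⊕ (Unit ⊕ Coded.ι V σ) :=
    Sum.elim (fun a => if ha : a.1 ∈ A then Sum.inl ⟨a.1, ha⟩ else Sum.inr (Sum.inl ()))
      fun i => Sum.inr (Sum.inr i)
  refine ⟨fun p => Coded.enc (V := V) p ∈ {v : Unit ⊕ Coded.ι V σ → V | (φ.relabel r).Realize (Sum.elim (fun a : A => a.1) v)},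
    ⟨_, Set.definable_iff_exists_formula_sum.2 ⟨φ.relabel r, rfl⟩, fun _ => Iff.rfl⟩,
    fun x => ?_⟩
  rw [h]
  refine Iff.trans ?_ FirstOrder.Language.Formula.realize_relabel.symm
  have e : (Sum.elim (fun a : A => a.1) (Coded.enc (V := V) (w, x))) ∘ r =
      Sum.elim (fun a : (insert w A : Set V) => a.1) (Coded.enc x) := by
    funext i
    cases i with
    | inl a =>
      by_cases ha : a.1 ∈ A
      · simp [r, ha]
      · have : a.1 = w := a.2.resolve_right ha
        simp only [r, Function.comp, Sum.elim_inl, dif_neg ha]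
        exact this.symm
    | inr i => rfl
  rw [e]
  rfl

include hV

theorem transfer {P : V → Prop} (hP : D memLanguage (StdSet V) P) (h : ∀ x, IsStd x → P x) :
    ∀ x, P x := hV.transfer _ hP.definable₁ h

theorem exists_std {P : V → Prop} (hP : D memLanguage (StdSet V) P) (h : ∃ x, P x) :
    ∃ x, IsStd x ∧ P x := by
  by_contra! h'
  obtain ⟨x, hx⟩ := h
  exact transfer hV hP.not h' x hx

/-- Transfer provides a standard solution of the formula defining `c`, and `c` is its only solution.
-/
theorem isStd_of_eq {c : V} (h : D memLanguage (StdSet V) fun x => x = c) : IsStd c := by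
  obtain ⟨x, hx, rfl⟩ := exists_std hV h ⟨c, rfl⟩
  exact hx

theorem isStd_of_DF {c : V} (h : DF memLanguage (StdSet V) fun _ : V => c) : IsStd c :=
  isStd_of_eq hV (D.eq DF.id h)

theorem std_subV {a b : V} (ha : IsStd a) (hb : IsStd b)
    (h : ∀ x, IsStd x → x ∈ᵥ a → x ∈ᵥ b) : SubV a b :=
  transfer hV (P := fun x => x ∈ᵥ a → x ∈ᵥ b) D.auto h

theorem std_ext {a b : V} (ha : IsStd a) (hb : IsStd b)
    (h : ∀ x, IsStd x → (x ∈ᵥ a ↔ x ∈ᵥ b)) : a = b :=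
  set_ext fun x => ⟨std_subV hV ha hb (fun x hx => (h x hx).1) x,
    std_subV hV hb ha (fun x hx => (h x hx).2) x⟩

theorem standardize {P : V → Prop} (hP : D stMemLanguage (univ : Set V) P) (a : V) :
    ∃ s, IsStd s ∧ ∀ x, IsStd x → (x ∈ᵥ s ↔ x ∈ᵥ a ∧ P x) :=
  hV.standardization _ hP.definable₁ a

theorem isStd_app {f x : V} (hf : IsStd f) (hx : IsStd x) : IsStd (app f x) :=
  isStd_of_eq hV D.auto

/-- Standardization of a relation to a standard function. -/
theorem exists_std_fun {P : V → V → Prop}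
    (hP : D stMemLanguage (univ : Set V) fun p : V × V => P p.1 p.2) {a b : V} (ha : IsStd a)
    (hb : IsStd b) (h : ∀ x, IsStd x → x ∈ᵥ a → ∃ y, IsStd y ∧ y ∈ᵥ b ∧ P x y) :
    ∃ f, IsStd f ∧ IsFun f a b ∧ ∀ x, IsStd x → x ∈ᵥ a → P x (app f x) := by
  -- `E` may be multivalued, and its nonstandard pairs need not satisfy `P`. By Transfer it is
  -- nevertheless total on `a`.
  obtain ⟨E, hE, hE'⟩ := standardize hV (P := fun p => ∃ x y, p = opair x y ∧ P x y)
    (D.ex (D.ex (D.and D.auto (D.comp₂ (P := P) hP DF.id.fst.snd DF.id.snd)))) (prodV a b)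
  have h₁ : ∀ x, x ∈ᵥ a → ∃ y, y ∈ᵥ b ∧ opair x y ∈ᵥ E := by
    refine transfer hV (P := fun x => x ∈ᵥ a → ∃ y, y ∈ᵥ b ∧ opair x y ∈ᵥ E) D.auto
      fun x hx hxa => ?_
    obtain ⟨y, hy, hyb, hxy⟩ := h x hx hxa
    exact ⟨y, hyb, (hE' _ (isStd_of_eq hV D.auto)).2
      ⟨opair_mem_prodV.2 ⟨hxa, hyb⟩, x, y, rfl, hxy⟩⟩
  -- Choice and Transfer give a standard function that uniformizes `E`. Its values at standard
  -- points are standard, so there the external description of `E` applies and returns `P`.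
  obtain ⟨f, hf, hfun, hfE⟩ := exists_std hV
    (P := fun f => IsFun f a b ∧ ∀ x, x ∈ᵥ a → opair x (app f x) ∈ᵥ E) D.auto
    (exists_choice_fun (P := fun x y => opair x y ∈ᵥ E) D.auto h₁)
  refine ⟨f, hf, hfun, fun x hx hxa => ?_⟩
  have hstd := isStd_app hV hf hx
  obtain ⟨_, x', y', e, hxy⟩ := (hE' _ (isStd_of_eq hV D.auto)).1 (hfE x hxa)
  rw [opair_inj] at e
  obtain ⟨rfl, rfl⟩ := e
  exact hxy

/-- Transfer for the `w`-standard sets. -/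
theorem exists_app_of_exists {I w Y : V} (hI : IsStd I) (hw : w ∈ᵥ I) (hY : IsStd Y)
    {P : V → Prop} (hP : D memLanguage (insert w (StdSet V)) P) (h : ∃ x, x ∈ᵥ Y ∧ P x) :
    ∃ f, IsStd f ∧ IsFun f I Y ∧ P (app f w) := by
  obtain ⟨Q, hQ, hPQ⟩ := hP.exists_param
  have hQ' : ∀ {A : Set V} [StdSub A] {σ : Type u} [Coded V σ] {a b : σ → V},
      (StdSet V) ⊆ A → DF memLanguage A a → DF memLanguage A b → D memLanguage A fun x => Q (a x, b x) :=
    fun hA ha hb => (hQ.mono hA).comp (ha.pair hb)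
  obtain ⟨x, hxY, hx⟩ := h
  -- A Skolem function is sought on the whole of `I`, with arbitrary values where no witness exists.
  -- The condition on it no longer mentions `w`, so Transfer makes it standard, and evaluation at
  -- `w` gives the witness.
  have h₁ : ∀ i, i ∈ᵥ I → ∃ y, y ∈ᵥ Y ∧ ((∃ z, z ∈ᵥ Y ∧ Q (i, z)) → Q (i, y)) := by
    intro i _
    by_cases hi : ∃ z, z ∈ᵥ Y ∧ Q (i, z)
    · exact ⟨_, hi.choose_spec.1, fun _ => hi.choose_spec.2⟩
    · exact ⟨x, hxY, fun h => absurd h hi⟩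
  have h₂ := exists_choice_fun (P := fun i y => (∃ z, z ∈ᵥ Y ∧ Q (i, z)) → Q (i, y))
    (D.imp (D.ex (D.and D.auto (hQ' (subset_univ _) DF.id.fst.fst DF.id.snd)))
      (hQ' (subset_univ _) DF.id.fst DF.id.snd)) h₁
  obtain ⟨f, hf, hfun, hfQ⟩ := exists_std hV (P := fun f => IsFun f I Y ∧
    ∀ i, i ∈ᵥ I → (∃ z, z ∈ᵥ Y ∧ Q (i, z)) → Q (i, app f i))
    (D.and D.auto (D.all (D.imp D.auto (D.imp
    (D.ex (D.and D.auto (hQ' subset_rfl DF.id.fst.snd DF.id.snd)))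
    (hQ' subset_rfl DF.id.snd (DF.app DF.id.fst DF.id.snd)))))) h₂
  exact ⟨f, hf, hfun, (hPQ _).2 (hfQ w hw ⟨x, hxY, (hPQ x).1 hx⟩)⟩

/-- Boundedness places the given witness in a standard set, which can serve as codomain of the
Skolem function. -/
theorem exists_stdRel {I w : V} (hI : IsStd I) (hw : w ∈ᵥ I) {P : V → Prop}
    (hP : D memLanguage (insert w (StdSet V)) P) (h : ∃ x, P x) : ∃ x, StdRel I w x ∧ P x := by
  obtain ⟨x, hx⟩ := h
  obtain ⟨Y, hY, hxY⟩ := hV.boundedness x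
  obtain ⟨f, hf, hfun, hP⟩ := exists_app_of_exists hV hI hw hY hP ⟨x, hxY, hx⟩
  exact ⟨_, ⟨f, hf, hfun.1, hfun.1.maps_app hw⟩, hP⟩

theorem stdRel_of_eq {I w c : V} (hI : IsStd I) (hw : w ∈ᵥ I)
    (h : D memLanguage (insert w (StdSet V)) fun x => x = c) : StdRel I w c := by
  obtain ⟨x, hx, rfl⟩ := exists_stdRel hV hI hw h ⟨c, rfl⟩
  exact hx

/-! ### Standard real numbers and shadows -/

namespace RealNumbers

variable {R : RealNumbers V}

theorem isStd_decR {x : V} (hx : IsStd x) : IsStd (R.decR x).1 := isStd_of_eq hV D.auto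

theorem transferR {P : El R.carrier → Prop} (hP : D memLanguage (StdSet V) P)
    (h : ∀ r : El R.carrier, IsStd r.1 → P r) : ∀ r, P r := fun r => by
  have := transfer hV (P := fun x => P (R.decR x)) (hP.comp (DF.decR DF.id))
    (fun x hx => h _ (isStd_decR hV hx)) r.1
  rwa [R.decR_val] at this

theorem exists_stdR {P : El R.carrier → Prop} (hP : D memLanguage (StdSet V) P) (h : ∃ r, P r) :
    ∃ r : El R.carrier, IsStd r.1 ∧ P r := by
  by_contra! h'
  obtain ⟨r, hr⟩ := h
  exact transferR hV hP.not h' r hr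

theorem isStd_zero : IsStd (0 : El R.carrier).1 := isStd_of_eq hV D.auto

theorem isStd_one : IsStd (1 : El R.carrier).1 := isStd_of_eq hV D.auto

theorem isStd_add {r s : El R.carrier} (hr : IsStd r.1) (hs : IsStd s.1) : IsStd (r + s).1 :=
  isStd_of_eq hV D.auto

theorem isStd_sub {r s : El R.carrier} (hr : IsStd r.1) (hs : IsStd s.1) : IsStd (r - s).1 :=
  isStd_of_eq hV D.auto

theorem isStd_div {r s : El R.carrier} (hr : IsStd r.1) (hs : IsStd s.1) : IsStd (r / s).1 :=
  isStd_of_eq hV D.auto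

theorem exists_std_between {r s : El R.carrier} (hr : IsStd r.1) (hs : IsStd s.1) (h : r < s) :
    ∃ c : El R.carrier, IsStd c.1 ∧ r < c ∧ c < s :=
  exists_stdR hV (P := fun c => r < c ∧ c < s) D.auto (exists_between h)

theorem exists_std_nat_gt {r : El R.carrier} (hr : IsStd r.1) :
    ∃ n : El R.carrier, IsStd n.1 ∧ n.1 ∈ᵥ R.nat ∧ r < n :=
  exists_stdR hV (P := fun n => n.1 ∈ᵥ R.nat ∧ r < n) D.auto (exists_nat_gt r)

/-- The predicate may be external. The standard set with the same standard elements is inductive at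
standard points, hence inductive by Transfer, and so contains `ℕ`. -/
theorem std_nat_induction {P : El R.carrier → Prop} (hP : D stMemLanguage (univ : Set V) P)
    (h0 : P 0) (hs : ∀ k : El R.carrier, k.1 ∈ᵥ R.nat → IsStd k.1 → P k → P (k + 1)) :
    ∀ k : El R.carrier, k.1 ∈ᵥ R.nat → IsStd k.1 → P k := by
  obtain ⟨s, hs', hsP⟩ := standardize hV (hP.comp (DF.decR DF.id)) R.nat
  have hmem : ∀ k : El R.carrier, IsStd k.1 → (k.1 ∈ᵥ s ↔ k.1 ∈ᵥ R.nat ∧ P k) := by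
    intro k hk
    rw [hsP _ hk, R.decR_val]
  have := R.nat_least s ((hmem 0 (isStd_zero hV)).2 ⟨R.zero_mem_nat, h0⟩) (by
    refine transferR hV D.auto fun k hk hks => ?_
    obtain ⟨h₁, h₂⟩ := (hmem k hk).1 hks
    exact (hmem _ (isStd_add hV hk (isStd_one hV))).2 ⟨R.succ_mem_nat k h₁, hs k h₁ hk h₂⟩)
  exact fun k hk hks => ((hmem k hks).1 (this k.1 hk)).2

/-- External induction on the bound: below a standard natural number only finitely many successor
steps, each preserving standardness, can occur. -/
theorem isStd_of_le {k n : El R.carrier} (hn : n.1 ∈ᵥ R.nat) (hns : IsStd n.1)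
    (hk : k.1 ∈ᵥ R.nat) (h : k ≤ n) : IsStd k.1 := by
  refine std_nat_induction hV (P := fun n => ∀ k : El R.carrier, k.1 ∈ᵥ R.nat → k ≤ n →
    IsStd k.1) D.auto (fun k hk h => ?_) (fun n hn hns ih k hk h => ?_) n hn hns k hk h
  · rw [le_antisymm h (nat_nonneg hk)]
    exact isStd_zero hV
  · rcases (nat_le_succ hk hn).1 h with h | rfl
    exacts [ih k hk h, isStd_add hV hns (isStd_one hV)]

/-- An order-theoretic description of shadows. -/
theorem isShadow_iff {t u : R.Ext} : R.IsShadow t u ↔ IsStd (R.code u) ∧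
    (∀ c : El R.carrier, IsStd c.1 → (c : R.Ext) < u → (c : R.Ext) ≤ t) ∧
    ∀ c : El R.carrier, IsStd c.1 → u < c → t ≤ c := by
  constructor
  · rintro (⟨r, s, rfl, rfl, hs, h⟩ | ⟨rfl, h⟩)
    · have key : ∀ δ : El R.carrier, IsStd δ.1 → 0 < δ → |r - s| < δ := by
        intro δ hδ hδ0
        obtain ⟨n, hn, hn', h'⟩ := exists_std_nat_gt hV (isStd_div hV (isStd_one hV) hδ)
        have hn0 : 0 < n := lt_trans (by positivity) h'
        refine (h n hn' hn hn0.ne').trans ?_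
        rw [div_lt_iff₀ hn0]
        rw [div_lt_iff₀ hδ0] at h'
        linarith
      refine ⟨hs, fun c hc hcs => ?_, fun c hc hcs => ?_⟩
      · rw [WithTop.coe_lt_coe] at hcs
        have := abs_lt.1 (key _ (isStd_sub hV hs hc) (sub_pos.2 hcs))
        rw [WithTop.coe_le_coe]
        linarith
      · rw [WithTop.coe_lt_coe] at hcs
        have := abs_lt.1 (key _ (isStd_sub hV hc hs) (sub_pos.2 hcs))
        rw [WithTop.coe_le_coe]
        linarith
    · refine ⟨R.std_infty, fun c hc _ => ?_, fun c _ hc => absurd hc not_top_lt⟩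
      obtain ⟨n, hn, hn', h'⟩ := exists_std_nat_gt hV hc
      exact (WithTop.coe_le_coe.2 h'.le).trans (h n hn' hn)
  · rintro ⟨hu, h₁, h₂⟩
    induction u using WithTop.recTopCoe with
    | top => exact Or.inr ⟨rfl, fun n _ hn => h₁ n hn (WithTop.coe_lt_top n)⟩
    | coe s =>
      have hs : IsStd s.1 := hu
      have ht := h₂ (s + 1) (isStd_add hV hs (isStd_one hV))
        (WithTop.coe_lt_coe.2 (lt_add_one s))
      induction t using WithTop.recTopCoe with
      | top => exact absurd ht (not_le.2 (WithTop.coe_lt_top _))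
      | coe r =>
        refine Or.inl ⟨r, s, rfl, rfl, hs, fun n hn hns hn0 => ?_⟩
        have hnpos : 0 < n := lt_of_le_of_ne (nat_nonneg hn) (Ne.symm hn0)
        -- The order description gives only weak inequalities, so `1 / (n + 1)` is used to reach the
        -- strict bound by `1 / n`.
        have hδ : IsStd (1 / (n + 1)).1 :=
          isStd_div hV (isStd_one hV) (isStd_add hV hns (isStd_one hV))
        have hδ0 : 0 < 1 / (n + 1) := by positivity
        have hlt : 1 / (n + 1) < 1 / n := one_div_lt_one_div_of_lt hnpos (lt_add_one n)
        have h₃ := WithTop.coe_le_coe.1 (h₁ (s - 1 / (n + 1)) (isStd_sub hV hs hδ)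
          (WithTop.coe_lt_coe.2 (by linarith)))
        have h₄ := WithTop.coe_le_coe.1 (h₂ (s + 1 / (n + 1)) (isStd_add hV hs hδ)
          (WithTop.coe_lt_coe.2 (by linarith)))
        rw [abs_lt]
        constructor <;> linarith

theorem exists_std_betweenX {s t : R.Ext} (hs : IsStd (R.code s)) (ht : IsStd (R.code t))
    (h : s < t) : ∃ c : El R.carrier, IsStd c.1 ∧ s < c ∧ (c : R.Ext) < t := by
  induction s using WithTop.recTopCoe with
  | top => exact absurd h not_top_lt
  | coe s =>
    induction t using WithTop.recTopCoe with
    | top =>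
      exact ⟨s + 1, isStd_add hV hs (isStd_one hV), WithTop.coe_lt_coe.2 (lt_add_one s),
        WithTop.coe_lt_top _⟩
    | coe t =>
      obtain ⟨c, hc, h₁, h₂⟩ := exists_std_between hV hs ht (WithTop.coe_lt_coe.1 h)
      exact ⟨c, hc, WithTop.coe_lt_coe.2 h₁, WithTop.coe_lt_coe.2 h₂⟩

theorem IsShadow.mono {s t u v : R.Ext} (hs : R.IsShadow s u) (ht : R.IsShadow t v)
    (h : s ≤ t) : u ≤ v := by
  rw [isShadow_iff hV] at hs ht
  by_contra! hlt
  -- Two standard reals `c < d` are placed strictly between the shadows, since the comparisons with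
  -- `s` and `t` are only weak: they give `d ≤ s ≤ t ≤ c`.
  obtain ⟨c, hc, h₁, h₂⟩ := exists_std_betweenX hV ht.1 hs.1 hlt
  obtain ⟨d, hd, h₃, h₄⟩ := exists_std_betweenX hV (R := R) (s := (c : R.Ext)) hc hs.1 h₂
  have h₅ := hs.2.1 d hd h₄
  have h₆ := ht.2.2 c hc h₁
  exact absurd (h₃.trans_le (h₅.trans (h.trans h₆))) (lt_irrefl _)

theorem IsShadow.unique {t u v : R.Ext} (h : R.IsShadow t u) (h' : R.IsShadow t v) : u = v :=
  le_antisymm (h.mono hV h' le_rfl) (h'.mono hV h le_rfl)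

theorem isShadow_zero : R.IsShadow 0 0 :=
  (isShadow_iff hV).2 ⟨isStd_zero hV, fun _ _ h => h.le, fun _ _ h => h.le⟩

theorem IsShadow.nonneg {t u : R.Ext} (h : R.IsShadow t u) (ht : 0 ≤ t) : 0 ≤ u :=
  (isShadow_zero hV).mono hV h ht

theorem IsShadow.isStd {t u : R.Ext} (h : R.IsShadow t u) : IsStd (R.code u) :=
  ((isShadow_iff hV).1 h).1

/-- Standardization collects the standard reals below `t` into a standard set. If it is bounded, its
supremum is standard by Transfer and is the shadow; if not, `t` exceeds every standard real. -/
theorem exists_isShadow {t : R.Ext} (ht : 0 ≤ t) : ∃ u, R.IsShadow t u := by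
  obtain ⟨Q, hQ, hQt⟩ := standardize hV (P := fun x => ((R.decR x : El R.carrier) : R.Ext) ≤ t)
    D.auto R.carrier
  have hmem : ∀ c : El R.carrier, IsStd c.1 → (c.1 ∈ᵥ Q ↔ (c : R.Ext) ≤ t) := by
    intro c hc
    rw [hQt _ hc, R.decR_val]
    exact and_iff_right c.2
  by_cases hbd : ∃ b : El R.carrier, ∀ r : El R.carrier, r.1 ∈ᵥ Q → r ≤ b
  · obtain ⟨b, hb, hb₁, hb₂⟩ := exists_stdR hV (P := fun b : El R.carrier =>
      (∀ r : El R.carrier, r.1 ∈ᵥ Q → r ≤ b) ∧ ∀ c : El R.carrier,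
        (∀ r : El R.carrier, r.1 ∈ᵥ Q → r ≤ c) → b ≤ c) D.auto (by
      obtain ⟨b, hb⟩ := exists_isLUB (R := R) (P := fun r => r.1 ∈ᵥ Q) D.auto
        ⟨0, (hmem 0 (isStd_zero hV)).2 ht⟩ hbd
      exact ⟨b, fun r hr => hb.1 hr, fun c hc => hb.2 fun r hr => hc r hr⟩)
    refine ⟨b, (isShadow_iff hV).2 ⟨hb, fun c hc hcb => ?_, fun c hc hcb => ?_⟩⟩
    · rw [WithTop.coe_lt_coe] at hcb
      obtain ⟨q, hq, hqQ, hcq⟩ := exists_stdR hV (P := fun q : El R.carrier => q.1 ∈ᵥ Q ∧ c < q)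
        D.auto (by
          by_contra! h
          exact absurd (hb₂ c fun r hr => h r hr) (not_le.2 hcb))
      exact (WithTop.coe_le_coe.2 hcq.le).trans ((hmem q hq).1 hqQ)
    · rw [WithTop.coe_lt_coe] at hcb
      refine le_of_not_ge fun h => ?_
      exact absurd (hb₁ c ((hmem c hc).2 h)) (not_le.2 hcb)
  · refine ⟨⊤, (isShadow_iff hV).2 ⟨R.std_infty, fun c hc _ => ?_,
      fun c _ hc => absurd hc not_top_lt⟩⟩
    obtain ⟨q, hq, hqQ, hcq⟩ := exists_stdR hV (P := fun q : El R.carrier => q.1 ∈ᵥ Q ∧ c < q)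
      D.auto (by
        by_contra! h
        exact hbd ⟨c, h⟩)
    exact (WithTop.coe_le_coe.2 hcq.le).trans ((hmem q hq).1 hqQ)

theorem IsShadow.add {s t u v : R.Ext} (hs : R.IsShadow s u) (ht : R.IsShadow t v) (hs0 : 0 ≤ s)
    (ht0 : 0 ≤ t) : R.IsShadow (s + t) (u + v) := by
  rw [isShadow_iff hV] at *
  induction u using WithTop.recTopCoe with
  | top =>
    rw [top_add]
    refine ⟨R.std_infty, fun c hc _ => ?_, fun c _ hc => absurd hc not_top_lt⟩
    exact (hs.2.1 c hc (WithTop.coe_lt_top c)).trans (le_add_of_nonneg_right ht0)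
  | coe u =>
    induction v using WithTop.recTopCoe with
    | top =>
      rw [add_top]
      refine ⟨R.std_infty, fun c hc _ => ?_, fun c _ hc => absurd hc not_top_lt⟩
      exact (ht.2.1 c hc (WithTop.coe_lt_top c)).trans (le_add_of_nonneg_left hs0)
    | coe v =>
      obtain ⟨hu, hs₁, hs₂⟩ := hs
      obtain ⟨hv, ht₁, ht₂⟩ := ht
      have hu : IsStd u.1 := hu
      have hv : IsStd v.1 := hv
      -- Two is written as `1 + 1` so that its standardness follows from that of one.
      have h11 := isStd_add hV (isStd_one hV (R := R)) (isStd_one hV)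
      rw [← WithTop.coe_add]
      have hhalf : ∀ a : El R.carrier, a / (1 + 1) + a / (1 + 1) = a := fun a => by
        field_simp
      refine ⟨isStd_add hV hu hv, fun c hc h => ?_, fun c hc h => ?_⟩
      · rw [WithTop.coe_lt_coe] at h
        have hδ := isStd_div hV (isStd_sub hV (isStd_add hV hu hv) hc) h11
        have hpos : 0 < (u + v - c) / (1 + 1) := div_pos (sub_pos.2 h) (by positivity)
        have h₁ := hs₁ _ (isStd_sub hV hu hδ) (WithTop.coe_lt_coe.2 (by linarith))
        have h₂ := ht₁ _ (isStd_sub hV hv hδ) (WithTop.coe_lt_coe.2 (by linarith))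
        refine le_trans (le_of_eq ?_) (add_le_add h₁ h₂)
        rw [← WithTop.coe_add]
        congr 1
        linarith [hhalf (u + v - c)]
      · rw [WithTop.coe_lt_coe] at h
        have hδ := isStd_div hV (isStd_sub hV hc (isStd_add hV hu hv)) h11
        have hpos : 0 < (c - (u + v)) / (1 + 1) := div_pos (sub_pos.2 h) (by positivity)
        have h₁ := hs₂ _ (isStd_add hV hu hδ) (WithTop.coe_lt_coe.2 (by linarith))
        have h₂ := ht₂ _ (isStd_add hV hv hδ) (WithTop.coe_lt_coe.2 (by linarith))
        refine (add_le_add h₁ h₂).trans (le_of_eq ?_)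
        rw [← WithTop.coe_add]
        congr 1
        linarith [hhalf (c - (u + v))]

/-- The shadow of `t` is at most the standard real `s` if and only if `t ≤ s + 1 / (n + 1)` for
all standard natural numbers `n`. -/
theorem IsShadow.le_coe_iff {t u : R.Ext} (h : R.IsShadow t u) {s : El R.carrier}
    (hs : IsStd s.1) : u ≤ s ↔ ∀ n : El R.carrier, n.1 ∈ᵥ R.nat → IsStd n.1 →
      t ≤ ((s + 1 / (n + 1) : El R.carrier) : R.Ext) := by
  rw [isShadow_iff hV] at h
  constructor
  · intro hus n hn hns
    have hn0 := nat_nonneg hn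
    have : 0 < 1 / (n + 1) := by positivity
    exact h.2.2 _ (isStd_add hV hs (isStd_div hV (isStd_one hV) (isStd_add hV hns (isStd_one hV))))
      (hus.trans_lt (WithTop.coe_lt_coe.2 (by linarith)))
  · intro hn
    by_contra! hlt
    obtain ⟨c, hc, h₁, h₂⟩ := exists_std_betweenX hV (R := R) (s := (s : R.Ext)) hs h.1 hlt
    rw [WithTop.coe_lt_coe] at h₁
    obtain ⟨n, hns, hnn, hlt'⟩ := exists_std_nat_gt hV
      (isStd_div hV (isStd_one hV) (isStd_sub hV hc hs))
    have h₃ := (h.2.1 c hc h₂).trans (hn n hnn hns)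
    rw [WithTop.coe_le_coe] at h₃
    have hpos : 0 < c - s := sub_pos.2 h₁
    have hn0 := nat_nonneg hnn
    rw [div_lt_iff₀ hpos] at hlt'
    have h₄ : 1 / (n + 1) < c - s := by
      rw [div_lt_iff₀ (by positivity)]
      linarith
    linarith

end RealNumbers

end Nonstandard

/-! ## Codes of `w`-standard sets -/

section Codes

variable {V : Type u} [StUniverse V] [hZ : Fact (IsZFC V)] (hV : IsBST V)

theorem D.stdRel {σ : Type*} [Coded V σ] {I w : V} {a : σ → V}
    (ha : DF stMemLanguage (univ : Set V) a) :
    D stMemLanguage (univ : Set V) fun x => StdRel I w (a x) :=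
  D.comp (P := fun x => StdRel I w x) (by unfold StdRel; exact D.auto) ha

theorem D.isCodeOf {σ : Type*} [Coded V σ] {O I w : V} {a b : σ → V}
    (ha : DF stMemLanguage (univ : Set V) a) (hb : DF stMemLanguage (univ : Set V) b) :
    D stMemLanguage (univ : Set V) fun x => IsCodeOf O I w (a x) (b x) := by
  refine D.comp₂ (P := fun a b => IsCodeOf O I w a b) ?_ ha hb
  unfold IsCodeOf IsGermOf StdRel
  exact D.auto

/-- `F` is the standard set whose standard elements are the standard `g ∈ O ^ I` with
`g(w) = x`. -/
def IsGermAt (O I w x F : V) : Prop :=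
  IsStd F ∧ ∀ g, IsStd g → (g ∈ᵥ F ↔ IsFun g I O ∧ MapsV g w x)

/-- The germ depends on `f` only through its value at `w`, which allows codes to be described by
values instead of representatives. -/
theorem isGermOf_iff {O I w f x F : V} (hf : IsFun f I O) (hx : MapsV f w x) :
    IsGermOf O I w f F ↔ IsGermAt O I w x F := by
  refine and_congr_right fun _ => forall_congr' fun g => imp_congr_right fun _ =>
    iff_congr Iff.rfl (and_congr_right fun _ => ⟨?_, fun h => ⟨x, hx, h⟩⟩)
  rintro ⟨y, hy, hg⟩
  rwa [← hx.app_eq hf.1, hy.app_eq hf.1]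

variable {O I w : V} (hO : IsStd O) (hI : IsStd I) (hw : w ∈ᵥ I)

include hV hO hI hw

/-- The function witnessing that `x` is `w`-standard may take values outside `Y`; Transfer at `w`
provides one with values in `Y`. -/
theorem exists_std_maps {Y x : V} (hY : IsStd Y) (hx : StdRel I w x) (hxY : x ∈ᵥ Y) :
    ∃ f, IsStd f ∧ IsFun f I Y ∧ MapsV f w x := by
  obtain ⟨f, hf, hfun, rfl⟩ := exists_app_of_exists hV hI hw hY (P := fun y => y = x) D.auto
    ⟨x, hxY, rfl⟩
  exact ⟨f, hf, hfun, hfun.1.maps_app hw⟩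

theorem isCodeOf_iff {X A : V} : IsCodeOf O I w X A ↔ IsStd A ∧ ∀ F, IsStd F →
    (F ∈ᵥ A ↔ ∃ x, StdRel I w x ∧ x ∈ᵥ O ∧ x ∈ᵥ X ∧ IsGermAt O I w x F) := by
  refine and_congr_right fun _ => forall_congr' fun F => imp_congr_right fun _ =>
    iff_congr Iff.rfl ⟨?_, ?_⟩
  · rintro ⟨f, x, _, hf, hF, hfx, hxX, hx⟩
    exact ⟨x, hx, hf.2 w x hfx, hxX, (isGermOf_iff hf hfx).1 hF⟩
  · rintro ⟨x, hx, hxO, hxX, hF⟩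
    obtain ⟨f, hf, hfun, hfx⟩ := exists_std_maps hV hO hI hw hO hx hxO
    exact ⟨f, x, hf, hfun, (isGermOf_iff hfun hfx).2 hF, hfx, hxX, hx⟩

omit hO hI hw in
theorem exists_isGermAt (x : V) : ∃ F, IsGermAt O I w x F := by
  obtain ⟨F, hF, h⟩ := standardize hV (P := fun g => IsFun g I O ∧ MapsV g w x) D.auto (funs I O)
  refine ⟨F, hF, fun g hg => (h g hg).trans ?_⟩
  rw [mem_funs]
  tauto

/-- As `x` is a `w`-standard element of `O`, its germ has a standard representative, and the value
of that representative at `w` identifies the point. -/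
theorem IsGermAt.inj {x y F : V} (hx : StdRel I w x) (hxO : x ∈ᵥ O) (h : IsGermAt O I w x F)
    (h' : IsGermAt O I w y F) : x = y := by
  obtain ⟨f, hf, hfun, hfx⟩ := exists_std_maps hV hO hI hw hO hx hxO
  have hfy := ((h'.2 f hf).1 ((h.2 f hf).2 ⟨hfun, hfx⟩)).2
  rw [hfun.1.mapsV hw] at hfx hfy
  rw [hfx, hfy]

/-- This supplies the bound needed to form sets of germs by Standardization. -/
theorem IsGermAt.mem_powV {x F : V} (h : IsGermAt O I w x F) : F ∈ᵥ powV (funs I O) := by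
  rw [_root_.mem_powV]
  refine std_subV hV h.1 (isStd_of_eq hV D.auto) fun g hg hgF => ?_
  exact mem_funs.2 ((h.2 g hg).1 hgF).1

/-- All germs belong to one standard power set, so Standardization applies; a standard set is
determined by its standard elements. -/
theorem exists_isCodeOf (X : V) : ∃! A, IsCodeOf O I w X A := by
  simp only [isCodeOf_iff hV hO hI hw]
  obtain ⟨A, hA, h⟩ := standardize hV
    (P := fun F => ∃ x, StdRel I w x ∧ x ∈ᵥ O ∧ x ∈ᵥ X ∧ IsGermAt O I w x F)
    (by unfold IsGermAt StdRel; exact D.auto) (powV (funs I O))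
  have h' : ∀ F, IsStd F →
      (F ∈ᵥ A ↔ ∃ x, StdRel I w x ∧ x ∈ᵥ O ∧ x ∈ᵥ X ∧ IsGermAt O I w x F) := by
    refine fun F hF => (h F hF).trans ⟨fun h => h.2, fun h => ⟨?_, h⟩⟩
    obtain ⟨x, _, _, _, hx⟩ := h
    exact hx.mem_powV hV hO hI hw
  exact ⟨A, ⟨hA, h'⟩, fun A' hA' => std_ext hV hA'.1 hA fun F hF =>
    (hA'.2 F hF).trans (h' F hF).symm⟩

omit hV hO hI hw in
variable (O I w) in
/-- The code `[X]` of the set `X`. -/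
noncomputable def codeV (X : V) : V := the fun A => IsCodeOf O I w X A

theorem isCodeOf_codeV (X : V) : IsCodeOf O I w X (codeV O I w X) :=
  the_spec (exists_isCodeOf hV hO hI hw X)

theorem isCodeOf_iff_eq {X A : V} : IsCodeOf O I w X A ↔ A = codeV O I w X :=
  ⟨fun h => (exists_isCodeOf hV hO hI hw X).unique h (isCodeOf_codeV hV hO hI hw X),
    fun h => h ▸ isCodeOf_codeV hV hO hI hw X⟩

theorem isStd_codeV (X : V) : IsStd (codeV O I w X) := (isCodeOf_codeV hV hO hI hw X).1

theorem mem_codeV {X F : V} (hF : IsStd F) : F ∈ᵥ codeV O I w X ↔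
    ∃ x, StdRel I w x ∧ x ∈ᵥ O ∧ x ∈ᵥ X ∧ IsGermAt O I w x F :=
  ((isCodeOf_iff hV hO hI hw).1 (isCodeOf_codeV hV hO hI hw X)).2 F hF

theorem codeV_mem_powV (X : V) : codeV O I w X ∈ᵥ powV (powV (funs I O)) := by
  rw [mem_powV]
  refine std_subV hV (isStd_codeV hV hO hI hw X) (isStd_of_eq hV D.auto) fun F hF h => ?_
  obtain ⟨x, _, _, _, hx⟩ := (mem_codeV hV hO hI hw hF).1 h
  exact hx.mem_powV hV hO hI hw

theorem codeV_mono {X Y : V} (h : SubV X Y) : SubV (codeV O I w X) (codeV O I w Y) :=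
  std_subV hV (isStd_codeV hV hO hI hw X) (isStd_codeV hV hO hI hw Y) fun F hF hFX => by
    obtain ⟨x, h₁, h₂, h₃, h₄⟩ := (mem_codeV hV hO hI hw hF).1 hFX
    exact (mem_codeV hV hO hI hw hF).2 ⟨x, h₁, h₂, h x h₃, h₄⟩

/-- If inclusion fails, some `w`-standard element of `X` lies outside `Y`. Its germ belongs to the
code of `X`, and by injectivity of germs it cannot belong to the code of `Y`. -/
theorem subV_of_codeV_subV {X Y : V} (hX : StdRel I w X) (hY : StdRel I w Y) (hXO : SubV X O)
    (h : SubV (codeV O I w X) (codeV O I w Y)) : SubV X Y := by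
  by_contra hne
  obtain ⟨x, hx, hxX, hxY⟩ := exists_stdRel hV hI hw (P := fun x => x ∈ᵥ X ∧ ¬ x ∈ᵥ Y) D.auto (by
    unfold SubV at hne
    push Not at hne
    exact hne)
  obtain ⟨F, hF⟩ := exists_isGermAt hV (O := O) (I := I) (w := w) x
  obtain ⟨y, _, _, hyY, hyF⟩ := (mem_codeV hV hO hI hw hF.1).1
    (h F ((mem_codeV hV hO hI hw hF.1).2 ⟨x, hx, hXO x hxX, hxX, hF⟩))
  exact hxY (hF.inj hV hO hI hw hx (hXO x hxX) hyF ▸ hyY)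

theorem codeV_inj {X Y : V} (hX : StdRel I w X) (hY : StdRel I w Y) (hXO : SubV X O)
    (hYO : SubV Y O) (h : codeV O I w X = codeV O I w Y) : X = Y :=
  set_ext fun x => ⟨subV_of_codeV_subV hV hO hI hw hX hY hXO (fun _ h' => h ▸ h') x,
    subV_of_codeV_subV hV hO hI hw hY hX hYO (fun _ h' => h ▸ h') x⟩

theorem codeV_cup (X Y : V) :
    codeV O I w (cup X Y) = cup (codeV O I w X) (codeV O I w Y) := by
  have h₁ := isStd_codeV hV hO hI hw X
  have h₂ := isStd_codeV hV hO hI hw Y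
  refine std_ext hV (isStd_codeV hV hO hI hw _) (isStd_of_eq hV D.auto) fun F hF => ?_
  simp only [mem_cup, mem_codeV hV hO hI hw hF]
  constructor
  · rintro ⟨x, hx, hxO, h | h, hF⟩
    exacts [Or.inl ⟨x, hx, hxO, h, hF⟩, Or.inr ⟨x, hx, hxO, h, hF⟩]
  · rintro (⟨x, hx, hxO, h, hF⟩ | ⟨x, hx, hxO, h, hF⟩)
    exacts [⟨x, hx, hxO, Or.inl h, hF⟩, ⟨x, hx, hxO, Or.inr h, hF⟩]

/-- Unlike unions, differences need injectivity of germs: no other element of `Y` may have the same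
germ as a point outside `Y`. -/
theorem codeV_sdiffV (X Y : V) :
    codeV O I w (sdiffV X Y) = sdiffV (codeV O I w X) (codeV O I w Y) := by
  have h₁ := isStd_codeV hV hO hI hw X
  have h₂ := isStd_codeV hV hO hI hw Y
  refine std_ext hV (isStd_codeV hV hO hI hw _) (isStd_of_eq hV D.auto) fun F hF => ?_
  simp only [mem_sdiffV, mem_codeV hV hO hI hw hF]
  constructor
  · rintro ⟨x, hx, hxO, h, hF⟩
    refine ⟨⟨x, hx, hxO, h.1, hF⟩, ?_⟩
    rintro ⟨y, hy, hyO, hyY, hF'⟩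
    exact h.2 (hF.inj hV hO hI hw hx hxO hF' ▸ hyY)
  · rintro ⟨⟨x, hx, hxO, h, hF⟩, h'⟩
    exact ⟨x, hx, hxO, ⟨h, fun hxY => h' ⟨x, hx, hxO, hxY, hF⟩⟩, hF⟩

theorem codeV_emp : codeV O I w (emp V) = emp V := by
  have h : IsStd (emp V) := isStd_of_eq hV D.auto
  refine std_ext hV (isStd_codeV hV hO hI hw _) h fun F hF => ?_
  rw [mem_codeV hV hO hI hw hF]
  refine iff_of_false ?_ (notMem_emp F)
  rintro ⟨x, _, _, hx, _⟩
  exact notMem_emp x hx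

theorem exists_isCodedAlgebra (𝒜 : V) : ∃! B, IsCodedAlgebra O I w 𝒜 B := by
  obtain ⟨B, hB, h⟩ := standardize hV
    (P := fun A => ∃ X, X ∈ᵥ 𝒜 ∧ StdRel I w X ∧ IsCodeOf O I w X A)
    (D.ex (D.and D.auto (D.and (D.stdRel DF.id.snd) (D.isCodeOf DF.id.snd DF.id.fst))))
    (powV (powV (funs I O)))
  have h' : IsCodedAlgebra O I w 𝒜 B := by
    refine ⟨hB, fun A hA => (h A hA).trans ⟨fun h => h.2, fun h => ⟨?_, h⟩⟩⟩
    obtain ⟨X, _, _, hX⟩ := h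
    rw [(isCodeOf_iff_eq hV hO hI hw).1 hX]
    exact codeV_mem_powV hV hO hI hw X
  exact ⟨B, h', fun B' hB' => std_ext hV hB'.1 hB fun A hA =>
    (hB'.2 A hA).trans (h'.2 A hA).symm⟩

end Codes

/-! ## The coded measure -/

section CodedMeasure

variable {V : Type u} [StUniverse V] [hZ : Fact (IsZFC V)] (hV : IsBST V)
variable {R : RealNumbers V} {Ω 𝒜 μ O I w : V} (hμ : R.IsFinAddSpace Ω 𝒜 μ)
  (hO : IsStd O) (hΩO : SubV Ω O) (hI : IsStd I) (hw : w ∈ᵥ I)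

theorem D.isShadow {σ : Type*} [Coded V σ] {a b : σ → R.Ext}
    (ha : DF stMemLanguage (univ : Set V) a) (hb : DF stMemLanguage (univ : Set V) b) :
    D stMemLanguage (univ : Set V) fun x => R.IsShadow (a x) (b x) :=
  D.comp₂ (P := R.IsShadow) (by unfold RealNumbers.IsShadow; exact D.auto) ha hb

include hμ hΩO in
theorem subV_of_mem {X : V} (hX : X ∈ᵥ 𝒜) : SubV X O := fun x hx => hΩO x (hμ.alg.sub X hX x hx)

include hV hμ hO hΩO hI hw

/-- The relation between a code and the shadow of the measure is standardized to a standard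
function. Nonnegativity of its values is checked at standard codes and transferred. -/
theorem exists_isCodedMeasure {B : V} (hB : IsCodedAlgebra O I w 𝒜 B) :
    ∃ m, IsCodedMeasure R O I w 𝒜 μ B m := by
  have hBs := hB.1
  have hcod := fun X => isCodeOf_codeV hV hO hI hw X
  set b := cup R.carrier (upair R.infty R.infty) with hb
  have hbmem : ∀ y, y ∈ᵥ b ↔ ∃ t, y = R.code t := by
    intro y
    rw [hb, mem_cup, mem_upair, or_self, R.exists_code]
  have hbs : IsStd b := isStd_of_DF hV ((DF.constV R.std_carrier).cup
    ((DF.constV R.std_infty).upair (DF.constV R.std_infty)))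
  obtain ⟨m, hm, hmf, hmP⟩ := exists_std_fun hV (P := fun A y => ∃ (X : V) (t s : R.Ext),
      X ∈ᵥ 𝒜 ∧ StdRel I w X ∧ IsCodeOf O I w X A ∧ R.Val μ X t ∧ R.IsShadow t s ∧ y = R.code s)
    (D.ex (D.ex (D.ex (D.and D.auto (D.and (D.stdRel DF.id.fst.fst.snd) (D.and
      (D.isCodeOf DF.id.fst.fst.snd DF.id.fst.fst.fst.fst) (D.and D.auto (D.and
      (D.isShadow DF.id.fst.snd DF.id.snd) D.auto)))))))) hBs hbs (by
    intro A hA hAB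
    obtain ⟨X, hX, hXw, hXA⟩ := (hB.2 A hA).1 hAB
    obtain ⟨s, hs⟩ := RealNumbers.exists_isShadow hV (RealNumbers.ev_nonneg hμ.isExtFun hX)
    exact ⟨R.code s, hs.isStd hV, (hbmem _).2 ⟨s, rfl⟩, X, _, s, hX, hXw, hXA,
      RealNumbers.val_ev hμ.isExtFun hX, hs, rfl⟩)
  have hext : R.IsExtFun m B := by
    refine ⟨hmf.1, ?_⟩
    have : ∀ A, A ∈ᵥ B → ∃ t : R.Ext, 0 ≤ t ∧ app m A = R.code t := by
      refine transfer hV (P := fun A => A ∈ᵥ B → ∃ t : R.Ext, 0 ≤ t ∧ app m A = R.code t)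
        D.auto fun A hA hAB => ?_
      obtain ⟨X, t, s, hX, _, _, ht, hts, h⟩ := hmP A hA hAB
      rw [RealNumbers.val_iff_ev hμ.isExtFun hX] at ht
      exact ⟨s, hts.nonneg hV (ht ▸ RealNumbers.ev_nonneg hμ.isExtFun hX), h⟩
    intro A y hAy
    rw [← hAy.app_eq hmf.1]
    exact this A (hmf.1.mem_dom hAy)
  refine ⟨m, hm, hext, fun X A hX hXw hXA => ?_⟩
  have hAB : A ∈ᵥ B := (hB.2 A hXA.1).2 ⟨X, hX, hXw, hXA⟩
  obtain ⟨X', t, s, hX', hXw', hXA', ht, hts, h⟩ := hmP A hXA.1 hAB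
  rw [isCodeOf_iff_eq hV hO hI hw] at hXA hXA'
  -- Injectivity of the coding makes the value independent of the preimage chosen by
  -- Standardization.
  have e : X = X' := codeV_inj hV hO hI hw hXw hXw' (subV_of_mem hμ hΩO hX)
    (subV_of_mem hμ hΩO hX') (hXA.symm.trans hXA')
  subst e
  exact ⟨t, s, ht, hts, (hmf.1.mapsV hAB).2 h.symm⟩

omit hV hμ hO hΩO hI hw in
theorem IsCodedMeasure.val {B m : V} (hm : IsCodedMeasure R O I w 𝒜 μ B m)
    (hμ : R.IsFinAddSpace Ω 𝒜 μ) {X A : V} (hX : X ∈ᵥ 𝒜)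
    (hXw : StdRel I w X) (hA : IsCodeOf O I w X A) :
    A ∈ᵥ B ∧ R.IsShadow (R.ev μ X) (R.ev m A) := by
  obtain ⟨t, s, ht, hts, h⟩ := hm.2.2 X A hX hXw hA
  rw [RealNumbers.val_iff_ev hμ.isExtFun hX] at ht
  rw [← ht, h.ev_eq hm.2.1]
  exact ⟨hm.2.1.1.mem_dom h, hts⟩

theorem existsUnique_isCodedMeasure {B : V} (hB : IsCodedAlgebra O I w 𝒜 B) :
    ∃! m, IsCodedMeasure R O I w 𝒜 μ B m := by
  obtain ⟨m, hm⟩ := exists_isCodedMeasure hV hμ hO hΩO hI hw hB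
  refine ⟨m, hm, fun m' hm' => ?_⟩
  have hms := hm.1
  have hms' := hm'.1
  have hBs := hB.1
  refine hm'.2.1.1.ext hm.2.1.1 (transfer hV (P := fun A => A ∈ᵥ B → app m' A = app m A) D.auto
    fun A hA hAB => ?_)
  obtain ⟨X, hX, hXw, hXA⟩ := (hB.2 A hA).1 hAB
  have h₁ := (hm.val hμ hX hXw hXA).2
  have h₂ := (hm'.val hμ hX hXw hXA).2
  have h₃ := RealNumbers.val_ev hm.2.1 hAB
  rw [h₁.unique hV h₂] at h₃
  rw [MapsV.app_eq h₃ hm.2.1.1, MapsV.app_eq (RealNumbers.val_ev hm'.2.1 hAB) hm'.2.1.1]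

variable (hΩw : StdRel I w Ω)

include hΩw

/-- Standard members of `B` are codes, and coding commutes with differences and unions. The algebra
laws therefore hold at standard members, and Transfer extends them. -/
theorem isAlgebraOn_coded {B : V} (hB : IsCodedAlgebra O I w 𝒜 B) :
    RealNumbers.IsAlgebraOn (codeV O I w Ω) B := by
  have hBs := hB.1
  have hCs := isStd_codeV hV hO hI hw Ω
  have hmem : ∀ X, X ∈ᵥ 𝒜 → StdRel I w X → codeV O I w X ∈ᵥ B := fun X hX hXw =>
    (hB.2 _ (isStd_codeV hV hO hI hw X)).2 ⟨X, hX, hXw, isCodeOf_codeV hV hO hI hw X⟩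
  have hex : ∀ A, IsStd A → A ∈ᵥ B → ∃ X, X ∈ᵥ 𝒜 ∧ StdRel I w X ∧ A = codeV O I w X := by
    intro A hA hAB
    obtain ⟨X, hX, hXw, hXA⟩ := (hB.2 A hA).1 hAB
    exact ⟨X, hX, hXw, (isCodeOf_iff_eq hV hO hI hw).1 hXA⟩
  refine ⟨?_, hmem Ω hμ.alg.whole hΩw, ?_, ?_⟩
  · refine transfer hV (P := fun X => X ∈ᵥ B → SubV X (codeV O I w Ω)) D.auto fun A hA hAB => ?_
    obtain ⟨X, hX, hXw, rfl⟩ := hex A hA hAB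
    exact codeV_mono hV hO hI hw (hμ.alg.sub X hX)
  · have : ∀ A, A ∈ᵥ B → sdiffV (codeV O I w Ω) A ∈ᵥ B := by
      refine transfer hV (P := fun A => A ∈ᵥ B → sdiffV (codeV O I w Ω) A ∈ᵥ B) D.auto
        fun A hA hAB => ?_
      obtain ⟨X, hX, hXw, rfl⟩ := hex A hA hAB
      rw [← codeV_sdiffV hV hO hI hw]
      exact hmem _ (hμ.alg.diff_mem hX) (stdRel_of_eq hV hI hw D.auto)
    intro X Y hX hY
    rw [isDiffV_iff] at hY
    exact hY ▸ this X hX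
  · have : ∀ A, A ∈ᵥ B → ∀ A', A' ∈ᵥ B → cup A A' ∈ᵥ B := by
      refine transfer hV (P := fun A => A ∈ᵥ B → ∀ A', A' ∈ᵥ B → cup A A' ∈ᵥ B) D.auto
        fun A hA hAB => ?_
      refine transfer hV (P := fun A' => A' ∈ᵥ B → cup A A' ∈ᵥ B) D.auto fun A' hA' hAB' => ?_
      obtain ⟨X, hX, hXw, rfl⟩ := hex A hA hAB
      obtain ⟨Y, hY, hYw, rfl⟩ := hex A' hA' hAB'
      rw [← codeV_cup hV hO hI hw]
      exact hmem _ (hμ.alg.cup_mem hX hY) (stdRel_of_eq hV hI hw D.auto)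
    intro X Y Z hX hY hZ
    rw [isUnionV_iff] at hZ
    exact hZ ▸ this X hX Y hY

theorem isFinAddSpace_coded {B m : V} (hB : IsCodedAlgebra O I w 𝒜 B)
    (hm : IsCodedMeasure R O I w 𝒜 μ B m) : R.IsFinAddSpace (codeV O I w Ω) B m := by
  have halg := isAlgebraOn_coded hV hμ hO hΩO hI hw hΩw hB
  have hBs := hB.1
  have hms := hm.1
  have hval : ∀ X, X ∈ᵥ 𝒜 → StdRel I w X →
      R.IsShadow (R.ev μ X) (R.ev m (codeV O I w X)) := fun X hX hXw =>
    (hm.val hμ hX hXw (isCodeOf_codeV hV hO hI hw X)).2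
  refine ⟨halg, hm.2.1, ?_, ?_⟩
  · intro E hE
    rw [emptyV_iff] at hE
    subst hE
    rw [RealNumbers.val_iff_ev hm.2.1 halg.emp_mem, ← codeV_emp hV hO hI hw]
    have := hval _ hμ.alg.emp_mem (stdRel_of_eq hV hI hw D.auto)
    rw [hμ.ev_emp] at this
    exact (RealNumbers.isShadow_zero hV).unique hV this
  · have : ∀ A, A ∈ᵥ B → ∀ A', A' ∈ᵥ B → DisjV A A' →
        R.ev m (cup A A') = R.ev m A + R.ev m A' := by
      refine transfer hV (P := fun A => A ∈ᵥ B → ∀ A', A' ∈ᵥ B → DisjV A A' →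
        R.ev m (cup A A') = R.ev m A + R.ev m A') D.auto fun A hA hAB => ?_
      refine transfer hV (P := fun A' => A' ∈ᵥ B → DisjV A A' →
        R.ev m (cup A A') = R.ev m A + R.ev m A') D.auto fun A' hA' hAB' hd => ?_
      obtain ⟨X, hX, hXw, hXA⟩ := (hB.2 A hA).1 hAB
      obtain ⟨Y, hY, hYw, hYA⟩ := (hB.2 A' hA').1 hAB'
      rw [isCodeOf_iff_eq hV hO hI hw] at hXA hYA
      subst hXA hYA
      -- Disjointness of the codes says that `[X]` is contained in `[X] \ [Y] = [X \ Y]`, which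
      -- reflects to the sets themselves.
      have hXY : DisjV X Y := by
        intro x hx
        have h := subV_of_codeV_subV hV hO hI hw (X := X) (Y := sdiffV X Y) hXw
          (stdRel_of_eq hV hI hw D.auto) (subV_of_mem hμ hΩO hX) (by
            rw [codeV_sdiffV hV hO hI hw]
            intro F hF
            exact mem_sdiffV.2 ⟨hF, fun hF' => hd F ⟨hF, hF'⟩⟩) x hx.1
        exact (mem_sdiffV.1 h).2 hx.2
      have h := hval _ (hμ.alg.cup_mem hX hY) (stdRel_of_eq hV hI hw D.auto)
      rw [hμ.ev_cup hX hY hXY, codeV_cup hV hO hI hw] at h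
      exact h.unique hV ((hval X hX hXw).add hV (hval Y hY hYw)
        (RealNumbers.ev_nonneg hμ.isExtFun hX) (RealNumbers.ev_nonneg hμ.isExtFun hY))
    intro X Y Z x y hX hY hd hZ hx hy
    rw [isUnionV_iff] at hZ
    subst hZ
    rw [RealNumbers.val_iff_ev hm.2.1 (halg.cup_mem hX hY), this X hX Y hY hd, hx.ev_eq hm.2.1,
      hy.ev_eq hm.2.1]

variable (hgood : Good R I w) (h𝒜w : StdRel I w 𝒜) (hμw : StdRel I w μ)

include hgood h𝒜w hμw

/-- Bounded increasing standard sequences have upper bounds by `ℵ₁`-saturation of the `w`-standard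
sets. -/
theorem exists_bound_of_isStd {B m A : V} {t : El R.carrier} (hB : IsCodedAlgebra O I w 𝒜 B)
    (hm : IsCodedMeasure R O I w 𝒜 μ B m) (hA : IsStd A) (ht : IsStd t.1) (hAB : IsFun A R.nat B)
    (hmono : ∀ k : El R.carrier, k.1 ∈ᵥ R.nat → SubV (app A k.1) (app A (k + 1).1))
    (hle : ∀ k : El R.carrier, k.1 ∈ᵥ R.nat → R.ev m (app A k.1) ≤ t) :
    ∃ U, U ∈ᵥ B ∧ (∀ k : El R.carrier, k.1 ∈ᵥ R.nat → SubV (app A k.1) U) ∧ R.ev m U ≤ t := by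
  have hww : StdRel I w w := stdRel_of_eq hV hI hw (D.eq DF.id (DF.constV_mem (mem_insert w _)))
  -- A single standard sequence of functions represents all sets coded by the `A_k` with standard
  -- `k`. The sequence `Φ_k(w)` is thereby defined from `w` for nonstandard `k` too.
  obtain ⟨Φ, hΦ, hΦf, hΦA⟩ := exists_std_fun hV
    (P := fun k f => app f w ∈ᵥ 𝒜 ∧ StdRel I w (app f w) ∧ IsCodeOf O I w (app f w) (app A k))
    (D.and D.auto (D.and (D.stdRel (DF.app DF.id.snd (DF.const_univ w)))
      (D.isCodeOf (DF.app DF.id.snd (DF.const_univ w))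
      (DF.app (DF.const_univ A) DF.id.fst)))) R.std_nat
    (b := funs I (powV O)) (isStd_of_eq hV D.auto) (by
    intro k hk hkn
    obtain ⟨X, hX, hXw, hXA⟩ := (hB.2 _ (isStd_app hV hA hk)).1 (hAB.app_mem hkn)
    obtain ⟨f, hf, hfun, hfX⟩ := exists_std_maps hV hO hI hw (Y := powV O)
      (isStd_of_eq hV D.auto) hXw (mem_powV.2 (subV_of_mem hμ hΩO hX))
    have e := hfX.app_eq hfun.1
    subst e
    exact ⟨f, hf, mem_funs.2 hfun, hX, hXw, hXA⟩)
  have hX : ∀ k : El R.carrier, k.1 ∈ᵥ R.nat → IsStd k.1 → app (app Φ k.1) w ∈ᵥ 𝒜 ∧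
      StdRel I w (app (app Φ k.1) w) ∧ app A k.1 = codeV O I w (app (app Φ k.1) w) := by
    intro k hk hks
    obtain ⟨h₁, h₂, h₃⟩ := hΦA k.1 hks hk
    exact ⟨h₁, h₂, (isCodeOf_iff_eq hV hO hI hw).1 h₃⟩
  have hmono' : ∀ k : El R.carrier, k.1 ∈ᵥ R.nat → ∀ j : El R.carrier, j.1 ∈ᵥ R.nat → j ≤ k →
      SubV (app A j.1) (app A k.1) := by
    refine RealNumbers.nat_induction (P := fun k => ∀ j : El R.carrier, j.1 ∈ᵥ R.nat → j ≤ k →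
      SubV (app A j.1) (app A k.1)) D.auto (fun j hj h => ?_) (fun k hk ih j hj h => ?_)
    · rw [le_antisymm h (RealNumbers.nat_nonneg hj)]
      exact fun _ h => h
    · rcases (RealNumbers.nat_le_succ hj hk).1 h with h | rfl
      · exact fun x hx => hmono k hk x (ih j hj h x hx)
      · exact fun _ h => h
  -- These conditions are internal, unlike the coding relation. A slack `1 / (k + 1)` is available
  -- at every standard `k` because the shadow is at most `t`, and at an index above all standard
  -- numbers it no longer affects the shadow.
  let good : El R.carrier → Prop := fun n => ∀ k : El R.carrier, k.1 ∈ᵥ R.nat → k ≤ n →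
    app (app Φ k.1) w ∈ᵥ 𝒜 ∧ (∀ j : El R.carrier, j.1 ∈ᵥ R.nat → j ≤ k →
      SubV (app (app Φ j.1) w) (app (app Φ k.1) w)) ∧
      R.ev μ (app (app Φ k.1) w) ≤ ((t + 1 / (k + 1) : El R.carrier) : R.Ext)
  have hstd : ∀ n : El R.carrier, n.1 ∈ᵥ R.nat → IsStd n.1 → good n := by
    intro n hn hns k hk hkn
    have hks := RealNumbers.isStd_of_le hV hn hns hk hkn
    obtain ⟨h₁, h₂, h₃⟩ := hX k hk hks
    refine ⟨h₁, fun j hj hjk => ?_, ?_⟩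
    · obtain ⟨h₁', h₂', h₃'⟩ := hX j hj (RealNumbers.isStd_of_le hV hk hks hj hjk)
      refine subV_of_codeV_subV hV hO hI hw h₂' h₂ (subV_of_mem hμ hΩO h₁') ?_
      rw [← h₃, ← h₃']
      exact hmono' k hk j hj hjk
    · have hsh := (hm.val hμ h₁ h₂ (isCodeOf_codeV hV hO hI hw _)).2
      rw [← h₃] at hsh
      exact (hsh.le_coe_iff hV ht).1 (hle k hk) k hk hks
  obtain ⟨ν, hν, hνw, hνs⟩ := hgood
  obtain ⟨ν, rfl⟩ : ∃ l : El R.carrier, l.1 = ν := ⟨⟨ν, R.nat_sub ν hν⟩, rfl⟩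
  have hlt : ∀ k : El R.carrier, k.1 ∈ᵥ R.nat → IsStd k.1 → k ≤ ν := fun k hk hks =>
    le_of_not_ge fun h => hνs (RealNumbers.isStd_of_le hV hk hks hν h)
  -- Overspill in the form of a maximum: every standard number is good and below `ν`, so the largest
  -- good number up to `ν` lies above all of them.
  obtain ⟨n, hn, hnν, hgn, hmax⟩ := RealNumbers.exists_max_nat (P := good) D.auto
    (hstd 0 R.zero_mem_nat (RealNumbers.isStd_zero hV)) hν
  -- The index must be `w`-standard for `Φ_n(w)` to have its code in `B`. The maximality property
  -- involves only standard objects, `w` and `w`-standard objects, so it has a `w`-standard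
  -- solution.
  obtain ⟨x, hxw, hxn, hxν, hxg, hxmax⟩ := exists_stdRel hV hI hw
    (P := fun x => x ∈ᵥ R.nat ∧ R.decR x ≤ ν ∧ good (R.decR x) ∧ ∀ k : El R.carrier,
      k.1 ∈ᵥ R.nat → k ≤ ν → good k → k ≤ R.decR x) D.auto
    ⟨n.1, hn, by rwa [R.decR_val], by rwa [R.decR_val], by rwa [R.decR_val]⟩
  obtain ⟨n, rfl⟩ : ∃ l : El R.carrier, l.1 = x := ⟨⟨x, R.nat_sub x hxn⟩, rfl⟩
  rw [R.decR_val] at hxν hxg hxmax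
  obtain ⟨h₁, h₂, h₃⟩ := hxg n hxn le_rfl
  have hlen : ∀ k : El R.carrier, k.1 ∈ᵥ R.nat → IsStd k.1 → k ≤ n := fun k hk hks =>
    hxmax k hk (hlt k hk hks) (hstd k hk hks)
  have hUw : StdRel I w (app (app Φ n.1) w) := stdRel_of_eq hV hI hw D.auto
  have hUs := isStd_codeV hV hO hI hw (app (app Φ n.1) w)
  obtain ⟨hUB, hsh⟩ := hm.val hμ h₁ hUw (isCodeOf_codeV hV hO hI hw _)
  refine ⟨codeV O I w (app (app Φ n.1) w), hUB, ?_, ?_⟩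
  · refine RealNumbers.transferR hV (P := fun k => k.1 ∈ᵥ R.nat →
      SubV (app A k.1) (codeV O I w (app (app Φ n.1) w))) D.auto fun k hks hk => ?_
    rw [(hX k hk hks).2.2]
    exact codeV_mono hV hO hI hw (h₂ k hk (hlen k hk hks))
  · refine (hsh.le_coe_iff hV ht).2 fun k hk hks => h₃.trans (WithTop.coe_le_coe.2 ?_)
    have hk0 := RealNumbers.nat_nonneg hk
    have := one_div_le_one_div_of_le (show 0 < k + 1 by positivity)
      (add_le_add_left (hlen k hk hks) 1)
    linarith

/-- The statement for standard sequences and bounds is internal with standard parameters, so it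
transfers, first in the sequence and then in the bound. -/
theorem increasingBounded_coded {B m : V} (hB : IsCodedAlgebra O I w 𝒜 B)
    (hm : IsCodedMeasure R O I w 𝒜 μ B m) : R.IncreasingBounded B m := by
  have hBs := hB.1
  have hms := hm.1
  refine transfer hV (P := fun A => ∀ t : El R.carrier, IsFun A R.nat B →
    (∀ k : El R.carrier, k.1 ∈ᵥ R.nat → SubV (app A k.1) (app A (k + 1).1)) →
    (∀ k : El R.carrier, k.1 ∈ᵥ R.nat → R.ev m (app A k.1) ≤ t) →
    ∃ U, U ∈ᵥ B ∧ (∀ k : El R.carrier, k.1 ∈ᵥ R.nat → SubV (app A k.1) U) ∧ R.ev m U ≤ t)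
    D.auto fun A hA => ?_
  exact RealNumbers.transferR hV (P := fun t => IsFun A R.nat B →
    (∀ k : El R.carrier, k.1 ∈ᵥ R.nat → SubV (app A k.1) (app A (k + 1).1)) →
    (∀ k : El R.carrier, k.1 ∈ᵥ R.nat → R.ev m (app A k.1) ≤ t) →
    ∃ U, U ∈ᵥ B ∧ (∀ k : El R.carrier, k.1 ∈ᵥ R.nat → SubV (app A k.1) U) ∧ R.ev m U ≤ t)
    D.auto fun t ht => exists_bound_of_isStd hV hμ hO hΩO hI hw hΩw hgood h𝒜w hμw hB hm hA ht

end CodedMeasure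

/-! ### The main theorem -/

theorem mainTheorem8 {V : Type u} [StUniverse V] (hV : IsBST V) (R : RealNumbers V)
    (Ω 𝒜 μ O I w : V)
    (hμ : R.IsFinAddSpace Ω 𝒜 μ)
    (hO : IsStd O) (hΩO : SubV Ω O)
    (hI : IsStd I) (hw : w ∈ᵥ I) (hgood : Good R I w)
    (hΩw : StdRel I w Ω) (h𝒜w : StdRel I w 𝒜) (hμw : StdRel I w μ) :
    (∀ X, X ∈ᵥ 𝒜 → StdRel I w X → ∃! A, IsCodeOf O I w X A) ∧
    (∃! B, IsCodedAlgebra O I w 𝒜 B) ∧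
    ∀ C B, IsCodeOf O I w Ω C → IsCodedAlgebra O I w 𝒜 B →
      (∃! m, IsCodedMeasure R O I w 𝒜 μ B m) ∧
      ∀ m, IsCodedMeasure R O I w 𝒜 μ B m →
        R.IsFinAddSpace C B m ∧
        R.CountablyAdditive B m ∧
        ∃ S m₁ S' m₂ : V, IsStd S ∧ IsStd m₁ ∧ IsStd S' ∧ IsStd m₂ ∧
          R.IsGeneratedBy C B S ∧
          R.IsMeasureSpaceOn C S m₁ ∧
          (∀ (A : V) (t : R.Ext), A ∈ᵥ B → R.Val m A t → R.Val m₁ A t) ∧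
          R.IsCompletionOf S' m₂ S m₁ ∧
          R.IsMeasureSpaceOn C S' m₂ ∧
          R.IsCompleteMeasure S' m₂ ∧
          (∀ (A : V) (t : R.Ext), A ∈ᵥ S → R.Val m₁ A t → R.Val m₂ A t) := by
  have : Fact (IsZFC V) := ⟨hV.toIsZFC⟩
  refine ⟨fun X _ _ => exists_isCodeOf hV hO hI hw X, exists_isCodedAlgebra hV hO hI hw 𝒜,
    fun C B hC hB => ⟨existsUnique_isCodedMeasure hV hμ hO hΩO hI hw hB, fun m hm => ?_⟩⟩
  have hCs := hC.1
  rw [isCodeOf_iff_eq hV hO hI hw] at hC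
  subst hC
  set C := codeV O I w Ω
  have hfin := isFinAddSpace_coded hV hμ hO hΩO hI hw hΩw hB hm
  have hbdd := increasingBounded_coded hV hμ hO hΩO hI hw hΩw hgood h𝒜w hμw hB hm
  have hgen := RealNumbers.isSigmaAlgebraOn_genSigma (R := R) hfin.alg.sub
  -- The measurable sets form a σ-algebra containing `B`, so minimality places the generated
  -- σ-algebra inside it.
  have hSc : SubV (R.genSigma C B) (R.caraV C B m) :=
    hgen.least _ (RealNumbers.isSigmaAlgebraOn_caraV hfin hbdd) (RealNumbers.subV_caraV hfin)
  have hcompl := RealNumbers.isCompletionOf_completionV hfin hgen.sigma.alg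
  have hS : DF memLanguage (StdSet V) fun _ : V => R.genSigma C B :=
    DF.genSigma (DF.constV hCs) (DF.constV hB.1)
  have hm₁ : DF memLanguage (StdSet V) fun _ : V => R.outerFun (R.genSigma C B) B m :=
    DF.outerFun hS (DF.constV hB.1) (DF.constV hm.1)
  have hS' := DF.completionV (R := R) (DF.constV hCs) hS hm₁
  have hm₂ := DF.outerFun (R := R) hS' (DF.constV hB.1) (DF.constV hm.1)
  refine ⟨hfin, hfin.countablyAdditive hbdd, _, _, _, _, isStd_of_DF hV hS, isStd_of_DF hV hm₁,
    isStd_of_DF hV hS', isStd_of_DF hV hm₂, hgen,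
    RealNumbers.isMeasureSpaceOn_outerFun hfin hbdd hgen.sigma hSc, fun A t hA ht => ?_, hcompl,
    RealNumbers.isMeasureSpaceOn_outerFun hfin hbdd
      (RealNumbers.isSigmaAlgebraOn_completionV hfin hbdd hgen.sigma)
      (RealNumbers.completionV_subV_caraV hfin hgen.sigma.alg hSc),
    RealNumbers.isCompleteMeasure_completionV hfin hgen.sigma.alg, fun A t hA ht => ?_⟩
  · rw [RealNumbers.val_outerFun hfin, RealNumbers.outer_eq hfin hA, ht.ev_eq hfin.isExtFun]
    exact ⟨hgen.sub A hA, rfl⟩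
  -- A measurable set is squeezed between itself and itself, with empty gap.
  · refine hcompl.val A A A t ((RealNumbers.squeezed_iff hfin hgen.sigma.alg).2
      ⟨hA, hA, fun _ h => h, fun _ h => h, ?_⟩) ht
    rw [emptyV_iff.1 (fun x hx => (mem_sdiffV.1 hx).2 (mem_sdiffV.1 hx).1),
      RealNumbers.outer_emp hfin]
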